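/- Let $M^n$ be a simply connected smooth manifold, let $f\colon M^n\to\mathbb{R}^{n+p}$ be a smooth immersion, and endow $M$ with the induced metric. Denote by $\alpha$ the second fundamental form of $f$, by $\nabla^\perp$ its normal connection, by $A_\xi$ its shape operators, and let $\nabla$ and $\mathrm{Hess}$ be the gradient and the Hessian (as an endomorphism of the tangent bundle) in the induced metric. Let $\varphi_1,\dots,\varphi_m$ be smooth functions on $M$ and $\beta_1,\dots,\beta_m$ smooth normal vector fields of $f$ such that $$\alpha(X,\nabla\varphi_i)+\nabla^\perp_X\beta_i=0\quad\text{for all tangent vectors } X,\qquad [\Phi_i,\Phi_j]=0,\qquad 1\le i,j\le m,$$ where $\Phi_i=\mathrm{Hess}\,\varphi_i-A_{\beta_i}$. Let $\mathcal{G}$ be the $(n+p)\times m$ matrix valued map on $M$ with columns $f_*\nabla\varphi_i+\beta_i$, and let $\varphi=(\varphi_1,\dots,\varphi_m)^t$. Then every point of $M$ has an open neighbourhood $U$ carrying a smooth map $\Omega\colon U\to GL(\mathbb{R}^m)$ with $$d\Omega=\mathcal{G}^t\,d\mathcal{G}\quad\text{and}\quad \Omega+\Omega^t=\mathcal{G}^t\mathcal{G}+I.\qquad(*)$$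 Moreover, for every open $U\subset M$ and every smooth $\Omega\colon U\to GL(\mathbb{R}^m)$ satisfying $(*)$, the set of regular points of the map $$\tilde f=(f-\mathcal{G}\Omega^{-1}\varphi,\,-\Omega^{-1}\varphi)\colon U\to\mathbb{R}^{n+p}\oplus\mathbb{R}^m=\mathbb{R}^{n+p+m}$$ (the points where its differential is injective) is open, and on it $\tilde f$ is an immersion carrying a parallel flat normal subbundle of rank $m$, that is, a smooth rank $m$ subbundle of the normal bundle that is invariant under the normal connection and on which the normal connection has vanishing curvature. Conversely, let $g\colon M^n\to\mathbb{R}^{n+p}\oplus\mathbb{R}^m$ be a smooth immersion of a smooth manifold (not necessarily simply connected) carrying a parallel flat normal subbundle of rank $m$. Then every point of $M$ has a simply connected open neighbourhood $U$ on which, after a translation of $\mathbb{R}^{n+p+m}$ by a vector of $\mathbb{R}^m$, $g$ is of the above form: there are $c\in\mathbb{R}^m$, an immersion $f\colon U\to\mathbb{R}^{n+p}$, functions $\varphi_i$ and normal fields $\beta_i$ on $U$ satisfying all the above conditions, and a smooth $\Omega\colon U\to GL(\mathbb{R}^m)$ satisfying $(*)$, such that $g+(0,c)=(f-\mathcal{G}\Omega^{-1}\varphi,\,-\Omega^{-1}\varphi)$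 on $U$. -/

import Mathlib

open scoped Manifold ContDiff

/-! Submanifolds of Euclidean space.  `M` is an `n`-dimensional smooth manifold and `F` a finite
dimensional Euclidean vector space.  All objects are considered on open subsets of `M`; maps are
defined on all of `M`, but only their restriction to the open subset matters. -/

noncomputable section

namespace EuclSubmfd

section Basic

variable {n : ℕ} {M : Type*} [TopologicalSpace M] [ChartedSpace (EuclideanSpace ℝ (Fin n)) M]

/-- The differential at `x` of a vector valued map `η` on `M`; for a section `η` of the trivial
bundle `f^* T F` this is the Euclidean derivative `X ↦ ∇̄_X η`. -/
def diff {G : Type*} [NormedAddCommGroup G] [NormedSpace ℝ G] (η : M → G) (x : M) :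
    TangentSpace (𝓡 n) x →ₗ[ℝ] G :=
  (mfderiv (𝓡 n) 𝓘(ℝ, G) η x).toLinearMap

/-- A family of tangent vectors is a smooth vector field on the set `U`. -/
def IsSmoothVectorField [IsManifold (𝓡 n) ∞ M] (X : ∀ x : M, TangentSpace (𝓡 n) x)
    (U : Set M) : Prop :=
  ContMDiffOn (𝓡 n) (𝓡 n).tangent ∞ (fun x => (⟨x, X x⟩ : TangentBundle (𝓡 n) M)) U

variable {F : Type*} [NormedAddCommGroup F] [InnerProductSpace ℝ F]

/-- `f` is a smooth immersion of the open set `U` into `F`. -/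
structure IsSmoothImmersionOn (f : M → F) (U : Set M) : Prop where
  smooth : ContMDiffOn (𝓡 n) 𝓘(ℝ, F) ∞ f U
  injective : ∀ x ∈ U, Function.Injective (diff (n := n) f x)

/-- The metric induced by `f`: `⟨X, Y⟩ = ⟨f_* X, f_* Y⟩`. -/
def metric (f : M → F) (x : M) : LinearMap.BilinForm ℝ (TangentSpace (𝓡 n) x) :=
  (innerₗ F).compl₁₂ (diff f x) (diff f x)

open Classical in
/-- The tangent vector `Z` with `⟨Z, X⟩ = ℓ X` for all `X`, in the metric induced by `f`
(and `0` if that metric is degenerate, that is, if `f` is not an immersion at `x`). -/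
def sharp (f : M → F) (x : M) :
    Module.Dual ℝ (TangentSpace (𝓡 n) x) →ₗ[ℝ] TangentSpace (𝓡 n) x :=
  haveI : FiniteDimensional ℝ (TangentSpace (𝓡 n) x) :=
    inferInstanceAs (FiniteDimensional ℝ (EuclideanSpace ℝ (Fin n)))
  if h : (metric (n := n) f x).Nondegenerate then
    ((metric (n := n) f x).toDual h).symm.toLinearMap
  else 0

/-- The gradient `∇φ` of a function, in the metric induced by `f`. -/
def grad (f : M → F) (φ : M → ℝ) (x : M) : TangentSpace (𝓡 n) x :=
  sharp f x (diff φ x)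

/-- The tangential component of `v ∈ F`, as a tangent vector of `M`: the vector `Z` with
`⟨Z, X⟩ = ⟨v, f_* X⟩` for all `X`. -/
def tangentPart (f : M → F) (x : M) : F →ₗ[ℝ] TangentSpace (𝓡 n) x :=
  sharp f x ∘ₗ (innerₗ F).compl₂ (diff f x)

/-- The normal component of `v ∈ F`. -/
def normalPart (f : M → F) (x : M) : F →ₗ[ℝ] F :=
  LinearMap.id - diff f x ∘ₗ tangentPart (n := n) f x

/-- The map `f_* Y` for a vector field `Y`. -/
def pushforward (f : M → F) (Y : ∀ x : M, TangentSpace (𝓡 n) x) (x : M) : F :=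
  diff f x (Y x)

/-- The Levi-Civita connection of the induced metric: `X ↦ ∇_X Y` is the tangential component of
the Euclidean derivative of `f_* Y` (Gauss formula). -/
def leviCivita (f : M → F) (Y : ∀ x : M, TangentSpace (𝓡 n) x) (x : M) :
    Module.End ℝ (TangentSpace (𝓡 n) x) :=
  tangentPart f x ∘ₗ diff (pushforward f Y) x

/-- The second fundamental form: `X ↦ α(X, Y)` is the normal component of the Euclidean derivative
of `f_* Y` (Gauss formula). -/
def secondFundForm (f : M → F) (Y : ∀ x : M, TangentSpace (𝓡 n) x) (x : M) :
    TangentSpace (𝓡 n) x →ₗ[ℝ] F :=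
  normalPart (n := n) f x ∘ₗ diff (pushforward f Y) x

/-- The normal connection: `X ↦ ∇^⊥_X ξ` is the normal component of the Euclidean derivative of
the normal field `ξ` (Weingarten formula). -/
def normalConn (f : M → F) (ξ : M → F) (x : M) : TangentSpace (𝓡 n) x →ₗ[ℝ] F :=
  normalPart (n := n) f x ∘ₗ diff ξ x

/-- The shape operator `A_ξ` of a normal field `ξ`: `A_ξ X` is minus the tangential component of
the Euclidean derivative of `ξ` (Weingarten formula). -/
def shapeOp (f : M → F) (ξ : M → F) (x : M) : Module.End ℝ (TangentSpace (𝓡 n) x) :=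
  -(tangentPart f x ∘ₗ diff ξ x)

/-- The Hessian `X ↦ ∇_X ∇φ`, in the metric induced by `f`. -/
def hess (f : M → F) (φ : M → ℝ) (x : M) : Module.End ℝ (TangentSpace (𝓡 n) x) :=
  leviCivita f (grad f φ) x

/-- The curvature of the normal connection:
`R^⊥(X, Y) ξ = ∇^⊥_X ∇^⊥_Y ξ - ∇^⊥_Y ∇^⊥_X ξ - ∇^⊥_{[X, Y]} ξ`. -/
def normalCurvature (f : M → F) (X Y : ∀ x : M, TangentSpace (𝓡 n) x) (ξ : M → F) (x : M) : F :=
  normalConn f (fun y => normalConn f ξ y (Y y)) x (X x)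
    - normalConn f (fun y => normalConn f ξ y (X y)) x (Y x)
    - normalConn f ξ x (VectorField.mlieBracket (𝓡 n) X Y x)

/-- `ξ` is a normal vector field of `f` on `U`, smooth on `U`. -/
structure IsNormalField (f : M → F) (U : Set M) (ξ : M → F) : Prop where
  smooth : ContMDiffOn (𝓡 n) 𝓘(ℝ, F) ∞ ξ U
  normal : ∀ x ∈ U, ∀ X : TangentSpace (𝓡 n) x, inner ℝ (ξ x) (diff f x X) = 0

/-- `ξ` is a smooth section over `U` of the family of subspaces `E`. -/
structure IsSection (E : M → Submodule ℝ F) (U : Set M) (ξ : M → F) : Prop where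
  smooth : ContMDiffOn (𝓡 n) 𝓘(ℝ, F) ∞ ξ U
  mem : ∀ x ∈ U, ξ x ∈ E x

/-- Over the open set `U`, the family `E` is a smooth subbundle of rank `m` of the normal bundle
of `f` which is parallel (invariant under the normal connection) and flat (the normal connection
restricted to `E` has vanishing curvature). -/
structure IsParallelFlatNormalSubbundle [IsManifold (𝓡 n) ∞ M] (f : M → F) (U : Set M) (m : ℕ)
    (E : M → Submodule ℝ F) : Prop where
  normal : ∀ x ∈ U, ∀ v ∈ E x, ∀ X : TangentSpace (𝓡 n) x, inner ℝ v (diff f x X) = 0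
  rank : ∀ x ∈ U, Module.finrank ℝ (E x) = m
  smooth : ∀ x ∈ U, ∃ W : Set M, IsOpen W ∧ x ∈ W ∧ W ⊆ U ∧ ∃ s : Fin m → M → F,
    (∀ i, ContMDiffOn (𝓡 n) 𝓘(ℝ, F) ∞ (s i) W) ∧
    ∀ y ∈ W, Submodule.span ℝ (Set.range fun i => s i y) = E y
  parallel : ∀ W : Set M, IsOpen W → W ⊆ U → ∀ ξ : M → F, IsSection (n := n) E W ξ →
    ∀ x ∈ W, ∀ X : TangentSpace (𝓡 n) x, normalConn f ξ x X ∈ E x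
  flat : ∀ W : Set M, IsOpen W → W ⊆ U → ∀ ξ : M → F, IsSection (n := n) E W ξ →
    ∀ X Y : (∀ x : M, TangentSpace (𝓡 n) x), IsSmoothVectorField X W → IsSmoothVectorField Y W →
    ∀ x ∈ W, normalCurvature f X Y ξ x = 0

end Basic

section Construction

variable {n p m : ℕ} {M : Type*} [TopologicalSpace M]
  [ChartedSpace (EuclideanSpace ℝ (Fin n)) M]

/-- The tensors `Φ_i = Hess φ_i - A_{β_i}`. -/
def codazzi (f : M → EuclideanSpace ℝ (Fin (n + p))) (φ : Fin m → M → ℝ)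
    (β : Fin m → M → EuclideanSpace ℝ (Fin (n + p))) (i : Fin m) (x : M) :
    Module.End ℝ (TangentSpace (𝓡 n) x) :=
  hess f (φ i) x - shapeOp f (β i) x

/-- The matrix `𝒢 = (f_* ∇φ_1 + β_1, …, f_* ∇φ_m + β_m)`. -/
def gMatrix (f : M → EuclideanSpace ℝ (Fin (n + p))) (φ : Fin m → M → ℝ)
    (β : Fin m → M → EuclideanSpace ℝ (Fin (n + p))) (x : M) : Matrix (Fin (n + p)) (Fin m) ℝ :=
  Matrix.of fun a i => (pushforward (n := n) f (grad f (φ i)) x + β i x) a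

/-- The entrywise derivative `X ↦ dA(X)` of a matrix valued map. -/
def matrixDiff {k l : ℕ} (A : M → Matrix (Fin k) (Fin l) ℝ) (x : M)
    (X : TangentSpace (𝓡 n) x) : Matrix (Fin k) (Fin l) ℝ :=
  Matrix.of fun a b => diff (fun y => A y a b) x X

/-- The initial data of the construction on a simply connected open set `U`: an immersion
`f : U → ℝ^{n+p}` (with the induced metric), smooth functions `φ_i` and normal fields `β_i`
with `α(X, ∇φ_i) + ∇^⊥_X β_i = 0` and commuting tensors `Φ_i`. -/
structure IsData (U : Set M) (f : M → EuclideanSpace ℝ (Fin (n + p))) (φ : Fin m → M → ℝ)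
    (β : Fin m → M → EuclideanSpace ℝ (Fin (n + p))) : Prop where
  isOpen : IsOpen U
  simplyConnected : SimplyConnectedSpace U
  immersion : IsSmoothImmersionOn (n := n) f U
  smooth : ∀ i, ContMDiffOn (𝓡 n) 𝓘(ℝ, ℝ) ∞ (φ i) U
  normalField : ∀ i, IsNormalField (n := n) f U (β i)
  eq_zero : ∀ i, ∀ x ∈ U, ∀ X : TangentSpace (𝓡 n) x,
    secondFundForm f (grad f (φ i)) x X + normalConn f (β i) x X = 0
  commute : ∀ i j, ∀ x ∈ U, Commute (codazzi (n := n) f φ β i x) (codazzi (n := n) f φ β j x)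

/-- `Ω : U → GL(ℝ^m)` is smooth with `dΩ = 𝒢ᵗ d𝒢` and `Ω + Ωᵗ = 𝒢ᵗ 𝒢 + I` on `U`. -/
structure IsSolution (U : Set M) (f : M → EuclideanSpace ℝ (Fin (n + p))) (φ : Fin m → M → ℝ)
    (β : Fin m → M → EuclideanSpace ℝ (Fin (n + p))) (Ω : M → Matrix (Fin m) (Fin m) ℝ) :
    Prop where
  smooth : ∀ i j, ContMDiffOn (𝓡 n) 𝓘(ℝ, ℝ) ∞ (fun x => Ω x i j) U
  isUnit : ∀ x ∈ U, IsUnit (Ω x)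
  diff_eq : ∀ x ∈ U, ∀ X : TangentSpace (𝓡 n) x,
    matrixDiff Ω x X =
      (gMatrix (n := n) f φ β x).transpose * matrixDiff (gMatrix (n := n) f φ β) x X
  symm_eq : ∀ x ∈ U, Ω x + (Ω x).transpose =
    (gMatrix (n := n) f φ β x).transpose * gMatrix (n := n) f φ β x + 1

/-- The map `(f - 𝒢 Ω⁻¹ φ, -Ω⁻¹ φ)` into `ℝ^{n+p+m} = ℝ^{n+p} ⊕ ℝ^m` (orthogonal sum). -/
def ribaucourMap (f : M → EuclideanSpace ℝ (Fin (n + p))) (φ : Fin m → M → ℝ)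
    (β : Fin m → M → EuclideanSpace ℝ (Fin (n + p))) (Ω : M → Matrix (Fin m) (Fin m) ℝ) (x : M) :
    WithLp 2 (EuclideanSpace ℝ (Fin (n + p)) × EuclideanSpace ℝ (Fin m)) :=
  WithLp.toLp 2
    (f x - WithLp.toLp 2 ((gMatrix (n := n) f φ β x).mulVec ((Ω x)⁻¹.mulVec fun i => φ i x)),
      -WithLp.toLp 2 ((Ω x)⁻¹.mulVec fun i => φ i x))

end Construction

end EuclSubmfd

end

open EuclSubmfd

/-!
Write `G_i = f_* ∇φ_i + β_i` for the columns of `𝒢`. The condition on `φ_i` and `β_i` says exactly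
that `dφ_i = ⟨G_i, df⟩` and `dG_i = f_* Φ_i`, so that `𝒢` has differentials tangential to `f`.
Closedness of `dφ_i` makes `Φ_i` symmetric, and then the `Φ_i` commute if and only if the one-forms
`⟨G_i, dG_j⟩` are closed.

*Existence of `Ω`* (`IsData.exists_isSolution`). The entries of `Ω` are primitives of the closed
one-forms `⟨G_i, dG_j⟩` on a coordinate ball. Since `d(Ω + Ωᵗ) = d(𝒢ᵗ 𝒢)`, a symmetric initial value
gives the algebraic identity everywhere; it makes `Ω + Ωᵗ` positive definite, hence `Ω` invertible.

*The subbundle* (`IsTransformData.exists_isParallelFlatNormalSubbundle`). For `b ∈ ℝ^m` let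
`ξ_b = (𝒢 Ω⁻¹ b, Ω⁻¹ b - b)`. Differentials of the transform and of `ξ_b` have the form
`(v - 𝒢 q, -q)` with `v` in the image of `df` and `q` determined by `⟨b, Ω q⟩ = ⟨𝒢 b, v⟩` for all
`b`. The identity for `Ω + Ωᵗ` shows that the `ξ_b` are orthogonal to all such vectors and that
`⟨ξ_b, ξ_b'⟩ = ⟨b, b'⟩`. At a regular point the vectors `v` that occur for the transform fill the
image of `df` by a dimension count, so that the differential of `ξ_b` is tangential to the
transform. Hence the `ξ_b` form an orthonormal parallel frame, and its span is a parallel flat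
subbundle (`isParallelFlatNormalSubbundle_span`).

*Converse*. In a local frame, the normal connection on a parallel flat normal subbundle is a flat
linear connection; solving a linear total differential equation (`exists_flat_section`) gives an
orthonormal frame of parallel sections (`IsParallelFlatNormalSubbundle.exists_parallel_frame`). Let
`(𝕌 b, 𝕎 b)` be the section with coefficients `b`. After changing the signs of some members of the
frame, `𝕎 + 1` is invertible near the given point (`exists_isUnit_add_diagonal`). The formulas for
`ξ_b` can then be solved: `Ω = (𝕎 + 1)⁻¹`, `𝒢 = 𝕌 Ω`, `φ = -Ω (g₂ + c)`, `f = g₁ - 𝒢 (g₂ + c)`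
(`exists_isTransformData`). With `c` chosen such that `g₂ + c` vanishes at the point, `f` is an
immersion nearby, and `β_i` is the normal part of `G_i` (`IsTransformData.exists_isData`).

Linear total differential equations are solved along rays: flatness makes the values at the ends of
the rays differentiable with the expected derivative (`norm_radial_solution_sub_le`). For explicit
calculations, vector fields and differentials are expressed in the preferred chart at a point.
-/

section Auxiliary

set_option maxSynthPendingDepth 3
open Set Metric Filter Topology

/-! ### Parallel sections of a flat linear connection -/

section Frobenius

variable {E V : Type*} [NormedAddCommGroup E] [NormedSpace ℝ E]
  [NormedAddCommGroup V] [NormedSpace ℝ V]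

/-- The first order Taylor estimate for a function with Lipschitz derivative. -/
theorem norm_taylor_le_of_lipschitzOnWith_fderiv {f : E → V} {s : Set E} (hs : IsOpen s)
    (hc : Convex ℝ s) {L : NNReal} (hf : DifferentiableOn ℝ f s)
    (hL : LipschitzOnWith L (fderiv ℝ f) s) {y z : E} (hy : y ∈ s) (hz : z ∈ s) :
    ‖f z - f y - fderiv ℝ f y (z - y)‖ ≤ L * ‖z - y‖ ^ 2 := by
  have hseg : segment ℝ y z ⊆ s := hc.segment_subset hy hz
  have := (convex_segment y z).norm_image_sub_le_of_norm_hasFDerivWithin_le'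
    (f := f) (f' := fderiv ℝ f) (φ := fderiv ℝ f y) (C := L * ‖z - y‖)
    (fun w hw => ((hf.differentiableAt (hs.mem_nhds (hseg hw))).hasFDerivAt).hasFDerivWithinAt)
    (fun w hw => ?_) (left_mem_segment ℝ y z) (right_mem_segment ℝ y z)
  · rw [sq, ← mul_assoc]; exact this
  · refine (hL.norm_sub_le (hseg hw) hy).trans ?_
    gcongr
    obtain ⟨t, ht, rfl⟩ := (segment_eq_image' ℝ y z) ▸ hw
    simp only [add_sub_cancel_left, norm_smul, Real.norm_eq_abs, abs_of_nonneg ht.1]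
    exact mul_le_of_le_one_left (norm_nonneg _) ht.2

/-- The initial value problem for the restriction of `da = A a` to the ray `t ↦ t x`. -/
theorem exists_radial_solution [CompleteSpace V] {A : E → E →L[ℝ] V →L[ℝ] V} {r : ℝ}
    (hA : ContinuousOn A (ball 0 r)) {x : E} (hx : x ∈ ball 0 r)
    (hC : ∀ y ∈ ball (0 : E) r, ‖A y x‖ ≤ 1 / 2) (a₀ : V) :
    ∃ y : ℝ → V, y 0 = a₀ ∧
      ∀ t ∈ Icc (0 : ℝ) 1, HasDerivWithinAt y (A (t • x) x (y t)) (Icc 0 1) t := by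
  have hmem : ∀ t ∈ Icc (0 : ℝ) 1, t • x ∈ ball (0 : E) r := fun t ht =>
    (convex_ball (0 : E) r).smul_mem_of_zero_mem
      (mem_ball_self ((norm_nonneg x).trans_lt (by simpa using hx))) hx ht
  have hpl : IsPicardLindelof (fun t y => A (t • x) x y) (⟨0, by simp⟩ : Icc (0 : ℝ) 1) a₀
      (‖a₀‖₊ + 1) 0 (‖a₀‖₊ + 1) 1 := by
    refine ⟨fun t ht => ?_, fun v _ => ?_, fun t ht v hv => ?_, ?_⟩
    · refine LipschitzOnWith.of_dist_le_mul fun v _ w _ => ?_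
      rw [dist_eq_norm, ← map_sub, dist_eq_norm]
      refine ((A (t • x) x).le_opNorm _).trans ?_
      gcongr
      exact (hC _ (hmem t ht)).trans (by norm_num)
    · have h1 : ContinuousOn (fun t : ℝ => A (t • x)) (Icc 0 1) :=
        hA.comp (by fun_prop) hmem
      exact (h1.clm_apply continuousOn_const).clm_apply continuousOn_const
    · have hv' : ‖v‖ ≤ 2 * ‖a₀‖ + 1 := by
        have h := norm_le_norm_add_norm_sub' v a₀
        have h2 : ‖v - a₀‖ ≤ ‖a₀‖ + 1 := by simpa [dist_eq_norm] using hv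
        linarith
      have h1 := (A (t • x) x).le_opNorm v
      have h2 := hC _ (hmem t ht)
      have : ‖A (t • x) x‖ * ‖v‖ ≤ 1 / 2 * (2 * ‖a₀‖ + 1) := by gcongr
      push_cast
      linarith
    · simp
  exact hpl.exists_eq_forall_mem_Icc_hasDerivWithinAt₀

/-- The solution on the ray through `x + h` agrees to first order in `h` with the curve
`t ↦ y t + t A(t x)(h) y t` built from the solution `y` on the ray through `x`. Flatness of the
connection cancels the first order part of the defect, and Grönwall's inequality
turns the quadratic bound of the defect into a quadratic bound for the difference. -/
theorem norm_radial_solution_sub_le {A : E → E →L[ℝ] V →L[ℝ] V} {r C : ℝ}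
    {L : NNReal} (hr : r ≤ 1) (hC0 : 0 ≤ C)
    (hA : DifferentiableOn ℝ A (ball 0 r)) (hL : LipschitzOnWith L (fderiv ℝ A) (ball 0 r))
    (hC : ∀ y ∈ ball (0 : E) r, ‖A y‖ ≤ C) (hC' : ∀ y ∈ ball (0 : E) r, ‖fderiv ℝ A y‖ ≤ C)
    (hCr : C * r ≤ 1 / 2)
    (hflat : ∀ y ∈ ball (0 : E) r, ∀ u v : E,
      fderiv ℝ A y u v + A y v ∘L A y u = fderiv ℝ A y v u + A y u ∘L A y v)
    {x h : E} (hx : x ∈ ball 0 r) (hxh : x + h ∈ ball 0 r) {y z : ℝ → V}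
    (hyz : y 0 = z 0)
    (hy : ∀ t ∈ Icc (0 : ℝ) 1, HasDerivWithinAt y (A (t • x) x (y t)) (Icc 0 1) t)
    (hz : ∀ t ∈ Icc (0 : ℝ) 1,
      HasDerivWithinAt z (A (t • (x + h)) (x + h) (z t)) (Icc 0 1) t)
    {Y : ℝ} (hY : ∀ t ∈ Icc (0 : ℝ) 1, ‖y t‖ ≤ Y) :
    ‖z 1 - (y 1 + A x h (y 1))‖ ≤
      (C ^ 2 * Y + C * Y + C ^ 2 * Y + L * (Y + 2 * C * Y)) * ‖h‖ ^ 2 * (Real.exp 1 - 1) := by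
  have hr0 : (0 : ℝ) < r := (norm_nonneg x).trans_lt (by simpa using hx)
  have hxn : ‖x‖ ≤ r := by simpa using (mem_ball_zero_iff.1 hx).le
  have hxhn : ‖x + h‖ ≤ r := by simpa using (mem_ball_zero_iff.1 hxh).le
  have hhn : ‖h‖ ≤ 2 := by
    have h1 : ‖h‖ = ‖(x + h) - x‖ := by congr 1; abel
    have := norm_sub_le (x + h) x
    linarith
  have hY0 : 0 ≤ Y := (norm_nonneg _).trans (hY 0 (by simp))
  have hmem : ∀ w ∈ ball (0 : E) r, ∀ t ∈ Icc (0 : ℝ) 1, t • w ∈ ball (0 : E) r :=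
    fun w hw t ht => (convex_ball (0 : E) r).smul_mem_of_zero_mem (mem_ball_self hr0) hw ht
  have hIci : ∀ t ∈ Ico (0 : ℝ) 1, Icc (0 : ℝ) 1 ∈ 𝓝[Ici t] t := fun t ht =>
    mem_of_superset (Icc_mem_nhdsGE ht.2) (Icc_subset_Icc_left ht.1)
  set ε := (C ^ 2 * Y + C * Y + C ^ 2 * Y + L * (Y + 2 * C * Y)) * ‖h‖ ^ 2 with hε
  -- the approximate solution `q` on the ray through `x + h`, and its derivative
  let q : ℝ → V := fun t => y t + t • A (t • x) h (y t)
  let q' : ℝ → V := fun t => A (t • x) x (y t) + (A (t • x) h (y t)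
    + t • (fderiv ℝ A (t • x) x h (y t) + A (t • x) h (A (t • x) x (y t))))
  have hq : ∀ t ∈ Icc (0 : ℝ) 1, HasDerivWithinAt q (q' t) (Icc 0 1) t := by
    intro t ht
    have h1 : HasDerivWithinAt (fun t : ℝ => A (t • x)) (fderiv ℝ A (t • x) x) (Icc 0 1) t := by
      have hd := ((hA.differentiableAt (isOpen_ball.mem_nhds (hmem x hx t ht))).hasFDerivAt)
      have h2 : HasDerivAt (fun t : ℝ => t • x) x t := by
        simpa using (hasDerivAt_id t).smul_const x
      exact (hd.comp_hasDerivAt t h2).hasDerivWithinAt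
    have h2 : HasDerivWithinAt (fun t : ℝ => A (t • x) h) (fderiv ℝ A (t • x) x h) (Icc 0 1) t := by
      simpa using h1.clm_apply (hasDerivWithinAt_const t _ h)
    have h3 := h2.clm_apply (hy t ht)
    have h4 := (hasDerivWithinAt_id t (Icc (0 : ℝ) 1)).smul h3
    have h5 := (hy t ht).add h4
    refine h5.congr_deriv ?_
    simp only [q', id]
    module
  have hdefect : ∀ t ∈ Icc (0 : ℝ) 1, dist (q' t) (A (t • (x + h)) (x + h) (q t)) ≤ ε := by
    intro t ht
    obtain ⟨ht0, ht1⟩ := ht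
    have hp := hmem x hx t ⟨ht0, ht1⟩
    have hp' := hmem _ hxh t ⟨ht0, ht1⟩
    have hR := norm_taylor_le_of_lipschitzOnWith_fderiv isOpen_ball (convex_ball (0 : E) r)
      hA hL hp hp'
    have hth : t • (x + h) - t • x = t • h := by module
    rw [hth] at hR
    set p := t • x with hpdef
    set D := fderiv ℝ A p with hD
    set R := A (t • (x + h)) - A p - D (t • h) with hRdef
    have hAR : A (t • (x + h)) = A p + D (t • h) + R := by rw [hRdef]; abel
    have hR' : ‖R‖ ≤ L * ‖h‖ ^ 2 := by
      refine hR.trans ?_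
      gcongr
      rw [norm_smul, Real.norm_of_nonneg ht0]
      exact mul_le_of_le_one_left (norm_nonneg _) ht1
    have hyt := hY t ⟨ht0, ht1⟩
    -- flatness turns `D h x` into `D x h` and cancels the terms that are linear in `h`
    have hf := congrArg (fun T : V →L[ℝ] V => T (y t)) (hflat p hp x h)
    simp only [add_apply, ContinuousLinearMap.comp_apply] at hf
    have hAh : ‖A p h (y t)‖ ≤ C * ‖h‖ * Y := by
      refine ((A p h).le_opNorm _).trans ?_
      gcongr
      exact (A p).le_of_opNorm_le (hC p hp) h
    -- the terms of the defect that are quadratic in `h`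
    have key : A (t • (x + h)) (x + h) (q t) - q' t
        = t • A p h (A p h (y t)) + t • D h h (y t) + t • D h (x + h) (t • A p h (y t))
          + R (x + h) (y t + t • A p h (y t)) := by
      have hqt : q t = y t + t • A p h (y t) := rfl
      have hqt' : q' t = A p x (y t) + (A p h (y t)
        + t • (D x h (y t) + A p h (A p x (y t)))) := rfl
      rw [hqt, hqt', hAR]
      simp only [map_add, map_smul, add_apply, smul_apply, smul_add, smul_smul]
      have hf' : D h x (y t) = D x h (y t) + A p h (A p x (y t)) - A p x (A p h (y t)) := by
        rw [hf]; abel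
      rw [hf']
      module
    rw [dist_comm, dist_eq_norm, key]
    have habs : |t| ≤ 1 := by rwa [abs_of_nonneg ht0]
    have hts : ∀ v : V, ‖t • v‖ ≤ ‖v‖ := fun v => by
      rw [norm_smul, Real.norm_eq_abs]
      exact mul_le_of_le_one_left (norm_nonneg _) habs
    have hDh : ‖D h‖ ≤ C * ‖h‖ := D.le_of_opNorm_le (hC' p hp) h
    have hx1 : ‖x + h‖ ≤ 1 := hxhn.trans hr
    have e1 : ‖t • A p h (A p h (y t))‖ ≤ C ^ 2 * Y * ‖h‖ ^ 2 := by
      refine (hts _).trans (((A p h).le_opNorm _).trans ?_)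
      calc ‖A p h‖ * ‖A p h (y t)‖ ≤ (C * ‖h‖) * (C * ‖h‖ * Y) := by
            gcongr
            exact (A p).le_of_opNorm_le (hC p hp) h
        _ = _ := by ring
    have e2 : ‖t • D h h (y t)‖ ≤ C * Y * ‖h‖ ^ 2 := by
      refine (hts _).trans (((D h h).le_opNorm _).trans ?_)
      calc ‖D h h‖ * ‖y t‖ ≤ (C * ‖h‖ * ‖h‖) * Y := by
            gcongr
            exact (D h).le_of_opNorm_le hDh h
        _ = _ := by ring
    have e3 : ‖t • D h (x + h) (t • A p h (y t))‖ ≤ C ^ 2 * Y * ‖h‖ ^ 2 := by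
      refine (hts _).trans (((D h (x + h)).le_opNorm _).trans ?_)
      calc ‖D h (x + h)‖ * ‖t • A p h (y t)‖ ≤ (C * ‖h‖ * 1) * (C * ‖h‖ * Y) := by
            gcongr
            · exact ((D h).le_of_opNorm_le hDh (x + h)).trans (by gcongr)
            · exact (hts _).trans hAh
        _ = _ := by ring
    have e4 : ‖R (x + h) (y t + t • A p h (y t))‖ ≤ L * (Y + 2 * C * Y) * ‖h‖ ^ 2 := by
      refine ((R (x + h)).le_opNorm _).trans ?_
      calc ‖R (x + h)‖ * ‖y t + t • A p h (y t)‖ ≤ (L * ‖h‖ ^ 2 * 1) * (Y + C * 2 * Y) := by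
            gcongr
            · exact (R.le_of_opNorm_le hR' (x + h)).trans (by gcongr)
            · refine (norm_add_le _ _).trans (add_le_add hyt ((hts _).trans (hAh.trans ?_)))
              gcongr
        _ = _ := by ring
    refine (norm_add_le _ _).trans ((add_le_add ((norm_add_le _ _).trans
      (add_le_add ((norm_add_le _ _).trans (add_le_add e1 e2)) e3)) e4).trans (le_of_eq ?_))
    rw [hε]; ring
  have := dist_le_of_approx_trajectories_ODE_of_mem (K := 1) (εf := 0) (εg := ε) (δ := 0)
    (v := fun t => A (t • (x + h)) (x + h)) (s := fun _ => univ) (a := 0) (b := 1)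
    (f := z) (g := q) (f' := fun t => A (t • (x + h)) (x + h) (z t)) (g' := q')
    (fun t ht => ?_) (fun t ht => (hz t ht).continuousWithinAt)
    (fun t ht => (hz t (Ico_subset_Icc_self ht)).mono_of_mem_nhdsWithin (hIci t ht))
    (fun t _ => by simp) (fun _ _ => trivial) (fun t ht => (hq t ht).continuousWithinAt)
    (fun t ht => (hq t (Ico_subset_Icc_self ht)).mono_of_mem_nhdsWithin (hIci t ht))
    (fun t ht => hdefect t (Ico_subset_Icc_self ht)) (fun _ _ => trivial) (by simp [q, hyz]) 1
    (by simp)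
  · rw [dist_eq_norm] at this
    simpa [q, gronwallBound] using this
  · refine LipschitzWith.lipschitzOnWith (LipschitzWith.of_dist_le_mul fun v w => ?_)
    rw [dist_eq_norm, ← map_sub, dist_eq_norm]
    refine ((A (t • (x + h)) (x + h)).le_opNorm _).trans ?_
    gcongr
    refine ((A _).le_of_opNorm_le (hC _ (hmem _ hxh t (Ico_subset_Icc_self ht))) _).trans ?_
    have : C * ‖x + h‖ ≤ C * r := by gcongr
    simp; linarith

/-- The Frobenius theorem for the linear total differential equation `da = A a`: if the connection
is flat, that is, if the derivative of the right hand side is symmetric for every value of `a`, then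
there are solutions with all initial values on a common ball. -/
theorem exists_flat_section [CompleteSpace V] {A : E → E →L[ℝ] V →L[ℝ] V} {s : Set E} {x₀ : E}
    (hs : s ∈ 𝓝 x₀) (hA : ContDiffAt ℝ 2 A x₀)
    (hflat : ∀ y ∈ s, ∀ u v : E,
      fderiv ℝ A y u v + A y v ∘L A y u = fderiv ℝ A y v u + A y u ∘L A y v) :
    ∃ r > 0, ∀ a₀ : V, ∃ a : E → V, a x₀ = a₀ ∧
      ∀ x ∈ ball x₀ r, HasFDerivAt a ((A x).flip (a x)) x := by
  -- translate to the origin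
  let B : E → E →L[ℝ] V →L[ℝ] V := fun x => A (x₀ + x)
  have hB : ContDiffAt ℝ 2 B 0 := by
    have : ContDiffAt ℝ 2 A (x₀ + 0) := by simpa using hA
    exact this.comp (0 : E) (by fun_prop)
  have hBfd : ∀ x, fderiv ℝ B x = fderiv ℝ A (x₀ + x) := fun x => fderiv_comp_add_left x₀
  have h0 : Tendsto (fun x : E => x₀ + x) (𝓝 0) (𝓝 x₀) := by
    have : ContinuousAt (fun x : E => x₀ + x) 0 := by fun_prop
    simpa [ContinuousAt] using this
  have hB1 : ContDiffAt ℝ 1 (fderiv ℝ B) 0 := hB.fderiv_right (by norm_num)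
  obtain ⟨L, t, ht, hL⟩ := hB1.exists_lipschitzOnWith
  have ev : ∀ᶠ x in 𝓝 (0 : E), x ∈ t ∧ x₀ + x ∈ s ∧ DifferentiableAt ℝ B x ∧
      ‖B x‖ ≤ ‖B 0‖ + ‖fderiv ℝ B 0‖ + 1 ∧ ‖fderiv ℝ B x‖ ≤ ‖B 0‖ + ‖fderiv ℝ B 0‖ + 1 := by
    have e1 : ∀ᶠ x in 𝓝 (0 : E), ‖B x‖ < ‖B 0‖ + ‖fderiv ℝ B 0‖ + 1 :=
      hB.continuousAt.norm.eventually_lt_const (by have := norm_nonneg (fderiv ℝ B 0); linarith)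
    have e2 : ∀ᶠ x in 𝓝 (0 : E), ‖fderiv ℝ B x‖ < ‖B 0‖ + ‖fderiv ℝ B 0‖ + 1 :=
      hB1.continuousAt.norm.eventually_lt_const (by have := norm_nonneg (B 0); linarith)
    have e3 : ∀ᶠ x in 𝓝 (0 : E), DifferentiableAt ℝ B x :=
      (hB.eventually (by simp)).mono fun x hx => hx.differentiableAt (by norm_num)
    filter_upwards [ht, h0 hs, e1, e2, e3] with x h1 h2 h3 h4 h5
    exact ⟨h1, h2, h5, h3.le, h4.le⟩
  set C := ‖B 0‖ + ‖fderiv ℝ B 0‖ + 1 with hCdef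
  have hCpos : 0 < C := by positivity
  obtain ⟨ρ, hρ, hball⟩ := Metric.eventually_nhds_iff_ball.1 ev
  -- on this ball the right hand side of the equation on each ray is `1/2`-Lipschitz
  set r := min ρ (min 1 (1 / (2 * C))) with hr
  have hrpos : 0 < r := by positivity
  have hrρ : ball (0 : E) r ⊆ ball 0 ρ := ball_subset_ball (min_le_left _ _)
  have hr1 : r ≤ 1 := (min_le_right _ _).trans (min_le_left _ _)
  have hCr : C * r ≤ 1 / 2 := by
    have : r ≤ 1 / (2 * C) := (min_le_right _ _).trans (min_le_right _ _)
    calc C * r ≤ C * (1 / (2 * C)) := by gcongr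
      _ = 1 / 2 := by field_simp
  have hBdiff : DifferentiableOn ℝ B (ball 0 r) := fun x hx =>
    (hball x (hrρ hx)).2.2.1.differentiableWithinAt
  have hLr : LipschitzOnWith L (fderiv ℝ B) (ball 0 r) := hL.mono fun x hx => (hball x (hrρ hx)).1
  refine ⟨r, hrpos, fun a₀ => ?_⟩
  have hex : ∀ x ∈ ball (0 : E) r, ∃ y : ℝ → V, y 0 = a₀ ∧
      ∀ t ∈ Icc (0 : ℝ) 1, HasDerivWithinAt y (B (t • x) x (y t)) (Icc 0 1) t := by
    refine fun x hx => exists_radial_solution hBdiff.continuousOn hx (fun y hy => ?_) a₀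
    have hxn : ‖x‖ ≤ r := (mem_ball_zero_iff.1 hx).le
    calc ‖B y x‖ ≤ C * ‖x‖ := (B y).le_of_opNorm_le (hball y (hrρ hy)).2.2.2.1 x
      _ ≤ C * r := by gcongr
      _ ≤ 1 / 2 := hCr
  -- the solution at `x` is the value at time `1` of the solution on the ray through `x`
  choose! Y hY0 hY using hex
  have hmain : ∀ x ∈ ball (0 : E) r, HasFDerivAt (fun x => Y x 1) ((B x).flip (Y x 1)) x := by
    intro x hx
    obtain ⟨K, hK⟩ := isCompact_Icc.exists_bound_of_continuousOn
      (f := Y x) (fun t ht => (hY x hx t ht).continuousWithinAt)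
    rw [hasFDerivAt_iff_isLittleO_nhds_zero]
    refine Asymptotics.IsBigO.trans_isLittleO ?_
      (Asymptotics.isLittleO_norm_pow_id (E' := E) one_lt_two)
    have hnear : ∀ᶠ h in 𝓝 (0 : E), x + h ∈ ball (0 : E) r := by
      have : ContinuousAt (fun h : E => x + h) 0 := by fun_prop
      exact this.eventually_mem (isOpen_ball.mem_nhds (by simpa using hx))
    refine Asymptotics.IsBigO.of_bound
      ((C ^ 2 * K + C * K + C ^ 2 * K + L * (K + 2 * C * K)) * (Real.exp 1 - 1)) ?_
    filter_upwards [hnear] with h hh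
    have := norm_radial_solution_sub_le hr1 hCpos.le hBdiff hLr
      (fun y hy => (hball y (hrρ hy)).2.2.2.1) (fun y hy => (hball y (hrρ hy)).2.2.2.2) hCr
      (fun y hy u v => by simpa only [hBfd] using hflat _ (hball y (hrρ hy)).2.1 u v) hx hh
      ((hY0 x hx).trans (hY0 _ hh).symm) (hY x hx) (hY _ hh) hK
    rw [Real.norm_of_nonneg (by positivity), ContinuousLinearMap.flip_apply, sub_sub]
    refine this.trans (le_of_eq (by ring))
  refine ⟨fun x => Y (x - x₀) 1, ?_, fun x hx => ?_⟩
  · have h00 : (0 : E) ∈ ball (0 : E) r := mem_ball_self hrpos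
    have hconst : ∀ t ∈ Icc (0 : ℝ) 1, Y 0 t = Y 0 0 :=
      constant_of_has_deriv_right_zero (fun t ht => (hY 0 h00 t ht).continuousWithinAt)
        fun t ht => by
          have := (hY 0 h00 t (Ico_subset_Icc_self ht)).mono_of_mem_nhdsWithin
            (mem_of_superset (Icc_mem_nhdsGE ht.2) (Icc_subset_Icc_left ht.1))
          simpa using this
    simp only [sub_self]
    rw [hconst 1 (by simp), hY0 0 h00]
  · have hx' : x - x₀ ∈ ball (0 : E) r := by simpa [dist_eq_norm] using hx
    have := (hmain _ hx').comp x ((hasFDerivAt_id x).sub_const x₀)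
    simpa [B, Function.comp_def] using! this

end Frobenius

/-! ### Differentials in a chart -/

namespace EuclSubmfd

section Chart

variable {n : ℕ} {M : Type*} [TopologicalSpace M] [ChartedSpace (EuclideanSpace ℝ (Fin n)) M]
  [IsManifold (𝓡 n) ∞ M]
  {G : Type*} [NormedAddCommGroup G] [NormedSpace ℝ G]
  {G' : Type*} [NormedAddCommGroup G'] [NormedSpace ℝ G']
  {G'' : Type*} [NormedAddCommGroup G''] [NormedSpace ℝ G'']

/-- The expression `η ∘ ψ⁻¹` of a vector valued map in the preferred chart `ψ` at `x₀`. -/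
noncomputable def coordRep {G : Type*} (x₀ : M) (η : M → G) (u : EuclideanSpace ℝ (Fin n)) : G :=
  η ((extChartAt (𝓡 n) x₀).symm u)

/-- The vector field on the source of the preferred chart at `x₀` whose coordinate expression is
the constant vector `v`. -/
noncomputable def coordField (x₀ : M) (v : EuclideanSpace ℝ (Fin n)) :
    ∀ y : M, TangentSpace (𝓡 n) y :=
  VectorField.mpullback (𝓡 n) 𝓘(ℝ, EuclideanSpace ℝ (Fin n)) (extChartAt (𝓡 n) x₀) (fun _ => v)

theorem isManifold_one : IsManifold (𝓡 n) 1 M := IsManifold.of_le (n := ∞) (by simp)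

theorem contDiffAt_coordRep {x₀ y : M} (hy : y ∈ (extChartAt (𝓡 n) x₀).source) {η : M → G}
    {k : ℕ∞} (hη : ContMDiffAt (𝓡 n) 𝓘(ℝ, G) k η y) :
    ContDiffAt ℝ k (coordRep x₀ η) (extChartAt (𝓡 n) x₀ y) := by
  rw [← contMDiffAt_iff_contDiffAt]
  have h1 := (contMDiffOn_extChartAt_symm (I := 𝓡 n) (n := ∞) x₀).contMDiffAt
    ((isOpen_extChartAt_target x₀).mem_nhds ((extChartAt (𝓡 n) x₀).map_source hy))
  refine ContMDiffAt.comp (I' := 𝓡 n) _ ?_ (h1.of_le (by exact_mod_cast le_top))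
  rwa [(extChartAt (𝓡 n) x₀).left_inv hy]

theorem contMDiffAt_comp_extChartAt {x₀ y : M} (hy : y ∈ (extChartAt (𝓡 n) x₀).source)
    {h : EuclideanSpace ℝ (Fin n) → G} (hh : ContDiffAt ℝ ∞ h (extChartAt (𝓡 n) x₀ y)) :
    ContMDiffAt (𝓡 n) 𝓘(ℝ, G) ∞ (fun z => h (extChartAt (𝓡 n) x₀ z)) y :=
  hh.contMDiffAt.comp y (contMDiffAt_extChartAt' (by rwa [extChartAt_source] at hy))

omit [IsManifold (𝓡 n) ∞ M] in
theorem coordRep_extChartAt {G : Type*} {x₀ y : M} (hy : y ∈ (extChartAt (𝓡 n) x₀).source)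
    (η : M → G) :
    coordRep x₀ η (extChartAt (𝓡 n) x₀ y) = η y := by
  rw [coordRep, (extChartAt (𝓡 n) x₀).left_inv hy]

/-- The differential of a map is the derivative of its coordinate expression. -/
theorem diff_eq_fderiv_coordRep {x₀ y : M} (hy : y ∈ (extChartAt (𝓡 n) x₀).source) {η : M → G}
    (hη : MDifferentiableAt (𝓡 n) 𝓘(ℝ, G) η y) (X : TangentSpace (𝓡 n) y) :
    diff η y X = fderiv ℝ (coordRep x₀ η) (extChartAt (𝓡 n) x₀ y)
      (mfderiv (𝓡 n) 𝓘(ℝ, EuclideanSpace ℝ (Fin n)) (extChartAt (𝓡 n) x₀) y X) := by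
  have := isManifold_one (n := n) (M := M)
  have h1 : MDifferentiableAt 𝓘(ℝ, EuclideanSpace ℝ (Fin n)) 𝓘(ℝ, G) (coordRep x₀ η)
      (extChartAt (𝓡 n) x₀ y) := by
    have h2 : MDifferentiableAt 𝓘(ℝ, EuclideanSpace ℝ (Fin n)) (𝓡 n) (extChartAt (𝓡 n) x₀).symm
        (extChartAt (𝓡 n) x₀ y) :=
      mdifferentiableOn_extChartAt_symm.mdifferentiableAt
        ((isOpen_extChartAt_target x₀).mem_nhds ((extChartAt (𝓡 n) x₀).map_source hy))
    refine MDifferentiableAt.comp (I' := 𝓡 n) _ ?_ h2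
    rwa [(extChartAt (𝓡 n) x₀).left_inv hy]
  have h3 : MDifferentiableAt (𝓡 n) 𝓘(ℝ, EuclideanSpace ℝ (Fin n)) (extChartAt (𝓡 n) x₀) y :=
    mdifferentiableAt_extChartAt (by rwa [extChartAt_source] at hy)
  have h4 : η =ᶠ[𝓝 y] coordRep x₀ η ∘ extChartAt (𝓡 n) x₀ := by
    filter_upwards [(isOpen_extChartAt_source (I := 𝓡 n) x₀).mem_nhds hy] with z hz
    exact (coordRep_extChartAt hz η).symm
  have h5 := mfderiv_comp y h1 h3
  rw [← mfderiv_eq_fderiv, diff, h4.mfderiv_eq, h5]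
  rfl

theorem isInvertible_mfderiv_extChartAt' {x₀ y : M} (hy : y ∈ (extChartAt (𝓡 n) x₀).source) :
    (mfderiv (𝓡 n) 𝓘(ℝ, EuclideanSpace ℝ (Fin n)) (extChartAt (𝓡 n) x₀) y).IsInvertible := by
  have := isManifold_one (n := n) (M := M)
  exact isInvertible_mfderiv_extChartAt hy

theorem mfderiv_extChartAt_coordField {x₀ y : M} (hy : y ∈ (extChartAt (𝓡 n) x₀).source)
    (v : EuclideanSpace ℝ (Fin n)) :
    mfderiv (𝓡 n) 𝓘(ℝ, EuclideanSpace ℝ (Fin n)) (extChartAt (𝓡 n) x₀) y (coordField x₀ v y)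
      = v := by
  exact (isInvertible_mfderiv_extChartAt' hy).self_apply_inverse v

theorem mfderiv_extChartAt_injective {x₀ y : M} (hy : y ∈ (extChartAt (𝓡 n) x₀).source) :
    Function.Injective
      (mfderiv (𝓡 n) 𝓘(ℝ, EuclideanSpace ℝ (Fin n)) (extChartAt (𝓡 n) x₀) y) := by
  obtain ⟨e, he⟩ := isInvertible_mfderiv_extChartAt' hy
  rw [← he]
  exact e.injective

theorem exists_coordField_eq {x₀ y : M} (hy : y ∈ (extChartAt (𝓡 n) x₀).source)
    (X : TangentSpace (𝓡 n) y) : ∃ v, coordField x₀ v y = X :=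
  ⟨mfderiv (𝓡 n) 𝓘(ℝ, EuclideanSpace ℝ (Fin n)) (extChartAt (𝓡 n) x₀) y X,
    mfderiv_extChartAt_injective hy (mfderiv_extChartAt_coordField hy _)⟩

theorem diff_coordField {x₀ y : M} (hy : y ∈ (extChartAt (𝓡 n) x₀).source) {η : M → G}
    (hη : MDifferentiableAt (𝓡 n) 𝓘(ℝ, G) η y) (v : EuclideanSpace ℝ (Fin n)) :
    diff η y (coordField x₀ v y) = fderiv ℝ (coordRep x₀ η) (extChartAt (𝓡 n) x₀ y) v := by
  rw [diff_eq_fderiv_coordRep hy hη, mfderiv_extChartAt_coordField hy]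

theorem isSmoothVectorField_coordField (x₀ : M) (v : EuclideanSpace ℝ (Fin n)) :
    IsSmoothVectorField (coordField x₀ v) (extChartAt (𝓡 n) x₀).source := by
  have := isManifold_one (n := n) (M := M)
  intro y hy
  have h1 : ContMDiffAt 𝓘(ℝ, EuclideanSpace ℝ (Fin n)) (𝓘(ℝ, EuclideanSpace ℝ (Fin n))).tangent ∞
      (fun u => (⟨u, v⟩ : TangentBundle 𝓘(ℝ, EuclideanSpace ℝ (Fin n))
        (EuclideanSpace ℝ (Fin n)))) (extChartAt (𝓡 n) x₀ y) :=
    contMDiffAt_vectorSpace_iff_contDiffAt.2 contDiffAt_const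
  refine (ContMDiffAt.mpullback_vectorField_preimage (n := ∞) h1 ?_
    (isInvertible_mfderiv_extChartAt' hy) (by simp)).contMDiffWithinAt
  exact contMDiffAt_extChartAt' (by rwa [extChartAt_source] at hy)

end Chart


section Calculus

variable {n : ℕ} {M : Type*} [TopologicalSpace M] [ChartedSpace (EuclideanSpace ℝ (Fin n)) M]
  {G : Type*} [NormedAddCommGroup G] [NormedSpace ℝ G]
  {G' : Type*} [NormedAddCommGroup G'] [NormedSpace ℝ G']
  {G'' : Type*} [NormedAddCommGroup G''] [NormedSpace ℝ G'']

/-! ### Rules for the differential -/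

theorem diff_congr {η ζ : M → G} {x : M} (h : η =ᶠ[𝓝 x] ζ) : diff (n := n) η x = diff ζ x := by
  rw [diff, diff, h.mfderiv_eq]

theorem diff_eq_of_hasMFDerivAt {η : M → G} {x : M} {η' : TangentSpace (𝓡 n) x →L[ℝ] G}
    (h : HasMFDerivAt (𝓡 n) 𝓘(ℝ, G) η x η') (X : TangentSpace (𝓡 n) x) :
    diff η x X = η' X := by
  rw [diff, h.mfderiv]; rfl

theorem hasMFDerivAt_comp_of_hasFDerivAt {η : M → G} {x : M} {h : G → G'} {h' : G →L[ℝ] G'}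
    (hh : HasFDerivAt h h' (η x)) (hη : MDifferentiableAt (𝓡 n) 𝓘(ℝ, G) η x) :
    HasMFDerivAt (𝓡 n) 𝓘(ℝ, G') (fun y => h (η y)) x (h' ∘L mfderiv (𝓡 n) 𝓘(ℝ, G) η x) :=
  HasMFDerivAt.comp x hh.hasMFDerivAt hη.hasMFDerivAt

theorem mdifferentiableAt_comp_of_hasFDerivAt {η : M → G} {x : M} {h : G → G'} {h' : G →L[ℝ] G'}
    (hh : HasFDerivAt h h' (η x)) (hη : MDifferentiableAt (𝓡 n) 𝓘(ℝ, G) η x) :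
    MDifferentiableAt (𝓡 n) 𝓘(ℝ, G') (fun y => h (η y)) x :=
  (hasMFDerivAt_comp_of_hasFDerivAt hh hη).mdifferentiableAt

theorem diff_comp_of_hasFDerivAt {η : M → G} {x : M} {h : G → G'} {h' : G →L[ℝ] G'}
    (hh : HasFDerivAt h h' (η x)) (hη : MDifferentiableAt (𝓡 n) 𝓘(ℝ, G) η x)
    (X : TangentSpace (𝓡 n) x) : diff (fun y => h (η y)) x X = h' (diff η x X) :=
  diff_eq_of_hasMFDerivAt (hasMFDerivAt_comp_of_hasFDerivAt hh hη) X

theorem diff_clm_comp (L : G →L[ℝ] G') {η : M → G} {x : M}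
    (hη : MDifferentiableAt (𝓡 n) 𝓘(ℝ, G) η x) (X : TangentSpace (𝓡 n) x) :
    diff (fun y => L (η y)) x X = L (diff η x X) :=
  diff_comp_of_hasFDerivAt L.hasFDerivAt hη X

theorem diff_const (c : G) (x : M) (X : TangentSpace (𝓡 n) x) :
    diff (fun _ : M => c) x X = 0 :=
  diff_eq_of_hasMFDerivAt (hasMFDerivAt_const c x) X

theorem diff_add {η ζ : M → G} {x : M} (hη : MDifferentiableAt (𝓡 n) 𝓘(ℝ, G) η x)
    (hζ : MDifferentiableAt (𝓡 n) 𝓘(ℝ, G) ζ x) (X : TangentSpace (𝓡 n) x) :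
    diff (fun y => η y + ζ y) x X = diff η x X + diff ζ x X :=
  diff_eq_of_hasMFDerivAt (hη.hasMFDerivAt.add hζ.hasMFDerivAt) X

theorem diff_sub {η ζ : M → G} {x : M} (hη : MDifferentiableAt (𝓡 n) 𝓘(ℝ, G) η x)
    (hζ : MDifferentiableAt (𝓡 n) 𝓘(ℝ, G) ζ x) (X : TangentSpace (𝓡 n) x) :
    diff (fun y => η y - ζ y) x X = diff η x X - diff ζ x X :=
  diff_eq_of_hasMFDerivAt (hη.hasMFDerivAt.sub hζ.hasMFDerivAt) X

theorem diff_neg {η : M → G} {x : M} (hη : MDifferentiableAt (𝓡 n) 𝓘(ℝ, G) η x)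
    (X : TangentSpace (𝓡 n) x) : diff (fun y => -η y) x X = -diff η x X :=
  diff_eq_of_hasMFDerivAt hη.hasMFDerivAt.neg X

theorem diff_prodMk {η : M → G} {ζ : M → G'} {x : M}
    (hη : MDifferentiableAt (𝓡 n) 𝓘(ℝ, G) η x) (hζ : MDifferentiableAt (𝓡 n) 𝓘(ℝ, G') ζ x)
    (X : TangentSpace (𝓡 n) x) :
    diff (fun y => (η y, ζ y)) x X = (diff η x X, diff ζ x X) := by
  exact diff_eq_of_hasMFDerivAt
    (η' := ContinuousLinearMap.prod (mfderiv (𝓡 n) 𝓘(ℝ, G) η x) (mfderiv (𝓡 n) 𝓘(ℝ, G') ζ x))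
    ⟨hη.continuousAt.prodMk hζ.continuousAt, hη.hasMFDerivAt.2.prodMk hζ.hasMFDerivAt.2⟩ X

/-- The product rule for a continuous bilinear map. -/
theorem diff_bilin (B : G →L[ℝ] G' →L[ℝ] G'') {η : M → G} {ζ : M → G'} {x : M}
    (hη : MDifferentiableAt (𝓡 n) 𝓘(ℝ, G) η x) (hζ : MDifferentiableAt (𝓡 n) 𝓘(ℝ, G') ζ x)
    (X : TangentSpace (𝓡 n) x) :
    diff (fun y => B (η y) (ζ y)) x X = B (diff η x X) (ζ x) + B (η x) (diff ζ x X) := by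
  have := diff_comp_of_hasFDerivAt (x := x) (h := fun q : G × G' => B q.1 q.2)
    (B.isBoundedBilinearMap.hasFDerivAt (η x, ζ x)) (hη.prodMk_space hζ) X
  rw [this, diff_prodMk hη hζ]
  exact add_comm _ _

theorem mdifferentiableAt_bilin (B : G →L[ℝ] G' →L[ℝ] G'') {η : M → G} {ζ : M → G'} {x : M}
    (hη : MDifferentiableAt (𝓡 n) 𝓘(ℝ, G) η x) (hζ : MDifferentiableAt (𝓡 n) 𝓘(ℝ, G') ζ x) :
    MDifferentiableAt (𝓡 n) 𝓘(ℝ, G'') (fun y => B (η y) (ζ y)) x :=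
  mdifferentiableAt_comp_of_hasFDerivAt (x := x) (h := fun q : G × G' => B q.1 q.2)
    (B.isBoundedBilinearMap.hasFDerivAt (η x, ζ x)) (hη.prodMk_space hζ)

theorem contMDiffOn_bilin (B : G →L[ℝ] G' →L[ℝ] G'') {η : M → G} {ζ : M → G'} {U : Set M}
    (hη : ContMDiffOn (𝓡 n) 𝓘(ℝ, G) ∞ η U) (hζ : ContMDiffOn (𝓡 n) 𝓘(ℝ, G') ∞ ζ U) :
    ContMDiffOn (𝓡 n) 𝓘(ℝ, G'') ∞ (fun y => B (η y) (ζ y)) U :=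
  ContMDiffOn.comp (t := univ) (g := fun q : G × G' => B q.1 q.2)
    (B.isBoundedBilinearMap.contDiff.contMDiff.contMDiffOn) (hη.prodMk_space hζ)
    (fun _ _ => trivial)

theorem contMDiffOn_clm_comp (L : G →L[ℝ] G') {η : M → G} {U : Set M}
    (hη : ContMDiffOn (𝓡 n) 𝓘(ℝ, G) ∞ η U) :
    ContMDiffOn (𝓡 n) 𝓘(ℝ, G') ∞ (fun y => L (η y)) U :=
  L.contDiff.contMDiff.comp_contMDiffOn hη

theorem diff_clm_apply {η : M → G →L[ℝ] G'} {ζ : M → G} {x : M}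
    (hη : MDifferentiableAt (𝓡 n) 𝓘(ℝ, G →L[ℝ] G') η x) (hζ : MDifferentiableAt (𝓡 n) 𝓘(ℝ, G) ζ x)
    (X : TangentSpace (𝓡 n) x) :
    diff (fun y => η y (ζ y)) x X = diff η x X (ζ x) + η x (diff ζ x X) :=
  diff_bilin (ContinuousLinearMap.id ℝ (G →L[ℝ] G')) hη hζ X

theorem mdifferentiableAt_clm_apply {η : M → G →L[ℝ] G'} {ζ : M → G} {x : M}
    (hη : MDifferentiableAt (𝓡 n) 𝓘(ℝ, G →L[ℝ] G') η x)
    (hζ : MDifferentiableAt (𝓡 n) 𝓘(ℝ, G) ζ x) :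
    MDifferentiableAt (𝓡 n) 𝓘(ℝ, G') (fun y => η y (ζ y)) x :=
  mdifferentiableAt_bilin (ContinuousLinearMap.id ℝ (G →L[ℝ] G')) hη hζ

theorem contMDiffOn_clm_apply {η : M → G →L[ℝ] G'} {ζ : M → G} {U : Set M}
    (hη : ContMDiffOn (𝓡 n) 𝓘(ℝ, G →L[ℝ] G') ∞ η U) (hζ : ContMDiffOn (𝓡 n) 𝓘(ℝ, G) ∞ ζ U) :
    ContMDiffOn (𝓡 n) 𝓘(ℝ, G') ∞ (fun y => η y (ζ y)) U :=
  contMDiffOn_bilin (ContinuousLinearMap.id ℝ (G →L[ℝ] G')) hη hζ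

theorem diff_inner {F : Type*} [NormedAddCommGroup F] [InnerProductSpace ℝ F] {η ζ : M → F} {x : M}
    (hη : MDifferentiableAt (𝓡 n) 𝓘(ℝ, F) η x) (hζ : MDifferentiableAt (𝓡 n) 𝓘(ℝ, F) ζ x)
    (X : TangentSpace (𝓡 n) x) :
    diff (fun y => inner ℝ (η y) (ζ y)) x X
      = inner ℝ (diff η x X) (ζ x) + inner ℝ (η x) (diff ζ x X) :=
  diff_bilin (innerSL ℝ) hη hζ X

theorem contMDiffOn_inner {F : Type*} [NormedAddCommGroup F] [InnerProductSpace ℝ F] {η ζ : M → F}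
    {U : Set M} (hη : ContMDiffOn (𝓡 n) 𝓘(ℝ, F) ∞ η U) (hζ : ContMDiffOn (𝓡 n) 𝓘(ℝ, F) ∞ ζ U) :
    ContMDiffOn (𝓡 n) 𝓘(ℝ, ℝ) ∞ (fun y => inner ℝ (η y) (ζ y)) U :=
  contMDiffOn_bilin (innerSL ℝ) hη hζ

theorem mdifferentiableAt_of_contMDiffOn {η : M → G} {U : Set M} (hU : IsOpen U)
    (hη : ContMDiffOn (𝓡 n) 𝓘(ℝ, G) ∞ η U) {x : M} (hx : x ∈ U) :
    MDifferentiableAt (𝓡 n) 𝓘(ℝ, G) η x :=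
  (hη.contMDiffAt (hU.mem_nhds hx)).mdifferentiableAt (by simp)

end Calculus

theorem two_le_infty : (2 : WithTop ℕ∞) ≤ ∞ :=
  WithTop.coe_le_coe.2 (le_top : (2 : ℕ∞) ≤ ⊤)

section SecondOrder

variable {n : ℕ} {M : Type*} [TopologicalSpace M] [ChartedSpace (EuclideanSpace ℝ (Fin n)) M]
  [IsManifold (𝓡 n) ∞ M]
  {G : Type*} [NormedAddCommGroup G] [NormedSpace ℝ G]
  {F : Type*} [NormedAddCommGroup F] [InnerProductSpace ℝ F]

/-! ### Closed one-forms and the Lie bracket -/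

theorem hasFDerivAt_inner_fderiv {E : Type*} [NormedAddCommGroup E] [NormedSpace ℝ E]
    {v w : E → F} {u : E} (hv : DifferentiableAt ℝ v u) (hw : DifferentiableAt ℝ (fderiv ℝ w) u) :
    HasFDerivAt (fun u => innerSL ℝ (v u) ∘L fderiv ℝ w u)
      ((ContinuousLinearMap.compL ℝ E F ℝ (innerSL ℝ (v u))) ∘L fderiv ℝ (fderiv ℝ w) u
        + ((ContinuousLinearMap.compL ℝ E F ℝ).flip (fderiv ℝ w u)) ∘L
          (innerSL ℝ : F →L[ℝ] F →L[ℝ] ℝ) ∘L fderiv ℝ v u) u := by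
  have h1 : HasFDerivAt (fun u => (innerSL ℝ : F →L[ℝ] F →L[ℝ] ℝ) (v u))
      ((innerSL ℝ : F →L[ℝ] F →L[ℝ] ℝ) ∘L fderiv ℝ v u) u :=
    (innerSL ℝ : F →L[ℝ] F →L[ℝ] ℝ).hasFDerivAt.comp u hv.hasFDerivAt
  exact h1.clm_comp hw.hasFDerivAt

theorem fderiv_inner_fderiv_apply {E : Type*} [NormedAddCommGroup E] [NormedSpace ℝ E]
    {v w : E → F} {u : E} (hv : DifferentiableAt ℝ v u) (hw : DifferentiableAt ℝ (fderiv ℝ w) u)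
    (a b : E) :
    fderiv ℝ (fun u => innerSL ℝ (v u) ∘L fderiv ℝ w u) u a b
      = inner ℝ (v u) (fderiv ℝ (fderiv ℝ w) u a b)
        + inner ℝ (fderiv ℝ v u a) (fderiv ℝ w u b) := by
  rw [(hasFDerivAt_inner_fderiv hv hw).fderiv]
  rfl

theorem differentiableAt_fderiv_of_contDiffAt {E : Type*} [NormedAddCommGroup E] [NormedSpace ℝ E]
    {w : E → G} {u : E} (hw : ContDiffAt ℝ ∞ w u) : DifferentiableAt ℝ (fderiv ℝ w) u :=
  (hw.fderiv_right (m := 1)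
    (by rw [one_add_one_eq_two]; exact two_le_infty)).differentiableAt (by simp)

/-- If the one-form `⟨v, dw⟩` is exact, then it is closed: `⟨dv ∧ dw⟩ = 0`. -/
theorem inner_diff_symm_of_diff_eq {U : Set M} (hU : IsOpen U) {u : M → ℝ} {v w : M → F}
    (hu : ContMDiffOn (𝓡 n) 𝓘(ℝ, ℝ) ∞ u U) (hv : ContMDiffOn (𝓡 n) 𝓘(ℝ, F) ∞ v U)
    (hw : ContMDiffOn (𝓡 n) 𝓘(ℝ, F) ∞ w U)
    (h : ∀ y ∈ U, ∀ X : TangentSpace (𝓡 n) y, diff u y X = inner ℝ (v y) (diff w y X))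
    {x : M} (hxU : x ∈ U) (X Y : TangentSpace (𝓡 n) x) :
    inner ℝ (diff v x X) (diff w x Y) = inner ℝ (diff v x Y) (diff w x X) := by
  have hx := mem_extChartAt_source (I := 𝓡 n) x
  have hu' := contDiffAt_coordRep hx (hu.contMDiffAt (hU.mem_nhds hxU))
  have hv' := contDiffAt_coordRep hx (hv.contMDiffAt (hU.mem_nhds hxU))
  have hw' := contDiffAt_coordRep hx (hw.contMDiffAt (hU.mem_nhds hxU))
  have hev : fderiv ℝ (coordRep x u) =ᶠ[𝓝 (extChartAt (𝓡 n) x x)]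
      fun z => innerSL ℝ (coordRep x v z) ∘L fderiv ℝ (coordRep x w) z := by
    have h1 := (continuousAt_extChartAt_symm (I := 𝓡 n) x)
    rw [ContinuousAt, extChartAt_to_inv] at h1
    filter_upwards [h1 (hU.mem_nhds hxU), extChartAt_target_mem_nhds (I := 𝓡 n) x] with z hz hzt
    have hzs := (extChartAt (𝓡 n) x).map_target hzt
    ext a
    have := h _ hz (coordField x a _)
    rw [diff_coordField hzs (mdifferentiableAt_of_contMDiffOn hU hu hz),
      diff_coordField hzs (mdifferentiableAt_of_contMDiffOn hU hw hz),
      (extChartAt (𝓡 n) x).right_inv hzt] at this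
    exact this
  have hsymm : IsSymmSndFDerivAt ℝ (coordRep x u) (extChartAt (𝓡 n) x x) :=
    hu'.isSymmSndFDerivAt (by simpa using two_le_infty)
  have hsymm' : IsSymmSndFDerivAt ℝ (coordRep x w) (extChartAt (𝓡 n) x x) :=
    hw'.isSymmSndFDerivAt (by simpa using two_le_infty)
  obtain ⟨a, rfl⟩ := exists_coordField_eq hx X
  obtain ⟨b, rfl⟩ := exists_coordField_eq hx Y
  have hvx := mdifferentiableAt_of_contMDiffOn hU hv hxU
  have hwx := mdifferentiableAt_of_contMDiffOn hU hw hxU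
  rw [diff_coordField hx hvx, diff_coordField hx hvx, diff_coordField hx hwx,
    diff_coordField hx hwx]
  have e1 := hsymm a b
  rw [hev.fderiv_eq, fderiv_inner_fderiv_apply (hv'.differentiableAt (by simp))
    (differentiableAt_fderiv_of_contDiffAt hw'), fderiv_inner_fderiv_apply
    (hv'.differentiableAt (by simp)) (differentiableAt_fderiv_of_contDiffAt hw'),
    hsymm' a b] at e1
  exact add_left_cancel e1

/-- The coordinate expression of a vector field in the preferred chart at `x₀`. -/
noncomputable def coordVec (x₀ : M) (X : ∀ y : M, TangentSpace (𝓡 n) y)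
    (u : EuclideanSpace ℝ (Fin n)) : EuclideanSpace ℝ (Fin n) :=
  VectorField.mpullbackWithin 𝓘(ℝ, EuclideanSpace ℝ (Fin n)) (𝓡 n) (extChartAt (𝓡 n) x₀).symm X
    (range (𝓡 n)) u

theorem coordVec_eq {x₀ : M} {u : EuclideanSpace ℝ (Fin n)} (X : ∀ y : M, TangentSpace (𝓡 n) y)
    (hu : u ∈ (extChartAt (𝓡 n) x₀).target) :
    coordVec x₀ X u = mfderiv (𝓡 n) 𝓘(ℝ, EuclideanSpace ℝ (Fin n)) (extChartAt (𝓡 n) x₀)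
      ((extChartAt (𝓡 n) x₀).symm u) (X ((extChartAt (𝓡 n) x₀).symm u)) := by
  have := isManifold_one (n := n) (M := M)
  have h := ContinuousLinearMap.inverse_eq
    (mfderivWithin_extChartAt_symm_comp_mfderiv_extChartAt (I := 𝓡 n) hu)
    (mfderiv_extChartAt_comp_mfderivWithin_extChartAt_symm (I := 𝓡 n) hu)
  exact congrArg (fun L => L (X ((extChartAt (𝓡 n) x₀).symm u))) h

theorem differentiableAt_coordVec {x : M} {X : ∀ y : M, TangentSpace (𝓡 n) y} {U : Set M}
    (hU : U ∈ 𝓝 x) (hX : IsSmoothVectorField X U) :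
    DifferentiableAt ℝ (coordVec x X) (extChartAt (𝓡 n) x x) := by
  have := isManifold_one (n := n) (M := M)
  have : IsManifold (𝓡 n) 2 M := IsManifold.of_le (n := ∞) two_le_infty
  have h1 := (hX.contMDiffAt hU).mdifferentiableAt (by simp)
  rw [← mdifferentiableWithinAt_univ] at h1
  have h2 := h1.differentiableWithinAt_mpullbackWithin_vectorField
  rw [preimage_univ, univ_inter] at h2
  exact h2.differentiableAt (by simp)

theorem coordRep_diff_apply {x₀ : M} {c : M → G} {u : EuclideanSpace ℝ (Fin n)}
    (X : ∀ y : M, TangentSpace (𝓡 n) y) (hu : u ∈ (extChartAt (𝓡 n) x₀).target)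
    (hc : MDifferentiableAt (𝓡 n) 𝓘(ℝ, G) c ((extChartAt (𝓡 n) x₀).symm u)) :
    coordRep x₀ (fun y => diff c y (X y)) u = fderiv ℝ (coordRep x₀ c) u (coordVec x₀ X u) := by
  rw [coordVec_eq X hu, coordRep, diff_eq_fderiv_coordRep ((extChartAt (𝓡 n) x₀).map_target hu) hc,
    (extChartAt (𝓡 n) x₀).right_inv hu]

theorem coordRep_diff_eventuallyEq {U : Set M} (hU : IsOpen U) {c : M → G}
    (hc : ContMDiffOn (𝓡 n) 𝓘(ℝ, G) ∞ c U) {x : M} (hx : x ∈ U)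
    (X : ∀ y : M, TangentSpace (𝓡 n) y) :
    coordRep x (fun y => diff c y (X y)) =ᶠ[𝓝 (extChartAt (𝓡 n) x x)]
      fun u => fderiv ℝ (coordRep x c) u (coordVec x X u) := by
  have h1 := (continuousAt_extChartAt_symm (I := 𝓡 n) x)
  rw [ContinuousAt, extChartAt_to_inv] at h1
  filter_upwards [h1 (hU.mem_nhds hx), extChartAt_target_mem_nhds (I := 𝓡 n) x] with z hz hzt
  exact coordRep_diff_apply X hzt (mdifferentiableAt_of_contMDiffOn hU hc hz)

theorem mdifferentiableAt_of_differentiableAt_coordRep {x : M} {η : M → G}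
    (hη : DifferentiableAt ℝ (coordRep x η) (extChartAt (𝓡 n) x x)) :
    MDifferentiableAt (𝓡 n) 𝓘(ℝ, G) η x := by
  have := isManifold_one (n := n) (M := M)
  have h1 : MDifferentiableAt (𝓡 n) 𝓘(ℝ, EuclideanSpace ℝ (Fin n)) (extChartAt (𝓡 n) x) x :=
    mdifferentiableAt_extChartAt (mem_chart_source _ x)
  have h2 := mdifferentiableAt_comp_of_hasFDerivAt hη.hasFDerivAt h1
  refine h2.congr_of_eventuallyEq ?_
  filter_upwards [extChartAt_source_mem_nhds (I := 𝓡 n) x] with z hz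
  rw [coordRep_extChartAt hz]

theorem hasFDerivAt_fderiv_coordVec {U : Set M} (hU : IsOpen U) {c : M → G}
    (hc : ContMDiffOn (𝓡 n) 𝓘(ℝ, G) ∞ c U) {x : M} (hx : x ∈ U)
    {X : ∀ y : M, TangentSpace (𝓡 n) y} (hX : IsSmoothVectorField X U) :
    HasFDerivAt (fun u => fderiv ℝ (coordRep x c) u (coordVec x X u))
      ((fderiv ℝ (coordRep x c) (extChartAt (𝓡 n) x x)) ∘L
        fderiv ℝ (coordVec x X) (extChartAt (𝓡 n) x x)
        + (fderiv ℝ (fderiv ℝ (coordRep x c)) (extChartAt (𝓡 n) x x)).flip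
          (coordVec x X (extChartAt (𝓡 n) x x))) (extChartAt (𝓡 n) x x) :=
  (differentiableAt_fderiv_of_contDiffAt (contDiffAt_coordRep (mem_extChartAt_source x)
    (hc.contMDiffAt (hU.mem_nhds hx)))).hasFDerivAt.clm_apply
    (differentiableAt_coordVec (hU.mem_nhds hx) hX).hasFDerivAt

theorem mdifferentiableAt_diff_apply {U : Set M} (hU : IsOpen U) {c : M → G}
    (hc : ContMDiffOn (𝓡 n) 𝓘(ℝ, G) ∞ c U) {x : M} (hx : x ∈ U)
    {X : ∀ y : M, TangentSpace (𝓡 n) y} (hX : IsSmoothVectorField X U) :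
    MDifferentiableAt (𝓡 n) 𝓘(ℝ, G) (fun y => diff c y (X y)) x :=
  mdifferentiableAt_of_differentiableAt_coordRep <|
    (hasFDerivAt_fderiv_coordVec hU hc hx hX).differentiableAt.congr_of_eventuallyEq
      (coordRep_diff_eventuallyEq hU hc hx X)

theorem coordVec_self (x : M) (X : ∀ y : M, TangentSpace (𝓡 n) y) :
    coordVec x X (extChartAt (𝓡 n) x x) =
      mfderiv (𝓡 n) 𝓘(ℝ, EuclideanSpace ℝ (Fin n)) (extChartAt (𝓡 n) x) x (X x) := by
  rw [coordVec_eq X (mem_extChartAt_target x), extChartAt_to_inv]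

theorem mfderiv_extChartAt_mlieBracket (x : M) (X Y : ∀ y : M, TangentSpace (𝓡 n) y) :
    mfderiv (𝓡 n) 𝓘(ℝ, EuclideanSpace ℝ (Fin n)) (extChartAt (𝓡 n) x) x
        (VectorField.mlieBracket (𝓡 n) X Y x)
      = VectorField.lieBracket ℝ (E := EuclideanSpace ℝ (Fin n)) (coordVec x X)
          (coordVec x Y) (extChartAt (𝓡 n) x x) := by
  have h : VectorField.lieBracketWithin ℝ (E := EuclideanSpace ℝ (Fin n)) (coordVec x X)
      (coordVec x Y) ((extChartAt (𝓡 n) x).symm ⁻¹' univ ∩ range (𝓡 n)) (extChartAt (𝓡 n) x x) =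
      VectorField.lieBracket ℝ (E := EuclideanSpace ℝ (Fin n)) (coordVec x X) (coordVec x Y)
        (extChartAt (𝓡 n) x x) := by simp
  rw [← h]
  exact (isInvertible_mfderiv_extChartAt' (mem_extChartAt_source x)).self_apply_inverse _

/-- The Lie bracket acts on functions as the commutator of derivations. -/
theorem diff_diff_sub_eq_diff_mlieBracket {U : Set M} (hU : IsOpen U) {c : M → G}
    (hc : ContMDiffOn (𝓡 n) 𝓘(ℝ, G) ∞ c U) {x : M} (hx : x ∈ U)
    {X Y : ∀ y : M, TangentSpace (𝓡 n) y} (hX : IsSmoothVectorField X U)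
    (hY : IsSmoothVectorField Y U) :
    diff (fun y => diff c y (Y y)) x (X x) - diff (fun y => diff c y (X y)) x (Y x)
      = diff c x (VectorField.mlieBracket (𝓡 n) X Y x) := by
  have hs := mem_extChartAt_source (I := 𝓡 n) x
  have hc' := contDiffAt_coordRep hs (hc.contMDiffAt (hU.mem_nhds hx))
  have hsymm : IsSymmSndFDerivAt ℝ (coordRep x c) (extChartAt (𝓡 n) x x) :=
    hc'.isSymmSndFDerivAt (by simpa using two_le_infty)
  rw [diff_eq_fderiv_coordRep hs (mdifferentiableAt_diff_apply hU hc hx hY),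
    diff_eq_fderiv_coordRep hs (mdifferentiableAt_diff_apply hU hc hx hX),
    diff_eq_fderiv_coordRep hs (mdifferentiableAt_of_contMDiffOn hU hc hx),
    (coordRep_diff_eventuallyEq hU hc hx X).fderiv_eq,
    (coordRep_diff_eventuallyEq hU hc hx Y).fderiv_eq,
    (hasFDerivAt_fderiv_coordVec hU hc hx hX).fderiv,
    (hasFDerivAt_fderiv_coordVec hU hc hx hY).fderiv, mfderiv_extChartAt_mlieBracket,
    ← coordVec_self, ← coordVec_self, VectorField.lieBracket_eq]
  simp only [add_apply, ContinuousLinearMap.comp_apply, ContinuousLinearMap.flip_apply, map_sub,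
    hsymm (coordVec x X _) (coordVec x Y _)]
  abel

end SecondOrder


section CoordBall

variable {n : ℕ} {M : Type*} [TopologicalSpace M] [ChartedSpace (EuclideanSpace ℝ (Fin n)) M]
  [IsManifold (𝓡 n) ∞ M]
  {G : Type*} [NormedAddCommGroup G] [NormedSpace ℝ G]
  {F : Type*} [NormedAddCommGroup F] [InnerProductSpace ℝ F]

/-! ### Coordinate balls -/

/-- The points in the source of the preferred chart at `x₀` whose coordinates lie in the ball of
radius `r` around those of `x₀`. It is used for balls contained in the target of the chart. -/
def coordBall (x₀ : M) (r : ℝ) : Set M :=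
  (extChartAt (𝓡 n) x₀).source ∩ extChartAt (𝓡 n) x₀ ⁻¹' ball (extChartAt (𝓡 n) x₀ x₀) r

omit [IsManifold (𝓡 n) ∞ M] in
theorem isOpen_coordBall (x₀ : M) (r : ℝ) : IsOpen (coordBall (n := n) x₀ r) :=
  (continuousOn_extChartAt x₀).isOpen_inter_preimage (isOpen_extChartAt_source x₀) isOpen_ball

omit [IsManifold (𝓡 n) ∞ M] in
theorem mem_coordBall_self (x₀ : M) {r : ℝ} (hr : 0 < r) : x₀ ∈ coordBall (n := n) x₀ r :=
  ⟨mem_extChartAt_source x₀, mem_ball_self hr⟩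

omit [IsManifold (𝓡 n) ∞ M] in
theorem coordBall_mono (x₀ : M) {r r' : ℝ} (h : r ≤ r') :
    coordBall (n := n) x₀ r ⊆ coordBall (n := n) x₀ r' :=
  fun _ hy => ⟨hy.1, ball_subset_ball h hy.2⟩

omit [IsManifold (𝓡 n) ∞ M] in
theorem symm_mem_coordBall {x₀ : M} {r : ℝ}
    (hr : ball (extChartAt (𝓡 n) x₀ x₀) r ⊆ (extChartAt (𝓡 n) x₀).target)
    {u : EuclideanSpace ℝ (Fin n)} (hu : u ∈ ball (extChartAt (𝓡 n) x₀ x₀) r) :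
    (extChartAt (𝓡 n) x₀).symm u ∈ coordBall (n := n) x₀ r :=
  ⟨(extChartAt (𝓡 n) x₀).map_target (hr hu), by
    rwa [mem_preimage, (extChartAt (𝓡 n) x₀).right_inv (hr hu)]⟩

omit [IsManifold (𝓡 n) ∞ M] in
theorem exists_coordBall_subset {x₀ : M} {U : Set M} (hU : U ∈ 𝓝 x₀) :
    ∃ r > 0, ball (extChartAt (𝓡 n) x₀ x₀) r ⊆ (extChartAt (𝓡 n) x₀).target ∧
      coordBall (n := n) x₀ r ⊆ U := by
  have h1 := (continuousAt_extChartAt_symm (I := 𝓡 n) x₀)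
  rw [ContinuousAt, extChartAt_to_inv] at h1
  obtain ⟨r, hr, h⟩ := Metric.mem_nhds_iff.1
    (inter_mem (h1 hU) (extChartAt_target_mem_nhds (I := 𝓡 n) x₀))
  refine ⟨r, hr, fun u hu => (h hu).2, fun y hy => ?_⟩
  have := (h hy.2).1
  rwa [mem_preimage, (extChartAt (𝓡 n) x₀).left_inv hy.1] at this

omit [IsManifold (𝓡 n) ∞ M] in
theorem simplyConnectedSpace_coordBall {x₀ : M} {r : ℝ} (hr0 : 0 < r)
    (hr : ball (extChartAt (𝓡 n) x₀ x₀) r ⊆ (extChartAt (𝓡 n) x₀).target) :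
    SimplyConnectedSpace (coordBall (n := n) x₀ r) := by
  have himg : (chartAt (EuclideanSpace ℝ (Fin n)) x₀) '' coordBall (n := n) x₀ r
      = ball (extChartAt (𝓡 n) x₀ x₀) r := by
    ext u
    constructor
    · rintro ⟨y, hy, rfl⟩
      simpa using! hy.2
    · intro hu
      refine ⟨(extChartAt (𝓡 n) x₀).symm u, symm_mem_coordBall hr hu, ?_⟩
      have := (extChartAt (𝓡 n) x₀).right_inv (hr hu)
      simpa using! this
  have hsub : coordBall (n := n) x₀ r ⊆ (chartAt (EuclideanSpace ℝ (Fin n)) x₀).source := by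
    intro y hy
    have := hy.1
    rwa [extChartAt_source] at this
  have e := (chartAt (EuclideanSpace ℝ (Fin n)) x₀).homeomorphOfImageSubsetSource hsub himg
  have : ContractibleSpace (ball (extChartAt (𝓡 n) x₀ x₀) r) :=
    (convex_ball _ r).contractibleSpace ⟨_, mem_ball_self hr0⟩
  exact e.toHomotopyEquiv.simplyConnectedSpace

theorem diff_comp_extChartAt {x₀ y : M} (hy : y ∈ (extChartAt (𝓡 n) x₀).source)
    {h : EuclideanSpace ℝ (Fin n) → G} (hh : DifferentiableAt ℝ h (extChartAt (𝓡 n) x₀ y))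
    (v : EuclideanSpace ℝ (Fin n)) :
    diff (fun z => h (extChartAt (𝓡 n) x₀ z)) y (coordField x₀ v y)
      = fderiv ℝ h (extChartAt (𝓡 n) x₀ y) v := by
  have := isManifold_one (n := n) (M := M)
  have h1 : MDifferentiableAt (𝓡 n) 𝓘(ℝ, EuclideanSpace ℝ (Fin n)) (extChartAt (𝓡 n) x₀) y :=
    mdifferentiableAt_extChartAt (by rwa [extChartAt_source] at hy)
  rw [diff_comp_of_hasFDerivAt hh.hasFDerivAt h1]
  exact congrArg _ (mfderiv_extChartAt_coordField hy v)

theorem contDiffOn_coordRep {x₀ : M} {r : ℝ}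
    (hr : ball (extChartAt (𝓡 n) x₀ x₀) r ⊆ (extChartAt (𝓡 n) x₀).target) {η : M → G}
    {U : Set M} (hU : IsOpen U) (hη : ContMDiffOn (𝓡 n) 𝓘(ℝ, G) ∞ η U)
    (hrU : coordBall (n := n) x₀ r ⊆ U) :
    ContDiffOn ℝ ∞ (coordRep x₀ η) (ball (extChartAt (𝓡 n) x₀ x₀) r) := by
  intro u hu
  have hm := symm_mem_coordBall hr hu
  have := contDiffAt_coordRep hm.1 (hη.contMDiffAt (hU.mem_nhds (hrU hm)))
  rw [(extChartAt (𝓡 n) x₀).right_inv (hr hu)] at this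
  exact this.contDiffWithinAt

/-- A function with smooth differential is smooth. -/
theorem contDiffOn_of_hasFDerivAt {E : Type*} [NormedAddCommGroup E] [NormedSpace ℝ E] {s : Set E}
    (hs : IsOpen s) {h : E → G} {h' : E → E →L[ℝ] G} (hh : ∀ x ∈ s, HasFDerivAt h (h' x) x)
    (hh' : ContDiffOn ℝ ∞ h' s) : ContDiffOn ℝ ∞ h s :=
  (contDiffOn_infty_iff_fderiv_of_isOpen hs).2
    ⟨fun x hx => (hh x hx).differentiableAt.differentiableWithinAt,
      hh'.congr fun x hx => (hh x hx).fderiv⟩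

/-- The Poincaré lemma on a coordinate ball, for one-forms `⟨v, dw⟩`. -/
theorem exists_primitive_inner_diff {x₀ : M} {r : ℝ}
    (hr : ball (extChartAt (𝓡 n) x₀ x₀) r ⊆ (extChartAt (𝓡 n) x₀).target) {U : Set M}
    (hU : IsOpen U) (hrU : coordBall (n := n) x₀ r ⊆ U) {v w : M → F}
    (hv : ContMDiffOn (𝓡 n) 𝓘(ℝ, F) ∞ v U) (hw : ContMDiffOn (𝓡 n) 𝓘(ℝ, F) ∞ w U)
    (hclosed : ∀ y ∈ U, ∀ X Y : TangentSpace (𝓡 n) y,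
      inner ℝ (diff v y X) (diff w y Y) = inner ℝ (diff v y Y) (diff w y X)) (c : ℝ) :
    ∃ u : M → ℝ, u x₀ = c ∧ ContMDiffOn (𝓡 n) 𝓘(ℝ, ℝ) ∞ u (coordBall (n := n) x₀ r) ∧
      ∀ y ∈ coordBall (n := n) x₀ r, ∀ X : TangentSpace (𝓡 n) y,
        diff u y X = inner ℝ (v y) (diff w y X) := by
  set B := ball (extChartAt (𝓡 n) x₀ x₀) r with hB
  have hv' := contDiffOn_coordRep hr hU hv hrU
  have hw' := contDiffOn_coordRep hr hU hw hrU
  have hBo : IsOpen B := isOpen_ball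
  have hω : ContDiffOn ℝ ∞ (fun z => innerSL ℝ (coordRep x₀ v z) ∘L fderiv ℝ (coordRep x₀ w) z) B :=
    ((innerSL ℝ : F →L[ℝ] F →L[ℝ] ℝ).contDiff.comp_contDiffOn hv').clm_comp
      (((contDiffOn_infty_iff_fderiv_of_isOpen hBo).1 hw').2)
  obtain ⟨p, hp⟩ := (convex_ball _ r).exists_forall_hasFDerivAt_of_fderiv_symmetric hBo
    (hω.differentiableOn (by simp)) (fun z hz a b => by
      have hvz := (hv'.contDiffAt (hBo.mem_nhds hz)).differentiableAt (by simp)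
      have hwz := hw'.contDiffAt (hBo.mem_nhds hz)
      rw [fderiv_inner_fderiv_apply hvz (differentiableAt_fderiv_of_contDiffAt hwz),
        fderiv_inner_fderiv_apply hvz (differentiableAt_fderiv_of_contDiffAt hwz)]
      have hsymm : IsSymmSndFDerivAt ℝ (coordRep x₀ w) z :=
        hwz.isSymmSndFDerivAt (by simpa using two_le_infty)
      have hm := symm_mem_coordBall hr hz
      have h := hclosed _ (hrU hm) (coordField x₀ a _) (coordField x₀ b _)
      have hvm := mdifferentiableAt_of_contMDiffOn hU hv (hrU hm)
      have hwm := mdifferentiableAt_of_contMDiffOn hU hw (hrU hm)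
      rw [diff_coordField hm.1 hvm, diff_coordField hm.1 hvm, diff_coordField hm.1 hwm,
        diff_coordField hm.1 hwm, (extChartAt (𝓡 n) x₀).right_inv (hr hz)] at h
      rw [hsymm a b, h])
  have hps := contDiffOn_of_hasFDerivAt hBo hp hω
  let q : EuclideanSpace ℝ (Fin n) → ℝ := fun z => p z - p (extChartAt (𝓡 n) x₀ x₀) + c
  refine ⟨fun y => q (extChartAt (𝓡 n) x₀ y), by simp [q], fun y hy => ?_, fun y hy X => ?_⟩
  · have hq : ContDiffAt ℝ ∞ q (extChartAt (𝓡 n) x₀ y) :=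
      ((hps.contDiffAt (hBo.mem_nhds hy.2)).sub contDiffAt_const).add contDiffAt_const
    exact (contMDiffAt_comp_extChartAt hy.1 hq).contMDiffWithinAt
  · obtain ⟨a, rfl⟩ := exists_coordField_eq hy.1 X
    have hq : HasFDerivAt q _ (extChartAt (𝓡 n) x₀ y) :=
      ((hp _ hy.2).sub_const (p (extChartAt (𝓡 n) x₀ x₀))).add_const c
    rw [diff_comp_extChartAt hy.1 hq.differentiableAt, hq.fderiv,
      diff_coordField hy.1 (mdifferentiableAt_of_contMDiffOn hU hw (hrU hy))]
    rw [coordRep_extChartAt hy.1]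
    rfl

theorem eq_of_diff_eq_zero {x₀ : M} {r : ℝ}
    (hr : ball (extChartAt (𝓡 n) x₀ x₀) r ⊆ (extChartAt (𝓡 n) x₀).target) {η : M → G}
    (hη : ContMDiffOn (𝓡 n) 𝓘(ℝ, G) ∞ η (coordBall (n := n) x₀ r))
    (h0 : ∀ y ∈ coordBall (n := n) x₀ r, ∀ X : TangentSpace (𝓡 n) y, diff η y X = 0)
    {y : M} (hy : y ∈ coordBall (n := n) x₀ r) : η y = η x₀ := by
  have hη' := contDiffOn_coordRep hr (isOpen_coordBall x₀ r) hη subset_rfl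
  have hr0 : 0 < r := pos_of_mem_ball hy.2
  have := (convex_ball _ r).is_const_of_fderivWithin_eq_zero (𝕜 := ℝ)
    (hη'.differentiableOn (by simp)) (fun z hz => ?_) hy.2 (mem_ball_self hr0)
  · rwa [coordRep_extChartAt hy.1, coordRep_extChartAt (mem_extChartAt_source x₀)] at this
  · rw [fderivWithin_of_isOpen isOpen_ball hz]
    ext a
    have hm := symm_mem_coordBall hr hz
    have h := h0 _ hm (coordField x₀ a _)
    rwa [diff_coordField hm.1 (mdifferentiableAt_of_contMDiffOn (isOpen_coordBall x₀ r) hη hm),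
      (extChartAt (𝓡 n) x₀).right_inv (hr hz)] at h

end CoordBall

/-! ### The induced metric -/

section Gram

variable {E F : Type*} [NormedAddCommGroup E] [NormedSpace ℝ E] [FiniteDimensional ℝ E]
  [NormedAddCommGroup F] [InnerProductSpace ℝ F]

/-- The map `a ↦ ⟨T a, T ·⟩` from a space to its dual: the metric pulled back by `T`. -/
noncomputable def gram (T : E →L[ℝ] F) : E →L[ℝ] E →L[ℝ] ℝ :=
  ((ContinuousLinearMap.compL ℝ E F ℝ).flip T) ∘L (innerSL ℝ : F →L[ℝ] F →L[ℝ] ℝ) ∘L T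

omit [FiniteDimensional ℝ E] in
theorem gram_apply (T : E →L[ℝ] F) (a b : E) : gram T a b = inner ℝ (T a) (T b) := rfl

omit [FiniteDimensional ℝ E] in
theorem contDiff_gram : ContDiff ℝ ∞ (gram : (E →L[ℝ] F) → _) := by
  unfold gram
  fun_prop

theorem isInvertible_gram {T : E →L[ℝ] F} (hT : Function.Injective T) :
    (gram T).IsInvertible := by
  have hinj : Function.Injective (LinearMap.toContinuousLinearMap.symm.toLinearMap ∘ₗ
      (gram T).toLinearMap : E →ₗ[ℝ] Module.Dual ℝ E) := by
    rw [injective_iff_map_eq_zero]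
    intro a ha
    have h1 : gram T a a = 0 := congrArg (fun l : Module.Dual ℝ E => l a) ha
    rw [gram_apply, inner_self_eq_zero] at h1
    exact (injective_iff_map_eq_zero T).1 hT a h1
  let e := ((LinearMap.linearEquivOfInjective _ hinj Subspace.dual_finrank_eq.symm).trans
    LinearMap.toContinuousLinearMap).toContinuousLinearEquiv
  refine ⟨e, ?_⟩
  ext a b
  rfl

theorem contDiffAt_inverse_gram {T : E →L[ℝ] F} (hT : Function.Injective T) :
    ContDiffAt ℝ ∞ (fun T : E →L[ℝ] F => (gram T).inverse) T := by
  have := FiniteDimensional.complete ℝ E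
  exact ((isInvertible_gram hT).contDiffAt_map_inverse).comp T contDiff_gram.contDiffAt

theorem inner_inverse_gram {T : E →L[ℝ] F} (hT : Function.Injective T) (l : E →L[ℝ] ℝ) (b : E) :
    inner ℝ (T ((gram T).inverse l)) (T b) = l b := by
  rw [← gram_apply, (isInvertible_gram hT).self_apply_inverse]

end Gram

section Parts

variable {n : ℕ} {M : Type*} [TopologicalSpace M] [ChartedSpace (EuclideanSpace ℝ (Fin n)) M]
  {F : Type*} [NormedAddCommGroup F] [InnerProductSpace ℝ F] {f : M → F} {x : M}

theorem nondegenerate_metric (hf : Function.Injective (diff (n := n) f x)) :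
    (metric (n := n) f x).Nondegenerate := by
  have h : ∀ X, metric (n := n) f x X X = 0 → X = 0 := fun X hX => by
    have h1 : inner ℝ (diff f x X) (diff f x X) = (0 : ℝ) := hX
    exact (injective_iff_map_eq_zero _).1 hf X (inner_self_eq_zero.1 h1)
  exact ⟨fun X hX => h X (hX X), fun X hX => h X (hX X)⟩

theorem inner_diff_sharp (hf : Function.Injective (diff (n := n) f x))
    (l : Module.Dual ℝ (TangentSpace (𝓡 n) x)) (X : TangentSpace (𝓡 n) x) :
    inner ℝ (diff f x (sharp (n := n) f x l)) (diff f x X) = l X := by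
  have : FiniteDimensional ℝ (TangentSpace (𝓡 n) x) :=
    inferInstanceAs (FiniteDimensional ℝ (EuclideanSpace ℝ (Fin n)))
  have h := LinearMap.BilinForm.apply_toDual_symm_apply (hB := nondegenerate_metric hf) l X
  rw [sharp, dif_pos (nondegenerate_metric hf)]
  exact h

theorem eq_of_inner_diff_eq (hf : Function.Injective (diff (n := n) f x))
    {Z Z' : TangentSpace (𝓡 n) x}
    (h : ∀ X : TangentSpace (𝓡 n) x, 
      inner ℝ (diff f x Z) (diff f x X) = inner ℝ (diff f x Z') (diff f x X)) : Z = Z' := by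
  refine hf (sub_eq_zero.1 ?_)
  rw [← map_sub, ← inner_self_eq_zero (𝕜 := ℝ)]
  nth_rewrite 1 [map_sub]
  rw [inner_sub_left, h, sub_self]

theorem inner_grad (hf : Function.Injective (diff (n := n) f x)) (φ : M → ℝ)
    (X : TangentSpace (𝓡 n) x) :
    inner ℝ (diff f x (grad (n := n) f φ x)) (diff f x X) = diff φ x X :=
  inner_diff_sharp hf _ X

theorem inner_tangentPart (hf : Function.Injective (diff (n := n) f x)) (v : F)
    (X : TangentSpace (𝓡 n) x) :
    inner ℝ (diff f x (tangentPart (n := n) f x v)) (diff f x X) = inner ℝ v (diff f x X) :=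
  inner_diff_sharp hf _ X

theorem tangentPart_diff (hf : Function.Injective (diff (n := n) f x))
    (Z : TangentSpace (𝓡 n) x) : tangentPart (n := n) f x (diff f x Z) = Z :=
  eq_of_inner_diff_eq hf fun X => inner_tangentPart hf _ X

theorem tangentPart_eq_zero (hf : Function.Injective (diff (n := n) f x)) {v : F}
    (hv : ∀ X : TangentSpace (𝓡 n) x, inner ℝ v (diff f x X) = 0) :
    tangentPart (n := n) f x v = 0 :=
  eq_of_inner_diff_eq hf fun X => by rw [inner_tangentPart hf, hv, map_zero, inner_zero_left]

theorem normalPart_apply (v : F) :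
    normalPart (n := n) f x v = v - diff f x (tangentPart (n := n) f x v) := rfl

theorem normalPart_diff (hf : Function.Injective (diff (n := n) f x))
    (Z : TangentSpace (𝓡 n) x) : normalPart (n := n) f x (diff f x Z) = 0 := by
  rw [normalPart_apply, tangentPart_diff hf, sub_self]

theorem normalPart_of_normal (hf : Function.Injective (diff (n := n) f x)) {v : F}
    (hv : ∀ X : TangentSpace (𝓡 n) x, inner ℝ v (diff f x X) = 0) :
    normalPart (n := n) f x v = v := by
  rw [normalPart_apply, tangentPart_eq_zero hf hv, map_zero, sub_zero]

end Parts

section Smoothness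

variable {n : ℕ} {M : Type*} [TopologicalSpace M] [ChartedSpace (EuclideanSpace ℝ (Fin n)) M]
  [IsManifold (𝓡 n) ∞ M]
  {F : Type*} [NormedAddCommGroup F] [InnerProductSpace ℝ F] {f : M → F} {U : Set M}

theorem diff_injective_iff {x₀ y : M} (hy : y ∈ (extChartAt (𝓡 n) x₀).source)
    (hf : MDifferentiableAt (𝓡 n) 𝓘(ℝ, F) f y) :
    Function.Injective (diff (n := n) f y) ↔
      Function.Injective (fderiv ℝ (coordRep x₀ f) (extChartAt (𝓡 n) x₀ y)) := by
  rw [injective_iff_map_eq_zero, injective_iff_map_eq_zero]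
  constructor
  · intro h a ha
    rw [← diff_coordField hy hf] at ha
    rw [← mfderiv_extChartAt_coordField hy a, h _ ha]
    exact map_zero _
  · intro h X hX
    rw [diff_eq_fderiv_coordRep hy hf] at hX
    exact mfderiv_extChartAt_injective hy ((h _ hX).trans (map_zero _).symm)

theorem contDiffAt_fderiv_coordRep (hU : IsOpen U) (hf : ContMDiffOn (𝓡 n) 𝓘(ℝ, F) ∞ f U)
    {x : M} (hx : x ∈ U) :
    ContDiffAt ℝ ∞ (fderiv ℝ (coordRep x f)) (extChartAt (𝓡 n) x x) :=
  (contDiffAt_coordRep (mem_extChartAt_source x) (hf.contMDiffAt (hU.mem_nhds hx))).fderiv_right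
    (by simp)

/-- The set of regular points of a smooth map is open. -/
theorem isOpen_regular (hU : IsOpen U) (hf : ContMDiffOn (𝓡 n) 𝓘(ℝ, F) ∞ f U) :
    IsOpen {x ∈ U | Function.Injective (diff (n := n) f x)} := by
  rw [isOpen_iff_mem_nhds]
  rintro x ⟨hx, hinj⟩
  have hs := mem_extChartAt_source (I := 𝓡 n) x
  rw [diff_injective_iff hs (mdifferentiableAt_of_contMDiffOn hU hf hx)] at hinj
  have h1 : ContinuousAt (fun y => fderiv ℝ (coordRep x f) (extChartAt (𝓡 n) x y)) x :=
    (contDiffAt_fderiv_coordRep hU hf hx).continuousAt.comp (continuousAt_extChartAt x)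
  filter_upwards [hU.mem_nhds hx, extChartAt_source_mem_nhds (I := 𝓡 n) x,
    h1 (ContinuousLinearMap.isOpen_injective.mem_nhds hinj)] with y hyU hys hy
  exact ⟨hyU, (diff_injective_iff hys (mdifferentiableAt_of_contMDiffOn hU hf hyU)).2 hy⟩

/-- The field `f_* ∇φ` is smooth: in coordinates it is the inverse of the Gram matrix applied to
the differential of `φ`. -/
theorem contMDiffOn_pushforward_grad (hU : IsOpen U) (hf : IsSmoothImmersionOn (n := n) f U)
    {φ : M → ℝ} (hφ : ContMDiffOn (𝓡 n) 𝓘(ℝ, ℝ) ∞ φ U) :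
    ContMDiffOn (𝓡 n) 𝓘(ℝ, F) ∞ (pushforward f (grad (n := n) f φ)) U := by
  intro x hx
  have hs := mem_extChartAt_source (I := 𝓡 n) x
  have hinj := (diff_injective_iff hs (mdifferentiableAt_of_contMDiffOn hU hf.smooth hx)).1
    (hf.injective x hx)
  have h1 := contDiffAt_fderiv_coordRep hU hf.smooth hx
  have h2 := contDiffAt_fderiv_coordRep hU hφ hx
  have h3 : ContDiffAt ℝ ∞ (fun u => fderiv ℝ (coordRep x f) u
      ((gram (fderiv ℝ (coordRep x f) u)).inverse (fderiv ℝ (coordRep x φ) u)))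
      (extChartAt (𝓡 n) x x) :=
    h1.clm_apply (((contDiffAt_inverse_gram hinj).comp _ h1).clm_apply h2)
  refine ((contMDiffAt_comp_extChartAt hs h3).congr_of_eventuallyEq ?_).contMDiffWithinAt
  filter_upwards [hU.mem_nhds hx, extChartAt_source_mem_nhds (I := 𝓡 n) x] with y hyU hy
  have hfy := mdifferentiableAt_of_contMDiffOn hU hf.smooth hyU
  have hinj := (diff_injective_iff hy hfy).1 (hf.injective y hyU)
  rw [pushforward, ← diff_coordField hy hfy]
  refine congrArg _ (eq_of_inner_diff_eq (hf.injective y hyU) fun X => ?_)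
  obtain ⟨a, rfl⟩ := exists_coordField_eq hy X
  rw [inner_grad (hf.injective y hyU), diff_coordField hy hfy, diff_coordField hy hfy,
    inner_inverse_gram hinj, diff_coordField hy (mdifferentiableAt_of_contMDiffOn hU hφ hyU)]

end Smoothness


section ParallelFrame

variable {n : ℕ} {M : Type*} [TopologicalSpace M] [ChartedSpace (EuclideanSpace ℝ (Fin n)) M]
  {G : Type*} [NormedAddCommGroup G] [NormedSpace ℝ G]
  {F : Type*} [NormedAddCommGroup F] [InnerProductSpace ℝ F]

/-! ### Parallel orthonormal frames -/

theorem mdifferentiableAt_sum {ι : Type*} (s : Finset ι) {η : ι → M → G} {x : M}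
    (hη : ∀ i ∈ s, MDifferentiableAt (𝓡 n) 𝓘(ℝ, G) (η i) x) :
    MDifferentiableAt (𝓡 n) 𝓘(ℝ, G) (fun y => ∑ i ∈ s, η i y) x := by
  classical
  induction s using Finset.induction_on with
  | empty => simpa using mdifferentiableAt_const
  | insert i s hi ih =>
    simp only [Finset.sum_insert hi]
    exact (hη i (Finset.mem_insert_self i s)).add
      (ih fun j hj => hη j (Finset.mem_insert_of_mem hj))

theorem diff_sum {ι : Type*} (s : Finset ι) {η : ι → M → G} {x : M}
    (hη : ∀ i ∈ s, MDifferentiableAt (𝓡 n) 𝓘(ℝ, G) (η i) x) (X : TangentSpace (𝓡 n) x) :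
    diff (fun y => ∑ i ∈ s, η i y) x X = ∑ i ∈ s, diff (η i) x X := by
  classical
  induction s using Finset.induction_on with
  | empty => simpa using diff_const (0 : G) x X
  | insert i s hi ih =>
    simp only [Finset.sum_insert hi]
    have hs : ∀ j ∈ s, MDifferentiableAt (𝓡 n) 𝓘(ℝ, G) (η j) x :=
      fun j hj => hη j (Finset.mem_insert_of_mem hj)
    rw [diff_add (hη i (Finset.mem_insert_self i s)) (mdifferentiableAt_sum s hs), ih hs]

theorem contMDiffOn_sum' {ι : Type*} (s : Finset ι) {η : ι → M → G} {U : Set M}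
    (hη : ∀ i ∈ s, ContMDiffOn (𝓡 n) 𝓘(ℝ, G) ∞ (η i) U) :
    ContMDiffOn (𝓡 n) 𝓘(ℝ, G) ∞ (fun y => ∑ i ∈ s, η i y) U := by
  classical
  induction s using Finset.induction_on with
  | empty => simpa using contMDiffOn_const
  | insert i s hi ih =>
    simp only [Finset.sum_insert hi]
    exact (hη i (Finset.mem_insert_self i s)).add
      (ih fun j hj => hη j (Finset.mem_insert_of_mem hj))

theorem diff_smul {c : M → ℝ} {ξ : M → G} {x : M}
    (hc : MDifferentiableAt (𝓡 n) 𝓘(ℝ, ℝ) c x) (hξ : MDifferentiableAt (𝓡 n) 𝓘(ℝ, G) ξ x)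
    (X : TangentSpace (𝓡 n) x) :
    diff (fun y => c y • ξ y) x X = diff c x X • ξ x + c x • diff ξ x X :=
  diff_bilin (ContinuousLinearMap.lsmul ℝ ℝ) hc hξ X

theorem mdifferentiableAt_smul {c : M → ℝ} {ξ : M → G} {x : M}
    (hc : MDifferentiableAt (𝓡 n) 𝓘(ℝ, ℝ) c x) (hξ : MDifferentiableAt (𝓡 n) 𝓘(ℝ, G) ξ x) :
    MDifferentiableAt (𝓡 n) 𝓘(ℝ, G) (fun y => c y • ξ y) x :=
  mdifferentiableAt_bilin (ContinuousLinearMap.lsmul ℝ ℝ) hc hξ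

theorem contMDiffOn_smul' {c : M → ℝ} {ξ : M → G} {U : Set M}
    (hc : ContMDiffOn (𝓡 n) 𝓘(ℝ, ℝ) ∞ c U) (hξ : ContMDiffOn (𝓡 n) 𝓘(ℝ, G) ∞ ξ U) :
    ContMDiffOn (𝓡 n) 𝓘(ℝ, G) ∞ (fun y => c y • ξ y) U :=
  contMDiffOn_bilin (ContinuousLinearMap.lsmul ℝ ℝ) hc hξ

theorem normalConn_apply (f ξ : M → F) (x : M) (X : TangentSpace (𝓡 n) x) :
    normalConn f ξ x X = normalPart (n := n) f x (diff ξ x X) := rfl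

theorem normalConn_congr {f ξ ξ' : M → F} {x : M} (h : ξ =ᶠ[𝓝 x] ξ') :
    normalConn (n := n) f ξ x = normalConn f ξ' x := by
  rw [normalConn, diff_congr h, normalConn]

theorem eq_sum_inner_smul_of_mem_span {m : ℕ} {e : Fin m → F} (he : Orthonormal ℝ e) {v : F}
    (hv : v ∈ Submodule.span ℝ (range e)) : v = ∑ i, inner ℝ (e i) v • e i := by
  obtain ⟨c, rfl⟩ := (Submodule.mem_span_range_iff_exists_fun ℝ).1 hv
  exact Finset.sum_congr rfl fun i _ => by rw [he.inner_right_fintype]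

/-- The normal connection in a parallel frame differentiates the coefficients. -/
theorem normalConn_sum_smul {m : ℕ} {f : M → F} {ξ : Fin m → M → F} {x : M}
    (hf : Function.Injective (diff (n := n) f x))
    (hξ : ∀ i, MDifferentiableAt (𝓡 n) 𝓘(ℝ, F) (ξ i) x)
    (hn : ∀ i, ∀ X : TangentSpace (𝓡 n) x, inner ℝ (ξ i x) (diff f x X) = 0)
    (hp : ∀ i, ∀ X : TangentSpace (𝓡 n) x, ∃ Z : TangentSpace (𝓡 n) x,
      diff (ξ i) x X = diff f x Z)
    {c : Fin m → M → ℝ} (hc : ∀ i, MDifferentiableAt (𝓡 n) 𝓘(ℝ, ℝ) (c i) x)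
    (X : TangentSpace (𝓡 n) x) :
    normalConn f (fun y => ∑ i, c i y • ξ i y) x X = ∑ i, diff (c i) x X • ξ i x := by
  rw [normalConn_apply, diff_sum _ fun i _ => mdifferentiableAt_smul (hc i) (hξ i), map_sum]
  refine Finset.sum_congr rfl fun i _ => ?_
  obtain ⟨Z, hZ⟩ := hp i X
  rw [diff_smul (hc i) (hξ i), hZ, map_add, map_smul, map_smul, normalPart_of_normal hf (hn i),
    normalPart_diff hf, smul_zero, add_zero]

/-- The span of an orthonormal normal frame with tangential derivatives is a parallel flat normal
subbundle. -/
theorem isParallelFlatNormalSubbundle_span [IsManifold (𝓡 n) ∞ M] {m : ℕ} {f : M → F} {U : Set M}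
    {ξ : Fin m → M → F} (hU : IsOpen U) (hf : ∀ x ∈ U, Function.Injective (diff (n := n) f x))
    (hξ : ∀ i, ContMDiffOn (𝓡 n) 𝓘(ℝ, F) ∞ (ξ i) U)
    (ho : ∀ x ∈ U, Orthonormal ℝ fun i => ξ i x)
    (hn : ∀ i, ∀ x ∈ U, ∀ X : TangentSpace (𝓡 n) x, inner ℝ (ξ i x) (diff f x X) = 0)
    (hp : ∀ i, ∀ x ∈ U, ∀ X : TangentSpace (𝓡 n) x, ∃ Z : TangentSpace (𝓡 n) x,
      diff (ξ i) x X = diff f x Z) :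
    IsParallelFlatNormalSubbundle (n := n) f U m
      fun x => Submodule.span ℝ (range fun i => ξ i x) := by
  have hexp : ∀ W : Set M, W ⊆ U → ∀ η : M → F,
      IsSection (n := n) (fun x => Submodule.span ℝ (range fun i => ξ i x)) W η →
      ∀ x ∈ W, η x = ∑ i, inner ℝ (ξ i x) (η x) • ξ i x := fun W hWU η hη x hx =>
    eq_sum_inner_smul_of_mem_span (ho x (hWU hx)) (hη.mem x hx)
  have hcs : ∀ W : Set M, W ⊆ U → ∀ η : M → F,
      IsSection (n := n) (fun x => Submodule.span ℝ (range fun i => ξ i x)) W η →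
      ∀ i, ContMDiffOn (𝓡 n) 𝓘(ℝ, ℝ) ∞ (fun x => inner ℝ (ξ i x) (η x)) W :=
    fun W hWU η hη i => contMDiffOn_inner ((hξ i).mono hWU) hη.smooth
  have hconn : ∀ W : Set M, IsOpen W → W ⊆ U → ∀ η : M → F,
      IsSection (n := n) (fun x => Submodule.span ℝ (range fun i => ξ i x)) W η →
      ∀ x ∈ W, ∀ X : TangentSpace (𝓡 n) x, normalConn f η x X =
        ∑ i, diff (fun x => inner ℝ (ξ i x) (η x)) x X • ξ i x := by
    intro W hW hWU η hη x hx X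
    have h : η =ᶠ[𝓝 x] fun y => ∑ i, inner ℝ (ξ i y) (η y) • ξ i y := by
      filter_upwards [hW.mem_nhds hx] with y hy using hexp W hWU η hη y hy
    rw [normalConn_congr h]
    exact normalConn_sum_smul (hf x (hWU hx))
      (fun i => mdifferentiableAt_of_contMDiffOn hU (hξ i) (hWU hx)) (fun i => hn i x (hWU hx))
      (fun i => hp i x (hWU hx))
      (fun i => mdifferentiableAt_of_contMDiffOn hW (hcs W hWU η hη i) hx) X
  refine ⟨fun x hx v hv X => ?_, fun x hx => ?_, fun x hx => ?_, ?_, ?_⟩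
  · obtain ⟨c, rfl⟩ := (Submodule.mem_span_range_iff_exists_fun ℝ).1 hv
    simp [sum_inner, inner_smul_left, hn _ x hx X]
  · rw [finrank_span_eq_card (ho x hx).linearIndependent, Fintype.card_fin]
  · exact ⟨U, hU, hx, subset_rfl, ξ, hξ, fun y _ => rfl⟩
  · intro W hW hWU η hη x hx X
    rw [hconn W hW hWU η hη x hx X]
    exact Submodule.sum_mem _ fun i _ => Submodule.smul_mem _ _ (Submodule.subset_span ⟨i, rfl⟩)
  · intro W hW hWU η hη X Y hX hY x hx
    set c : Fin m → M → ℝ := fun i x => inner ℝ (ξ i x) (η x) with hc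
    have key : ∀ Z : ∀ y : M, TangentSpace (𝓡 n) y, IsSmoothVectorField Z W →
        ∀ X' : TangentSpace (𝓡 n) x, normalConn f (fun y => normalConn f η y (Z y)) x X' =
          ∑ i, diff (fun y => diff (c i) y (Z y)) x X' • ξ i x := by
      intro Z hZ X'
      have h : (fun y => normalConn f η y (Z y)) =ᶠ[𝓝 x]
          fun y => ∑ i, diff (c i) y (Z y) • ξ i y := by
        filter_upwards [hW.mem_nhds hx] with y hy using hconn W hW hWU η hη y hy (Z y)
      rw [normalConn_congr h]
      exact normalConn_sum_smul (hf x (hWU hx))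
        (fun i => mdifferentiableAt_of_contMDiffOn hU (hξ i) (hWU hx)) (fun i => hn i x (hWU hx))
        (fun i => hp i x (hWU hx))
        (fun i => mdifferentiableAt_diff_apply hW (hcs W hWU η hη i) hx hZ) X'
    rw [normalCurvature, key Y hY, key X hX, hconn W hW hWU η hη x hx, ← Finset.sum_sub_distrib,
      ← Finset.sum_sub_distrib]
    refine Finset.sum_eq_zero fun i _ => ?_
    rw [← sub_smul, ← sub_smul, diff_diff_sub_eq_diff_mlieBracket hW (hcs W hWU η hη i) hx hX hY,
      sub_self, zero_smul]

end ParallelFrame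


section Transform

variable {n : ℕ} {M : Type*} [TopologicalSpace M] [ChartedSpace (EuclideanSpace ℝ (Fin n)) M]
  {V : Type*} [NormedAddCommGroup V] [InnerProductSpace ℝ V]
  {W : Type*} [NormedAddCommGroup W] [InnerProductSpace ℝ W]

/-! ### The transformation and its parallel normal frame -/

/-- The conditions, free of coordinates in the target, under which the map
`(f - 𝒢 Ω⁻¹ φ, -Ω⁻¹ φ)` is defined and carries parallel normal fields: here `φ` takes values in a
Euclidean space `W`, and `𝒢` and `Ω` take values in the linear maps `W → V` and `W → W`. -/
structure IsTransformData (U : Set M) (f : M → V) (φ : M → W) (𝔾 : M → W →L[ℝ] V)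
    (Ω : M → W →L[ℝ] W) : Prop where
  isOpen : IsOpen U
  smooth_map : ContMDiffOn (𝓡 n) 𝓘(ℝ, V) ∞ f U
  smooth_fun : ContMDiffOn (𝓡 n) 𝓘(ℝ, W) ∞ φ U
  smooth_frame : ContMDiffOn (𝓡 n) 𝓘(ℝ, W →L[ℝ] V) ∞ 𝔾 U
  smooth_sol : ContMDiffOn (𝓡 n) 𝓘(ℝ, W →L[ℝ] W) ∞ Ω U
  isInvertible : ∀ x ∈ U, (Ω x).IsInvertible
  symm_eq : ∀ x ∈ U, ∀ a b : W, inner ℝ a (Ω x b) + inner ℝ (Ω x a) b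
    = inner ℝ (𝔾 x a) (𝔾 x b) + inner ℝ a b
  diff_sol : ∀ x ∈ U, ∀ X : TangentSpace (𝓡 n) x, ∀ a b : W,
    inner ℝ a (diff Ω x X b) = inner ℝ (𝔾 x a) (diff 𝔾 x X b)
  diff_fun : ∀ x ∈ U, ∀ X : TangentSpace (𝓡 n) x, ∀ a : W,
    inner ℝ a (diff φ x X) = inner ℝ (𝔾 x a) (diff f x X)
  tangent : ∀ x ∈ U, ∀ X : TangentSpace (𝓡 n) x, ∀ a : W, ∃ Z : TangentSpace (𝓡 n) x,
    diff 𝔾 x X a = diff f x Z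

/-- The map `(f - 𝒢 Ω⁻¹ φ, -Ω⁻¹ φ)`. -/
noncomputable def transform (f : M → V) (φ : M → W) (𝔾 : M → W →L[ℝ] V) (Ω : M → W →L[ℝ] W)
    (x : M) : WithLp 2 (V × W) :=
  WithLp.toLp 2 (f x - 𝔾 x ((Ω x).inverse (φ x)), -(Ω x).inverse (φ x))

/-- The normal field `(𝒢 Ω⁻¹ b, Ω⁻¹ b - b)` of the transform belonging to `b ∈ W`. -/
noncomputable def transformNormal (𝔾 : M → W →L[ℝ] V) (Ω : M → W →L[ℝ] W) (b : W) (x : M) :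
    WithLp 2 (V × W) :=
  WithLp.toLp 2 (𝔾 x ((Ω x).inverse b), (Ω x).inverse b - b)

theorem contMDiffOn_toLp {v : M → V} {w : M → W} {U : Set M}
    (hv : ContMDiffOn (𝓡 n) 𝓘(ℝ, V) ∞ v U) (hw : ContMDiffOn (𝓡 n) 𝓘(ℝ, W) ∞ w U) :
    ContMDiffOn (𝓡 n) 𝓘(ℝ, WithLp 2 (V × W)) ∞ (fun y => WithLp.toLp 2 (v y, w y)) U :=
  contMDiffOn_clm_comp (WithLp.prodContinuousLinearEquiv 2 ℝ V W).symm.toContinuousLinearMap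
    (hv.prodMk_space hw)

theorem diff_toLp {v : M → V} {w : M → W} {x : M}
    (hv : MDifferentiableAt (𝓡 n) 𝓘(ℝ, V) v x) (hw : MDifferentiableAt (𝓡 n) 𝓘(ℝ, W) w x)
    (X : TangentSpace (𝓡 n) x) :
    diff (fun y => WithLp.toLp 2 (v y, w y)) x X = WithLp.toLp 2 (diff v x X, diff w x X) := by
  have h := diff_clm_comp (WithLp.prodContinuousLinearEquiv 2 ℝ V W).symm.toContinuousLinearMap
    (hv.prodMk_space hw) X
  rw [diff_prodMk hv hw] at h
  exact h

theorem contMDiffOn_clm_inverse [CompleteSpace W] {A : M → W →L[ℝ] W} {U : Set M} (hU : IsOpen U)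
    (hA : ContMDiffOn (𝓡 n) 𝓘(ℝ, W →L[ℝ] W) ∞ A U) (hinv : ∀ y ∈ U, (A y).IsInvertible) :
    ContMDiffOn (𝓡 n) 𝓘(ℝ, W →L[ℝ] W) ∞ (fun y => (A y).inverse) U := fun y hy =>
  ((((hinv y hy).contDiffAt_map_inverse (n := ∞)).contMDiffAt).comp y
    (hA.contMDiffAt (hU.mem_nhds hy))).contMDiffWithinAt

namespace IsTransformData

variable {U : Set M} {f : M → V} {φ : M → W} {𝔾 : M → W →L[ℝ] V} {Ω : M → W →L[ℝ] W}

theorem contMDiffOn_inverse [FiniteDimensional ℝ W] (h : IsTransformData (n := n) U f φ 𝔾 Ω) :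
    ContMDiffOn (𝓡 n) 𝓘(ℝ, W →L[ℝ] W) ∞ (fun x => (Ω x).inverse) U :=
  have : CompleteSpace W := FiniteDimensional.complete ℝ W
  contMDiffOn_clm_inverse h.isOpen h.smooth_sol h.isInvertible

/-- The equation `⟨b, Ω q⟩ = ⟨𝒢 b, v⟩` determines `q` from `v`. -/
theorem eq_of_inner_apply_eq (h : IsTransformData (n := n) U f φ 𝔾 Ω) {x : M} (hx : x ∈ U)
    {v : V} {q q' : W} (hq : ∀ b, inner ℝ b (Ω x q) = inner ℝ (𝔾 x b) v)
    (hq' : ∀ b, inner ℝ b (Ω x q') = inner ℝ (𝔾 x b) v) : q = q' := by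
  have h1 : Ω x q = Ω x q' := ext_inner_left ℝ fun b => (hq b).trans (hq' b).symm
  have := congrArg (Ω x).inverse h1
  rwa [(h.isInvertible x hx).inverse_apply_self, (h.isInvertible x hx).inverse_apply_self] at this

theorem contMDiffOn_transform [FiniteDimensional ℝ W] (h : IsTransformData (n := n) U f φ 𝔾 Ω) :
    ContMDiffOn (𝓡 n) 𝓘(ℝ, WithLp 2 (V × W)) ∞ (transform f φ 𝔾 Ω) U := by
  have h1 := contMDiffOn_clm_apply h.contMDiffOn_inverse h.smooth_fun
  exact contMDiffOn_toLp (h.smooth_map.sub (contMDiffOn_clm_apply h.smooth_frame h1)) h1.neg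

theorem contMDiffOn_transformNormal [FiniteDimensional ℝ W]
    (h : IsTransformData (n := n) U f φ 𝔾 Ω) (b : W) :
    ContMDiffOn (𝓡 n) 𝓘(ℝ, WithLp 2 (V × W)) ∞ (transformNormal 𝔾 Ω b) U := by
  have h1 := contMDiffOn_clm_apply h.contMDiffOn_inverse (contMDiffOn_const (c := b))
  exact contMDiffOn_toLp (contMDiffOn_clm_apply h.smooth_frame h1) (h1.sub contMDiffOn_const)

/-- The differential of a section `Ω⁻¹ η`. -/
theorem apply_diff_inverse [FiniteDimensional ℝ W] (h : IsTransformData (n := n) U f φ 𝔾 Ω)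
    {η : M → W} (hη : ContMDiffOn (𝓡 n) 𝓘(ℝ, W) ∞ η U) {x : M} (hx : x ∈ U)
    (X : TangentSpace (𝓡 n) x) :
    Ω x (diff (fun y => (Ω y).inverse (η y)) x X)
      = diff η x X - diff Ω x X ((Ω x).inverse (η x)) := by
  have h1 := mdifferentiableAt_of_contMDiffOn h.isOpen
    (contMDiffOn_clm_apply h.contMDiffOn_inverse hη) hx
  have h2 : η =ᶠ[𝓝 x] fun y => Ω y ((Ω y).inverse (η y)) := by
    filter_upwards [h.isOpen.mem_nhds hx] with y hy
    rw [(h.isInvertible y hy).self_apply_inverse]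
  rw [diff_congr h2, diff_clm_apply (mdifferentiableAt_of_contMDiffOn h.isOpen h.smooth_sol hx) h1]
  abel

/-- The differential of the transform is `(τ - 𝒢 q, -q)` with `τ = df - d𝒢 (Ω⁻¹ φ)`, where `q` is
determined by `τ`. -/
theorem exists_diff_transform [FiniteDimensional ℝ W] (h : IsTransformData (n := n) U f φ 𝔾 Ω)
    {x : M} (hx : x ∈ U) (X : TangentSpace (𝓡 n) x) :
    ∃ q : W, (∀ b, inner ℝ b (Ω x q)
        = inner ℝ (𝔾 x b) (diff f x X - diff 𝔾 x X ((Ω x).inverse (φ x)))) ∧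
      diff (transform f φ 𝔾 Ω) x X = WithLp.toLp 2
        (diff f x X - diff 𝔾 x X ((Ω x).inverse (φ x)) - 𝔾 x q, -q) := by
  have h1 := mdifferentiableAt_of_contMDiffOn h.isOpen
    (contMDiffOn_clm_apply h.contMDiffOn_inverse h.smooth_fun) hx
  have h2 := mdifferentiableAt_of_contMDiffOn h.isOpen h.smooth_frame hx
  have h3 := mdifferentiableAt_of_contMDiffOn h.isOpen h.smooth_map hx
  refine ⟨diff (fun y => (Ω y).inverse (φ y)) x X, fun b => ?_, ?_⟩
  · rw [h.apply_diff_inverse h.smooth_fun hx, inner_sub_right, h.diff_fun x hx,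
      h.diff_sol x hx, inner_sub_right]
  · have := diff_toLp (h3.sub (mdifferentiableAt_clm_apply h2 h1)) h1.neg X
    refine this.trans ?_
    have e1 := diff_sub h3 (mdifferentiableAt_clm_apply h2 h1) X
    have e2 := diff_neg h1 X
    rw [diff_clm_apply h2 h1, ← sub_sub] at e1
    exact congrArg (WithLp.toLp 2) (Prod.ext e1 e2)

/-- The differentials of the normal fields have the same form `(v - 𝒢 q, -q)` as that of the
transform. -/
theorem exists_diff_transformNormal [FiniteDimensional ℝ W]
    (h : IsTransformData (n := n) U f φ 𝔾 Ω) {x : M} (hx : x ∈ U) (b : W)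
    (X : TangentSpace (𝓡 n) x) :
    ∃ q : W, (∀ b', inner ℝ b' (Ω x q)
        = inner ℝ (𝔾 x b') (diff 𝔾 x X ((Ω x).inverse b))) ∧
      diff (transformNormal 𝔾 Ω b) x X = WithLp.toLp 2
        (diff 𝔾 x X ((Ω x).inverse b) - 𝔾 x q, -q) := by
  have h1 := mdifferentiableAt_of_contMDiffOn h.isOpen
    (contMDiffOn_clm_apply h.contMDiffOn_inverse (contMDiffOn_const (c := b))) hx
  have h2 := mdifferentiableAt_of_contMDiffOn h.isOpen h.smooth_frame hx
  have h3 : MDifferentiableAt (𝓡 n) 𝓘(ℝ, W) (fun _ => b) x := mdifferentiableAt_const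
  refine ⟨-diff (fun y => (Ω y).inverse b) x X, fun b' => ?_, ?_⟩
  · rw [map_neg, h.apply_diff_inverse (contMDiffOn_const (c := b)) hx, diff_const, zero_sub,
      neg_neg, h.diff_sol x hx]
  · have := diff_toLp (mdifferentiableAt_clm_apply h2 h1) (h1.sub h3) X
    refine this.trans ?_
    have e1 := diff_clm_apply h2 h1 X
    have e2 := diff_sub h1 h3 X
    rw [diff_const, sub_zero] at e2
    rw [map_neg, sub_neg_eq_add, neg_neg]
    exact congrArg (WithLp.toLp 2) (Prod.ext e1 e2)

/-- The fields `transformNormal` are orthogonal to all vectors of the form that the differential of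
the transform takes. -/
theorem inner_transformNormal (h : IsTransformData (n := n) U f φ 𝔾 Ω) {x : M} (hx : x ∈ U)
    (b : W) {v : V} {q : W} (hq : ∀ b, inner ℝ b (Ω x q) = inner ℝ (𝔾 x b) v) :
    inner ℝ (transformNormal 𝔾 Ω b x) (WithLp.toLp 2 (v - 𝔾 x q, -q)) = 0 := by
  have h1 := h.symm_eq x hx ((Ω x).inverse b) q
  rw [hq, (h.isInvertible x hx).self_apply_inverse] at h1
  rw [transformNormal, WithLp.prod_inner_apply]
  simp only [inner_sub_right, inner_sub_left, inner_neg_right]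
  linarith

theorem inner_transformNormal_transformNormal (h : IsTransformData (n := n) U f φ 𝔾 Ω) {x : M}
    (hx : x ∈ U) (b b' : W) :
    inner ℝ (transformNormal 𝔾 Ω b x) (transformNormal 𝔾 Ω b' x) = inner ℝ b b' := by
  have h1 := h.symm_eq x hx ((Ω x).inverse b) ((Ω x).inverse b')
  rw [(h.isInvertible x hx).self_apply_inverse, (h.isInvertible x hx).self_apply_inverse] at h1
  rw [transformNormal, transformNormal, WithLp.prod_inner_apply]
  simp only [inner_sub_right, inner_sub_left]
  linarith

/-- At a regular point the map `df - d𝒢 (Ω⁻¹ φ)` has the same image as `df`: it is injective there,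
and its image is contained in that of `df`. -/
theorem exists_eq_of_regular [FiniteDimensional ℝ W] (h : IsTransformData (n := n) U f φ 𝔾 Ω)
    {x : M} (hx : x ∈ U) (hr : Function.Injective (diff (n := n) (transform f φ 𝔾 Ω) x))
    (Z : TangentSpace (𝓡 n) x) :
    ∃ X : TangentSpace (𝓡 n) x, diff f x X - diff 𝔾 x X ((Ω x).inverse (φ x)) = diff f x Z := by
  have : FiniteDimensional ℝ (TangentSpace (𝓡 n) x) :=
    inferInstanceAs (FiniteDimensional ℝ (EuclideanSpace ℝ (Fin n)))
  set ψ := (Ω x).inverse (φ x) with hψ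
  let τ : TangentSpace (𝓡 n) x →ₗ[ℝ] V :=
    diff f x - (ContinuousLinearMap.apply ℝ V ψ).toLinearMap ∘ₗ diff 𝔾 x
  have hτ : ∀ X, τ X = diff f x X - diff 𝔾 x X ψ := fun X => rfl
  have hinj : Function.Injective τ := by
    rw [injective_iff_map_eq_zero]
    intro X hX
    obtain ⟨q, hq, hd⟩ := h.exists_diff_transform hx X
    rw [← hψ, ← hτ, hX] at hq hd
    have hq0 : q = 0 := h.eq_of_inner_apply_eq hx hq fun b => by simp
    rw [hq0, map_zero, sub_zero, neg_zero] at hd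
    exact (injective_iff_map_eq_zero _).1 hr X hd
  have hle : LinearMap.range τ ≤ LinearMap.range (diff (n := n) f x) := by
    rintro _ ⟨X, rfl⟩
    obtain ⟨Y, hY⟩ := h.tangent x hx X ψ
    exact ⟨X - Y, by rw [map_sub, hτ, hY]⟩
  have heq := Submodule.eq_of_le_of_finrank_le hle
    ((LinearMap.finrank_range_le _).trans (LinearMap.finrank_range_of_inj hinj).ge)
  exact (heq.ge ⟨Z, rfl⟩ : diff f x Z ∈ LinearMap.range τ)

/-- On the set of regular points, the transform carries a parallel flat normal subbundle. -/
theorem exists_isParallelFlatNormalSubbundle [IsManifold (𝓡 n) ∞ M] [FiniteDimensional ℝ W]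
    {m : ℕ} (e : OrthonormalBasis (Fin m) ℝ W) (h : IsTransformData (n := n) U f φ 𝔾 Ω) {R : Set M}
    (hR : IsOpen R) (hRU : R ⊆ U)
    (hr : ∀ x ∈ R, Function.Injective (diff (n := n) (transform f φ 𝔾 Ω) x)) :
    ∃ E, IsParallelFlatNormalSubbundle (n := n) (transform f φ 𝔾 Ω) R m E := by
  refine ⟨_, isParallelFlatNormalSubbundle_span (ξ := fun i => transformNormal 𝔾 Ω (e i)) hR hr
    (fun i => (h.contMDiffOn_transformNormal (e i)).mono hRU) (fun x hx => ?_)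
    (fun i x hx X => ?_) (fun i x hx X => ?_)⟩
  · rw [orthonormal_iff_ite]
    intro i j
    rw [h.inner_transformNormal_transformNormal (hRU hx), orthonormal_iff_ite.1 e.orthonormal]
  · obtain ⟨q, hq, hd⟩ := h.exists_diff_transform (hRU hx) X
    rw [hd]
    exact h.inner_transformNormal (hRU hx) (e i) hq
  -- both differentials are determined by their part in the image of `df`
  · obtain ⟨q, hq, hd⟩ := h.exists_diff_transformNormal (hRU hx) (e i) X
    obtain ⟨Y, hY⟩ := h.tangent x (hRU hx) X ((Ω x).inverse (e i))
    obtain ⟨Z, hZ⟩ := h.exists_eq_of_regular (hRU hx) (hr x hx) Y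
    obtain ⟨q', hq', hd'⟩ := h.exists_diff_transform (hRU hx) Z
    rw [hZ, ← hY] at hq' hd'
    exact ⟨Z, by rw [hd, hd', h.eq_of_inner_apply_eq (hRU hx) hq hq']⟩

end IsTransformData

end Transform


section Columns

variable {n m p : ℕ} {M : Type*} [TopologicalSpace M] [ChartedSpace (EuclideanSpace ℝ (Fin n)) M]
  {V : Type*} [NormedAddCommGroup V] [InnerProductSpace ℝ V]

/-! ### Matrices and linear maps -/

/-- The linear map with columns `v i`, that is, `a ↦ ∑ a i • v i`. -/
noncomputable def ofColumns (v : Fin m → V) : EuclideanSpace ℝ (Fin m) →L[ℝ] V :=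
  ∑ i, (EuclideanSpace.proj (𝕜 := ℝ) i).smulRight (v i)

theorem ofColumns_apply (v : Fin m → V) (a : EuclideanSpace ℝ (Fin m)) :
    ofColumns v a = ∑ i, a i • v i := by
  simp [ofColumns]

theorem ofColumns_single (v : Fin m → V) (i : Fin m) :
    ofColumns v (EuclideanSpace.single i 1) = v i := by
  simp [ofColumns_apply]

theorem ofColumns_apply_single (T : EuclideanSpace ℝ (Fin m) →L[ℝ] V) :
    ofColumns (fun i => T (EuclideanSpace.single i 1)) = T := by
  refine ContinuousLinearMap.ext fun a => ?_
  rw [ofColumns_apply]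
  conv_rhs => rw [← (EuclideanSpace.basisFun (Fin m) ℝ).sum_repr a]
  simp

theorem contMDiffOn_ofColumns {v : Fin m → M → V} {U : Set M}
    (hv : ∀ i, ContMDiffOn (𝓡 n) 𝓘(ℝ, V) ∞ (v i) U) :
    ContMDiffOn (𝓡 n) 𝓘(ℝ, EuclideanSpace ℝ (Fin m) →L[ℝ] V) ∞
      (fun y => ofColumns fun i => v i y) U :=
  contMDiffOn_sum' _ fun i _ => contMDiffOn_clm_comp
    (ContinuousLinearMap.smulRightL ℝ (EuclideanSpace ℝ (Fin m)) V (EuclideanSpace.proj i)) (hv i)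

theorem diff_ofColumns {v : Fin m → M → V} {x : M}
    (hv : ∀ i, MDifferentiableAt (𝓡 n) 𝓘(ℝ, V) (v i) x) (X : TangentSpace (𝓡 n) x) :
    diff (fun y => ofColumns fun i => v i y) x X = ofColumns fun i => diff (v i) x X := by
  refine (diff_sum _ (fun i _ => mdifferentiableAt_comp_of_hasFDerivAt
    (ContinuousLinearMap.smulRightL ℝ (EuclideanSpace ℝ (Fin m)) V
      (EuclideanSpace.proj i)).hasFDerivAt (hv i)) X).trans ?_
  exact Finset.sum_congr rfl fun i _ => diff_clm_comp
    (ContinuousLinearMap.smulRightL ℝ (EuclideanSpace ℝ (Fin m)) V (EuclideanSpace.proj i)) (hv i) X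

theorem contMDiffOn_toLp_pi {k : ℕ} {u : Fin k → M → ℝ} {U : Set M}
    (hu : ∀ i, ContMDiffOn (𝓡 n) 𝓘(ℝ, ℝ) ∞ (u i) U) :
    ContMDiffOn (𝓡 n) 𝓘(ℝ, EuclideanSpace ℝ (Fin k)) ∞ (fun y => WithLp.toLp 2 fun i => u i y) U :=
  contMDiffOn_clm_comp (EuclideanSpace.equiv (Fin k) ℝ).symm.toContinuousLinearMap
    (contMDiffOn_pi_space.2 hu)

theorem diff_apply_pi {k : ℕ} {v : M → EuclideanSpace ℝ (Fin k)} {x : M}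
    (hv : MDifferentiableAt (𝓡 n) 𝓘(ℝ, EuclideanSpace ℝ (Fin k)) v x) (X : TangentSpace (𝓡 n) x)
    (i : Fin k) : diff (fun y => v y i) x X = diff v x X i :=
  diff_clm_comp (EuclideanSpace.proj (𝕜 := ℝ) i) hv X

theorem toEuclideanCLM_eq_ofColumns (A : Matrix (Fin m) (Fin m) ℝ) :
    Matrix.toEuclideanCLM (𝕜 := ℝ) A = ofColumns fun j => WithLp.toLp 2 fun i => A i j := by
  refine ContinuousLinearMap.ext fun a => ?_
  ext i
  rw [ofColumns_apply, Matrix.ofLp_toEuclideanCLM]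
  simp [Matrix.mulVec, dotProduct, mul_comm]

theorem inner_single_toEuclideanCLM (A : Matrix (Fin m) (Fin m) ℝ) (i j : Fin m) :
    inner ℝ (EuclideanSpace.single i 1) (Matrix.toEuclideanCLM (𝕜 := ℝ) A
      (EuclideanSpace.single j 1)) = A i j := by
  simp [EuclideanSpace.inner_single_left, Matrix.ofLp_toEuclideanCLM]

theorem isInvertible_toEuclideanCLM {A : Matrix (Fin m) (Fin m) ℝ} (hA : IsUnit A) :
    (Matrix.toEuclideanCLM (𝕜 := ℝ) A).IsInvertible := by
  have hA' := (Matrix.isUnit_iff_isUnit_det A).1 hA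
  refine ContinuousLinearMap.IsInvertible.of_inverse (g := Matrix.toEuclideanCLM (𝕜 := ℝ) A⁻¹) ?_ ?_
  · exact (map_mul (Matrix.toEuclideanCLM (𝕜 := ℝ)) A A⁻¹).symm.trans
      (by rw [Matrix.mul_nonsing_inv A hA', map_one]; rfl)
  · exact (map_mul (Matrix.toEuclideanCLM (𝕜 := ℝ)) A⁻¹ A).symm.trans
      (by rw [Matrix.nonsing_inv_mul A hA', map_one]; rfl)

theorem isUnit_of_isInvertible_toEuclideanCLM {A : Matrix (Fin m) (Fin m) ℝ}
    (hA : (Matrix.toEuclideanCLM (𝕜 := ℝ) A).IsInvertible) : IsUnit A := by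
  rw [Matrix.isUnit_iff_isUnit_det, isUnit_iff_ne_zero]
  intro h0
  obtain ⟨v, hv, hv'⟩ := Matrix.exists_mulVec_eq_zero_iff.2 h0
  refine hv ?_
  have h1 : Matrix.toEuclideanCLM (𝕜 := ℝ) A (WithLp.toLp 2 v) = 0 := by
    rw [Matrix.toEuclideanCLM_toLp, hv']; rfl
  have h2 := hA.inverse_apply_self (WithLp.toLp 2 v)
  rw [h1, map_zero] at h2
  exact (congrArg WithLp.ofLp h2).symm

theorem toEuclideanCLM_inv (A : Matrix (Fin m) (Fin m) ℝ) :
    (Matrix.toEuclideanCLM (𝕜 := ℝ) A).inverse = Matrix.toEuclideanCLM (𝕜 := ℝ) A⁻¹ := by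
  by_cases hA : IsUnit A
  · have h := isInvertible_toEuclideanCLM hA
    refine ContinuousLinearMap.ext fun v => ?_
    have h1 : v = Matrix.toEuclideanCLM (𝕜 := ℝ) A (Matrix.toEuclideanCLM (𝕜 := ℝ) A⁻¹ v) := by
      have := congrArg (fun T : EuclideanSpace ℝ (Fin m) →L[ℝ] _ => T v)
        (map_mul (Matrix.toEuclideanCLM (𝕜 := ℝ)) A A⁻¹)
      rw [Matrix.mul_nonsing_inv A ((Matrix.isUnit_iff_isUnit_det A).1 hA), map_one] at this
      exact this
    nth_rewrite 1 [h1]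
    exact h.inverse_apply_self _
  · have h : ¬ (Matrix.toEuclideanCLM (𝕜 := ℝ) A).IsInvertible := fun h =>
      hA (isUnit_of_isInvertible_toEuclideanCLM h)
    rw [ContinuousLinearMap.inverse_of_not_isInvertible h,
      Matrix.nonsing_inv_apply_not_isUnit A (by rwa [← Matrix.isUnit_iff_isUnit_det]), map_zero]

theorem bilin_ext (B B' : EuclideanSpace ℝ (Fin m) →ₗ[ℝ] EuclideanSpace ℝ (Fin m) →ₗ[ℝ] ℝ)
    (h : ∀ i j, B (EuclideanSpace.single i 1) (EuclideanSpace.single j 1)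
      = B' (EuclideanSpace.single i 1) (EuclideanSpace.single j 1)) : B = B' :=
  LinearMap.ext_basis (EuclideanSpace.basisFun (Fin m) ℝ).toBasis
    (EuclideanSpace.basisFun (Fin m) ℝ).toBasis fun i j => by simpa using h i j
/-- The identity `Ω + Ωᵗ = 𝒢ᵗ 𝒢 + 1` as an identity of bilinear forms. -/
theorem inner_toEuclideanCLM_add {A : Matrix (Fin m) (Fin m) ℝ} {G : Fin m → V}
    (h : ∀ i j, A i j + A j i = inner ℝ (G i) (G j) + (1 : Matrix (Fin m) (Fin m) ℝ) i j)
    (a b : EuclideanSpace ℝ (Fin m)) :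
    inner ℝ a (Matrix.toEuclideanCLM (𝕜 := ℝ) A b) + inner ℝ (Matrix.toEuclideanCLM (𝕜 := ℝ) A a) b
      = inner ℝ (ofColumns G a) (ofColumns G b) + inner ℝ a b := by
  let T : EuclideanSpace ℝ (Fin m) →ₗ[ℝ] EuclideanSpace ℝ (Fin m) :=
    (Matrix.toEuclideanCLM (𝕜 := ℝ) A).toLinearMap
  have key := bilin_ext ((innerₗ _).compl₁₂ LinearMap.id T + (innerₗ _).compl₁₂ T LinearMap.id)
    ((innerₗ V).compl₁₂ (ofColumns G).toLinearMap (ofColumns G).toLinearMap + innerₗ _)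
    (fun i j => by
      change inner ℝ (EuclideanSpace.single i 1) (Matrix.toEuclideanCLM (𝕜 := ℝ) A
        (EuclideanSpace.single j 1)) + inner ℝ (Matrix.toEuclideanCLM (𝕜 := ℝ) A
        (EuclideanSpace.single i 1)) (EuclideanSpace.single j 1)
        = inner ℝ (ofColumns G (EuclideanSpace.single i 1))
            (ofColumns G (EuclideanSpace.single j 1))
          + inner ℝ (EuclideanSpace.single i (1 : ℝ)) (EuclideanSpace.single j (1 : ℝ))
      rw [real_inner_comm (EuclideanSpace.single j (1 : ℝ)), inner_single_toEuclideanCLM,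
        inner_single_toEuclideanCLM, ofColumns_single, ofColumns_single, h,
        EuclideanSpace.inner_single_left]
      simp [Matrix.one_apply])
  exact LinearMap.congr_fun₂ key a b

theorem inner_ofColumns_eq {G H : Fin m → V} {A : Fin m → EuclideanSpace ℝ (Fin m)}
    (h : ∀ i j, A j i = inner ℝ (G i) (H j)) (a b : EuclideanSpace ℝ (Fin m)) :
    inner ℝ a (ofColumns A b) = inner ℝ (ofColumns G a) (ofColumns H b) := by
  have key := bilin_ext ((innerₗ _).compl₁₂ LinearMap.id (ofColumns A).toLinearMap)
    ((innerₗ V).compl₁₂ (ofColumns G).toLinearMap (ofColumns H).toLinearMap)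
    (fun i j => by
      change inner ℝ (EuclideanSpace.single i 1) (ofColumns A (EuclideanSpace.single j 1))
        = inner ℝ (ofColumns G (EuclideanSpace.single i 1))
            (ofColumns H (EuclideanSpace.single j 1))
      rw [ofColumns_single, ofColumns_single, ofColumns_single, ← h]
      simp [EuclideanSpace.inner_single_left])
  exact LinearMap.congr_fun₂ key a b

/-- A matrix with `Ω + Ωᵗ = 𝒢ᵗ 𝒢 + 1` is invertible, since `Ω + Ωᵗ` is positive definite. -/
theorem isUnit_of_add_transpose {A : Matrix (Fin m) (Fin m) ℝ} {G : Fin m → V}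
    (h : ∀ i j, A i j + A j i = inner ℝ (G i) (G j) + (1 : Matrix (Fin m) (Fin m) ℝ) i j) :
    IsUnit A := by
  rw [Matrix.isUnit_iff_isUnit_det, isUnit_iff_ne_zero]
  intro h0
  obtain ⟨v, hv, hv'⟩ := Matrix.exists_mulVec_eq_zero_iff.2 h0
  have h1 := inner_toEuclideanCLM_add h (WithLp.toLp 2 v) (WithLp.toLp 2 v)
  have h2 : Matrix.toEuclideanCLM (𝕜 := ℝ) A (WithLp.toLp 2 v) = 0 := by
    rw [Matrix.toEuclideanCLM_toLp, hv']; rfl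
  rw [h2, inner_zero_left, inner_zero_right, add_zero, real_inner_self_eq_norm_sq,
    real_inner_self_eq_norm_sq] at h1
  have h3 : ‖(WithLp.toLp 2 v : EuclideanSpace ℝ (Fin m))‖ = 0 := by
    nlinarith [sq_nonneg ‖ofColumns G (WithLp.toLp 2 v)‖,
      sq_nonneg ‖(WithLp.toLp 2 v : EuclideanSpace ℝ (Fin m))‖]
  exact hv (congrArg WithLp.ofLp (norm_eq_zero.1 h3))

end Columns

section Data

variable {n p m : ℕ} {M : Type*} [TopologicalSpace M] [ChartedSpace (EuclideanSpace ℝ (Fin n)) M]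
  {f : M → EuclideanSpace ℝ (Fin (n + p))} {φ : Fin m → M → ℝ}
  {β : Fin m → M → EuclideanSpace ℝ (Fin (n + p))} {Ω : M → Matrix (Fin m) (Fin m) ℝ} {U S : Set M}

/-! ### The initial data in terms of the columns of `𝒢` -/

/-- The columns `f_* ∇φ_i + β_i` of the matrix `𝒢`. -/
noncomputable def gColumn (f : M → EuclideanSpace ℝ (Fin (n + p))) (φ : Fin m → M → ℝ)
    (β : Fin m → M → EuclideanSpace ℝ (Fin (n + p))) (i : Fin m) (x : M) :
    EuclideanSpace ℝ (Fin (n + p)) :=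
  pushforward (n := n) f (grad f (φ i)) x + β i x

theorem toLp_gMatrix_mulVec (x : M) (a : EuclideanSpace ℝ (Fin m)) :
    WithLp.toLp 2 ((gMatrix (n := n) f φ β x).mulVec a)
      = ofColumns (fun i => gColumn (n := n) f φ β i x) a := by
  ext i
  rw [ofColumns_apply]
  simp [Matrix.mulVec, dotProduct, gMatrix, gColumn, mul_comm, mul_add]

theorem gMatrix_transpose_mul (x : M) (i j : Fin m) :
    ((gMatrix (n := n) f φ β x).transpose * gMatrix (n := n) f φ β x) i j
      = inner ℝ (gColumn (n := n) f φ β i x) (gColumn (n := n) f φ β j x) := by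
  simp [Matrix.mul_apply, gMatrix, gColumn, PiLp.inner_apply, mul_comm]

theorem gMatrix_transpose_mul_matrixDiff {x : M}
    (hG : ∀ i, MDifferentiableAt (𝓡 n) 𝓘(ℝ, EuclideanSpace ℝ (Fin (n + p)))
      (gColumn (n := n) f φ β i) x) (X : TangentSpace (𝓡 n) x) (i j : Fin m) :
    ((gMatrix (n := n) f φ β x).transpose * matrixDiff (gMatrix (n := n) f φ β) x X) i j
      = inner ℝ (gColumn (n := n) f φ β i x) (diff (gColumn (n := n) f φ β j) x X) := by
  rw [Matrix.mul_apply, PiLp.inner_apply]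
  refine Finset.sum_congr rfl fun a _ => ?_
  rw [← diff_apply_pi (hG j)]
  exact mul_comm _ _

theorem isSolution_iff (hG : ∀ i, ∀ x ∈ U,
      MDifferentiableAt (𝓡 n) 𝓘(ℝ, EuclideanSpace ℝ (Fin (n + p))) (gColumn (n := n) f φ β i) x) :
    IsSolution (n := n) U f φ β Ω ↔
      (∀ i j, ContMDiffOn (𝓡 n) 𝓘(ℝ, ℝ) ∞ (fun x => Ω x i j) U) ∧ (∀ x ∈ U, IsUnit (Ω x)) ∧
      (∀ x ∈ U, ∀ X : TangentSpace (𝓡 n) x, ∀ i j, diff (fun x => Ω x i j) x X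
        = inner ℝ (gColumn (n := n) f φ β i x) (diff (gColumn (n := n) f φ β j) x X)) ∧
      ∀ x ∈ U, ∀ i j, Ω x i j + Ω x j i
        = inner ℝ (gColumn (n := n) f φ β i x) (gColumn (n := n) f φ β j x)
          + (1 : Matrix (Fin m) (Fin m) ℝ) i j := by
  constructor
  · intro h
    refine ⟨h.smooth, h.isUnit, fun x hx X i j => ?_, fun x hx i j => ?_⟩
    · rw [← gMatrix_transpose_mul_matrixDiff (fun i => hG i x hx), ← h.diff_eq x hx X]
      rfl
    · rw [← gMatrix_transpose_mul]
      exact congrArg (fun A : Matrix (Fin m) (Fin m) ℝ => A i j) (h.symm_eq x hx)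
  · rintro ⟨h1, h2, h3, h4⟩
    refine ⟨h1, h2, fun x hx X => ?_, fun x hx => ?_⟩
    · ext i j
      rw [gMatrix_transpose_mul_matrixDiff (fun i => hG i x hx), ← h3 x hx X i j]
      rfl
    · ext i j
      rw [Matrix.add_apply, Matrix.add_apply, gMatrix_transpose_mul, ← h4 x hx]
      rfl

variable [IsManifold (𝓡 n) ∞ M]

namespace IsData

theorem contMDiffOn_gColumn (h : IsData (n := n) U f φ β) (i : Fin m) :
    ContMDiffOn (𝓡 n) 𝓘(ℝ, EuclideanSpace ℝ (Fin (n + p))) ∞ (gColumn (n := n) f φ β i) U :=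
  (contMDiffOn_pushforward_grad h.isOpen h.immersion (h.smooth i)).add (h.normalField i).smooth

theorem mdifferentiableAt_gColumn (h : IsData (n := n) U f φ β) (i : Fin m) {x : M} (hx : x ∈ U) :
    MDifferentiableAt (𝓡 n) 𝓘(ℝ, EuclideanSpace ℝ (Fin (n + p))) (gColumn (n := n) f φ β i) x :=
  mdifferentiableAt_of_contMDiffOn h.isOpen (h.contMDiffOn_gColumn i) hx

omit [IsManifold (𝓡 n) ∞ M] in
theorem diff_fun_eq (h : IsData (n := n) U f φ β) (i : Fin m) {x : M} (hx : x ∈ U)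
    (X : TangentSpace (𝓡 n) x) :
    diff (φ i) x X = inner ℝ (gColumn (n := n) f φ β i x) (diff f x X) := by
  rw [gColumn, inner_add_left, (h.normalField i).normal x hx, add_zero, pushforward,
    inner_grad (h.immersion.injective x hx)]

/-- The columns of `𝒢` satisfy `dG_i = f_* Φ_i`: the tangential part of `dG_i` is `Φ_i` by
definition, and the Codazzi type equation says that the normal part vanishes. -/
theorem diff_gColumn (h : IsData (n := n) U f φ β) (i : Fin m) {x : M} (hx : x ∈ U)
    (X : TangentSpace (𝓡 n) x) :
    diff (gColumn (n := n) f φ β i) x X = diff f x (codazzi (n := n) f φ β i x X) := by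
  have h1 : diff (gColumn (n := n) f φ β i) x X
      = diff (pushforward f (grad (n := n) f (φ i))) x X + diff (β i) x X :=
    diff_add (mdifferentiableAt_of_contMDiffOn h.isOpen
      (contMDiffOn_pushforward_grad h.isOpen h.immersion (h.smooth i)) hx)
      (mdifferentiableAt_of_contMDiffOn h.isOpen (h.normalField i).smooth hx) X
  have h2 : normalPart (n := n) f x (diff (gColumn (n := n) f φ β i) x X) = 0 := by
    rw [h1, map_add]
    exact h.eq_zero i x hx X
  have h3 : codazzi (n := n) f φ β i x X
      = tangentPart (n := n) f x (diff (gColumn (n := n) f φ β i) x X) := by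
    rw [h1, map_add]
    exact sub_neg_eq_add _ _
  rw [h3]
  rw [normalPart_apply, sub_eq_zero] at h2
  exact h2

/-- The `Φ_i` are symmetric, since `dφ_i = ⟨G_i, df⟩` is closed. -/
theorem inner_codazzi_comm (h : IsData (n := n) U f φ β) (i : Fin m) {x : M} (hx : x ∈ U)
    (X Y : TangentSpace (𝓡 n) x) :
    inner ℝ (diff f x (codazzi (n := n) f φ β i x X)) (diff f x Y)
      = inner ℝ (diff f x X) (diff f x (codazzi (n := n) f φ β i x Y)) := by
  rw [← h.diff_gColumn i hx, ← h.diff_gColumn i hx, real_inner_comm _ (diff f x X)]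
  exact inner_diff_symm_of_diff_eq h.isOpen (h.smooth i) (h.contMDiffOn_gColumn i)
    h.immersion.smooth (fun y hy X => h.diff_fun_eq i hy X) hx X Y

/-- The one-forms `⟨G_i, dG_j⟩` are closed, since the `Φ_i` commute. -/
theorem inner_diff_gColumn_comm (h : IsData (n := n) U f φ β) (i j : Fin m) {x : M} (hx : x ∈ U)
    (X Y : TangentSpace (𝓡 n) x) :
    inner ℝ (diff (gColumn (n := n) f φ β i) x X) (diff (gColumn (n := n) f φ β j) x Y)
      = inner ℝ (diff (gColumn (n := n) f φ β i) x Y) (diff (gColumn (n := n) f φ β j) x X) := by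
  have hc : ∀ Z, codazzi (n := n) f φ β i x (codazzi (n := n) f φ β j x Z)
      = codazzi (n := n) f φ β j x (codazzi (n := n) f φ β i x Z) := fun Z =>
    congrArg (fun T : Module.End ℝ (TangentSpace (𝓡 n) x) => T Z) (h.commute i j x hx).eq
  rw [h.diff_gColumn i hx, h.diff_gColumn j hx, h.diff_gColumn i hx, h.diff_gColumn j hx,
    h.inner_codazzi_comm i hx, hc, ← h.inner_codazzi_comm j hx, real_inner_comm]

/-- Local existence of `Ω`: its entries are primitives of the closed one-forms `⟨G_i, dG_j⟩`, and
`Ω + Ωᵗ - 𝒢ᵗ 𝒢` is constant. -/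
theorem exists_isSolution (h : IsData (n := n) U f φ β) {x : M} (hx : x ∈ U) :
    ∃ B : Set M, IsOpen B ∧ x ∈ B ∧ B ⊆ U ∧
      ∃ Ω : M → Matrix (Fin m) (Fin m) ℝ, IsSolution (n := n) B f φ β Ω := by
  obtain ⟨r, hr0, hr, hrU⟩ := exists_coordBall_subset (n := n) (h.isOpen.mem_nhds hx)
  have hB := isOpen_coordBall (n := n) x r
  -- the initial value is symmetric, so that the algebraic identity holds at `x`
  choose u hu0 hu hud using fun i j : Fin m => exists_primitive_inner_diff hr h.isOpen hrU
    (h.contMDiffOn_gColumn i) (h.contMDiffOn_gColumn j)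
    (fun y hy X Y => h.inner_diff_gColumn_comm i j hy X Y)
    ((inner ℝ (gColumn (n := n) f φ β i x) (gColumn (n := n) f φ β j x)
      + (1 : Matrix (Fin m) (Fin m) ℝ) i j) / 2)
  have hone : ∀ i j : Fin m, (1 : Matrix (Fin m) (Fin m) ℝ) i j = (1 : Matrix _ _ ℝ) j i := by
    intro i j
    rw [Matrix.one_apply, Matrix.one_apply]
    simp only [eq_comm]
  have hsym : ∀ y ∈ coordBall (n := n) x r, ∀ i j, u i j y + u j i y
      = inner ℝ (gColumn (n := n) f φ β i y) (gColumn (n := n) f φ β j y)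
          + (1 : Matrix (Fin m) (Fin m) ℝ) i j := by
    intro y hy i j
    have hG := fun i => (h.contMDiffOn_gColumn i).mono hrU
    have h1 := eq_of_diff_eq_zero (η := fun y => u i j y + u j i y
      - inner ℝ (gColumn (n := n) f φ β i y) (gColumn (n := n) f φ β j y)) hr
      (((hu i j).add (hu j i)).sub (contMDiffOn_inner (hG i) (hG j)))
      (fun z hz X => by
        have e1 := mdifferentiableAt_of_contMDiffOn hB (hu i j) hz
        have e2 := mdifferentiableAt_of_contMDiffOn hB (hu j i) hz
        have e3 := mdifferentiableAt_of_contMDiffOn hB (contMDiffOn_inner (hG i) (hG j)) hz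
        refine (diff_sub (e1.add e2) e3 X).trans ?_
        rw [diff_inner (h.mdifferentiableAt_gColumn i (hrU hz))
          (h.mdifferentiableAt_gColumn j (hrU hz))]
        have e4 := diff_add e1 e2 X
        rw [hud i j z hz, hud j i z hz] at e4
        rw [real_inner_comm (gColumn (n := n) f φ β j z)]
        exact sub_eq_zero.2 (e4.trans (add_comm _ _))) hy
    simp only [hu0] at h1
    rw [real_inner_comm (gColumn (n := n) f φ β i x), hone j i] at h1
    linarith
  refine ⟨_, hB, mem_coordBall_self x hr0, hrU, fun y => Matrix.of fun i j => u i j y,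
    (isSolution_iff fun i y hy => h.mdifferentiableAt_gColumn i (hrU hy)).2
      ⟨hu, fun y hy => isUnit_of_add_transpose (hsym y hy), fun y hy X i j => hud i j y hy X, hsym⟩⟩

/-- The data and a solution `Ω`, expressed through linear maps. -/
theorem isTransformData (h : IsData (n := n) S f φ β) (hU : IsOpen U) (hUS : U ⊆ S)
    (hΩ : IsSolution (n := n) U f φ β Ω) :
    IsTransformData (n := n) U f (fun x => WithLp.toLp 2 fun i => φ i x)
      (fun x => ofColumns fun i => gColumn (n := n) f φ β i x)
      (fun x => Matrix.toEuclideanCLM (𝕜 := ℝ) (Ω x)) := by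
  have hG := fun i => (h.contMDiffOn_gColumn i).mono hUS
  have hG' : ∀ i, ∀ x ∈ U, MDifferentiableAt (𝓡 n) 𝓘(ℝ, EuclideanSpace ℝ (Fin (n + p)))
      (gColumn (n := n) f φ β i) x := fun i x hx => h.mdifferentiableAt_gColumn i (hUS hx)
  obtain ⟨h1, h2, h3, h4⟩ := (isSolution_iff hG').1 hΩ
  have hφ : ContMDiffOn (𝓡 n) 𝓘(ℝ, EuclideanSpace ℝ (Fin m)) ∞
      (fun x => WithLp.toLp 2 fun i => φ i x) U :=
    contMDiffOn_toLp_pi fun i => (h.smooth i).mono hUS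
  have hcol : ∀ j, ContMDiffOn (𝓡 n) 𝓘(ℝ, EuclideanSpace ℝ (Fin m)) ∞
      (fun x => WithLp.toLp 2 fun i => Ω x i j) U := fun j => contMDiffOn_toLp_pi fun i => h1 i j
  refine ⟨hU, h.immersion.smooth.mono hUS, hφ, contMDiffOn_ofColumns hG, ?_,
    fun x hx => isInvertible_toEuclideanCLM (h2 x hx),
    fun x hx => inner_toEuclideanCLM_add (h4 x hx), fun x hx X a b => ?_, fun x hx X a => ?_,
    fun x hx X a => ?_⟩
  · simp_rw [toEuclideanCLM_eq_ofColumns]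
    exact contMDiffOn_ofColumns hcol
  · simp_rw [toEuclideanCLM_eq_ofColumns]
    rw [diff_ofColumns (fun i => hG' i x hx),
      diff_ofColumns (fun j => mdifferentiableAt_of_contMDiffOn hU (hcol j) hx)]
    refine inner_ofColumns_eq (fun i j => ?_) a b
    rw [← diff_apply_pi (mdifferentiableAt_of_contMDiffOn hU (hcol j) hx)]
    exact h3 x hx X i j
  · rw [ofColumns_apply, sum_inner, PiLp.inner_apply]
    refine Finset.sum_congr rfl fun i _ => ?_
    rw [inner_smul_left, ← h.diff_fun_eq i (hUS hx),
      ← diff_apply_pi (mdifferentiableAt_of_contMDiffOn hU hφ hx)]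
    exact mul_comm _ _
  · rw [diff_ofColumns (fun i => hG' i x hx), ofColumns_apply]
    refine ⟨∑ i, a i • codazzi (n := n) f φ β i x X, ?_⟩
    rw [map_sum]
    refine Finset.sum_congr rfl fun i _ => ?_
    rw [map_smul, h.diff_gColumn i (hUS hx)]

end IsData

omit [IsManifold (𝓡 n) ∞ M] in
theorem ribaucourMap_eq_transform :
    ribaucourMap (n := n) f φ β Ω = transform f (fun x => WithLp.toLp 2 fun i => φ i x)
      (fun x => ofColumns fun i => gColumn (n := n) f φ β i x)
      (fun x => Matrix.toEuclideanCLM (𝕜 := ℝ) (Ω x)) := by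
  funext x
  rw [transform, toEuclideanCLM_inv, Matrix.toEuclideanCLM_toLp, ← toLp_gMatrix_mulVec]
  rfl

/-- The maps `f`, `φ`, `𝒢` and `Ω` come from data as in `IsData`: the normal field `β_i` is the
normal part of the `i`-th column of `𝒢`. -/
theorem IsTransformData.exists_isData {φ : M → EuclideanSpace ℝ (Fin m)}
    {𝔾 : M → EuclideanSpace ℝ (Fin m) →L[ℝ] EuclideanSpace ℝ (Fin (n + p))}
    {Ω : M → EuclideanSpace ℝ (Fin m) →L[ℝ] EuclideanSpace ℝ (Fin m)}
    (h : IsTransformData (n := n) U f φ 𝔾 Ω) (hU : SimplyConnectedSpace U)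
    (hf : ∀ x ∈ U, Function.Injective (diff (n := n) f x)) :
    ∃ (φ' : Fin m → M → ℝ) (β : Fin m → M → EuclideanSpace ℝ (Fin (n + p)))
      (Ω' : M → Matrix (Fin m) (Fin m) ℝ), IsData (n := n) U f φ' β ∧
      IsSolution (n := n) U f φ' β Ω' ∧ ribaucourMap (n := n) f φ' β Ω' = transform f φ 𝔾 Ω := by
  let e : Fin m → EuclideanSpace ℝ (Fin m) := fun i => EuclideanSpace.single i 1
  let φ' : Fin m → M → ℝ := fun i x => φ x i
  let β : Fin m → M → EuclideanSpace ℝ (Fin (n + p)) := fun i x =>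
    𝔾 x (e i) - pushforward (n := n) f (grad f (φ' i)) x
  let Ω' : M → Matrix (Fin m) (Fin m) ℝ := fun x => (Matrix.toEuclideanCLM (𝕜 := ℝ)).symm (Ω x)
  have hΩ' : ∀ x, Matrix.toEuclideanCLM (𝕜 := ℝ) (Ω' x) = Ω x := fun x =>
    (Matrix.toEuclideanCLM (𝕜 := ℝ)).apply_symm_apply (Ω x)
  have hΩe : ∀ x i j, Ω' x i j = inner ℝ (e i) (Ω x (e j)) := fun x i j => by
    rw [← hΩ', inner_single_toEuclideanCLM]
  have hG : ∀ i, gColumn (n := n) f φ' β i = fun x => 𝔾 x (e i) := fun i => by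
    funext x
    exact add_sub_cancel _ _
  have hGs : ∀ i, ContMDiffOn (𝓡 n) 𝓘(ℝ, EuclideanSpace ℝ (Fin (n + p))) ∞
      (fun x => 𝔾 x (e i)) U := fun i => contMDiffOn_clm_apply h.smooth_frame contMDiffOn_const
  have hGd : ∀ i, ∀ x ∈ U, ∀ X : TangentSpace (𝓡 n) x,
      diff (fun x => 𝔾 x (e i)) x X = diff 𝔾 x X (e i) := fun i x hx X => by
    rw [diff_clm_apply (mdifferentiableAt_of_contMDiffOn h.isOpen h.smooth_frame hx)
      mdifferentiableAt_const, diff_const, map_zero, add_zero]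
  have hφs : ∀ i, ContMDiffOn (𝓡 n) 𝓘(ℝ, ℝ) ∞ (φ' i) U := fun i =>
    contMDiffOn_clm_comp (EuclideanSpace.proj (𝕜 := ℝ) i) h.smooth_fun
  have hφd : ∀ i, ∀ x ∈ U, ∀ X : TangentSpace (𝓡 n) x,
      diff (φ' i) x X = inner ℝ (𝔾 x (e i)) (diff f x X) := fun i x hx X => by
    rw [← h.diff_fun x hx, EuclideanSpace.inner_single_left, map_one, one_mul]
    exact diff_apply_pi (mdifferentiableAt_of_contMDiffOn h.isOpen h.smooth_fun hx) X i
  have hΩs : ∀ i j, ContMDiffOn (𝓡 n) 𝓘(ℝ, ℝ) ∞ (fun x => Ω' x i j) U := fun i j => by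
    simp_rw [hΩe]
    exact contMDiffOn_inner contMDiffOn_const (contMDiffOn_clm_apply h.smooth_sol contMDiffOn_const)
  have hΩd : ∀ x ∈ U, ∀ X : TangentSpace (𝓡 n) x, ∀ i j, diff (fun x => Ω' x i j) x X
      = inner ℝ (𝔾 x (e i)) (diff (fun x => 𝔾 x (e j)) x X) := fun x hx X i j => by
    have h1 := mdifferentiableAt_of_contMDiffOn h.isOpen h.smooth_sol hx
    simp_rw [hΩe]
    rw [diff_inner mdifferentiableAt_const (mdifferentiableAt_clm_apply h1 mdifferentiableAt_const),
      diff_const, inner_zero_left, zero_add, diff_clm_apply h1 mdifferentiableAt_const, diff_const,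
      map_zero, add_zero, h.diff_sol x hx, hGd j x hx]
  have himm : IsSmoothImmersionOn (n := n) f U := ⟨h.smooth_map, hf⟩
  have hps := fun i => contMDiffOn_pushforward_grad h.isOpen himm (hφs i)
  have hβ : ∀ i, IsNormalField (n := n) f U (β i) := fun i =>
    ⟨(hGs i).sub (hps i), fun x hx X => by
      rw [inner_sub_left, pushforward, inner_grad (hf x hx), hφd i x hx, sub_self]⟩
  -- the derivative of `G_i = f_* ∇φ_i + β_i`
  have hsum : ∀ i, ∀ x ∈ U, ∀ X : TangentSpace (𝓡 n) x,
      diff (pushforward f (grad (n := n) f (φ' i))) x X + diff (β i) x X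
        = diff (fun x => 𝔾 x (e i)) x X := fun i x hx X => by
    rw [← hG]
    exact (diff_add (mdifferentiableAt_of_contMDiffOn h.isOpen (hps i) hx)
      (mdifferentiableAt_of_contMDiffOn h.isOpen (hβ i).smooth hx) X).symm
  have hcod : ∀ i, ∀ x ∈ U, ∀ X : TangentSpace (𝓡 n) x,
      diff f x (codazzi (n := n) f φ' β i x X) = diff (fun x => 𝔾 x (e i)) x X := fun i x hx X => by
    have h1 : codazzi (n := n) f φ' β i x X
        = tangentPart (n := n) f x (diff (fun x => 𝔾 x (e i)) x X) := by
      rw [← hsum i x hx, map_add]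
      exact sub_neg_eq_add _ _
    obtain ⟨Z, hZ⟩ := h.tangent x hx X (e i)
    rw [h1, hGd i x hx, hZ, tangentPart_diff (hf x hx)]
  have hsymm : ∀ i, ∀ x ∈ U, ∀ X Y : TangentSpace (𝓡 n) x,
      inner ℝ (diff f x (codazzi (n := n) f φ' β i x X)) (diff f x Y)
        = inner ℝ (diff f x (codazzi (n := n) f φ' β i x Y)) (diff f x X) := fun i x hx X Y => by
    rw [hcod i x hx, hcod i x hx]
    exact inner_diff_symm_of_diff_eq h.isOpen (hφs i) (hGs i) h.smooth_map
      (fun y hy X => hφd i y hy X) hx X Y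
  refine ⟨φ', β, Ω', ⟨h.isOpen, hU, himm, hφs, hβ, fun i x hx X => ?_, fun i j x hx => ?_⟩,
    (isSolution_iff fun i x hx => ?_).2 ⟨hΩs, fun x hx => ?_, fun x hx X i j => ?_,
      fun x hx i j => ?_⟩, ?_⟩
  · obtain ⟨Z, hZ⟩ := h.tangent x hx X (e i)
    have h1 : secondFundForm f (grad f (φ' i)) x X + normalConn f (β i) x X
        = normalPart (n := n) f x (diff (fun x => 𝔾 x (e i)) x X) := by
      rw [← hsum i x hx, map_add]
      rfl
    rw [h1, hGd i x hx, hZ, normalPart_diff (hf x hx)]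
  -- the `Φ_i` commute since the one-forms `⟨G_i, dG_j⟩ = dΩ_ij` are closed
  · refine LinearMap.ext fun X => eq_of_inner_diff_eq (hf x hx) fun Y => ?_
    have h1 := inner_diff_symm_of_diff_eq h.isOpen (hΩs i j) (hGs i) (hGs j)
      (fun y hy X => hΩd y hy X i j) hx X Y
    rw [← hcod i x hx, ← hcod j x hx, ← hcod i x hx, ← hcod j x hx] at h1
    have h2 := hsymm i x hx (codazzi (n := n) f φ' β j x X) Y
    have h3 := hsymm j x hx (codazzi (n := n) f φ' β i x X) Y
    refine h2.trans (h1.symm.trans ?_)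
    rw [real_inner_comm]
    exact h3.symm
  · rw [hG]
    exact mdifferentiableAt_of_contMDiffOn h.isOpen (hGs i) hx
  · exact isUnit_of_isInvertible_toEuclideanCLM (by rw [hΩ']; exact h.isInvertible x hx)
  · rw [hG, hG]
    exact hΩd x hx X i j
  · have h1 := h.symm_eq x hx (e i) (e j)
    rw [real_inner_comm (e j) (Ω x (e i)), ← hΩe, ← hΩe] at h1
    rw [hG, hG, h1, EuclideanSpace.inner_single_left]
    simp [e, Matrix.one_apply]
  · rw [ribaucourMap_eq_transform]
    have h1 : (fun x => ofColumns fun i => gColumn (n := n) f φ' β i x) = 𝔾 := by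
      funext x
      simp_rw [hG]
      exact ofColumns_apply_single (𝔾 x)
    rw [h1]
    simp_rw [hΩ']
    rfl

end Data


section FlatFrame

/-! ### Parallel frames of a parallel flat normal subbundle -/

/-- The operator `(SᵗS)⁻¹ Sᵗ` of an injective linear map `S`. -/
noncomputable def leftInv {E F : Type*} [NormedAddCommGroup E] [NormedSpace ℝ E]
    [NormedAddCommGroup F] [InnerProductSpace ℝ F] (S : E →L[ℝ] F) : F →L[ℝ] E :=
  (gram S).inverse ∘L ((ContinuousLinearMap.compL ℝ E F ℝ).flip S) ∘L
    (innerSL ℝ : F →L[ℝ] F →L[ℝ] ℝ)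

theorem inner_leftInv {E F : Type*} [NormedAddCommGroup E] [NormedSpace ℝ E]
    [FiniteDimensional ℝ E] [NormedAddCommGroup F] [InnerProductSpace ℝ F] {S : E →L[ℝ] F}
    (hS : Function.Injective S) (z : F) (b : E) :
    inner ℝ (S (leftInv S z)) (S b) = inner ℝ z (S b) :=
  inner_inverse_gram hS _ b

theorem contDiffAt_leftInv {E F : Type*} [NormedAddCommGroup E] [NormedSpace ℝ E]
    [FiniteDimensional ℝ E] [NormedAddCommGroup F] [InnerProductSpace ℝ F] {S : E →L[ℝ] F}
    (hS : Function.Injective S) : ContDiffAt ℝ ∞ (leftInv : (E →L[ℝ] F) → F →L[ℝ] E) S := by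
  unfold leftInv
  exact (contDiffAt_inverse_gram hS).clm_comp (by fun_prop)

/-- Solutions of a linear total differential equation with smooth coefficients are smooth. -/
theorem contDiffOn_of_hasFDerivAt_flip {E V : Type*} [NormedAddCommGroup E] [NormedSpace ℝ E]
    [NormedAddCommGroup V] [NormedSpace ℝ V] {A : E → E →L[ℝ] V →L[ℝ] V} {a : E → V} {s : Set E}
    (hs : IsOpen s) (hA : ContDiffOn ℝ ∞ A s) (ha : ∀ x ∈ s, HasFDerivAt a ((A x).flip (a x)) x) :
    ContDiffOn ℝ ∞ a s := by
  have hd : DifferentiableOn ℝ a s := fun x hx => (ha x hx).differentiableAt.differentiableWithinAt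
  refine contDiffOn_infty.2 fun k => ?_
  induction k with
  | zero => exact contDiffOn_zero.2 hd.continuousOn
  | succ k ih =>
    push_cast
    refine (contDiffOn_succ_iff_fderiv_of_isOpen hs).2 ⟨hd, by simp, ?_⟩
    have h1 : ContDiffOn ℝ k (fun x => (A x).flip (a x)) s :=
      ((ContinuousLinearMap.flipₗᵢ ℝ E V V).contDiff.comp_contDiffOn
        (hA.of_le (by exact_mod_cast le_top))).clm_apply ih
    exact h1.congr fun x hx => (ha x hx).fderiv

variable {n : ℕ} {M : Type*} [TopologicalSpace M] [ChartedSpace (EuclideanSpace ℝ (Fin n)) M]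
  [IsManifold (𝓡 n) ∞ M]
  {F : Type*} [NormedAddCommGroup F] [InnerProductSpace ℝ F]

/-- Coordinate vector fields commute. -/
theorem mlieBracket_coordField (x₀ : M) (v w : EuclideanSpace ℝ (Fin n)) {y : M}
    (hy : y ∈ (extChartAt (𝓡 n) x₀).source) :
    VectorField.mlieBracket (𝓡 n) (coordField x₀ v) (coordField x₀ w) y = 0 := by
  have ho := isOpen_extChartAt_source (I := 𝓡 n) x₀
  have hc : ContMDiffOn (𝓡 n) 𝓘(ℝ, EuclideanSpace ℝ (Fin n)) ∞ (extChartAt (𝓡 n) x₀)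
      (extChartAt (𝓡 n) x₀).source := by
    rw [extChartAt_source]
    exact contMDiffOn_extChartAt
  have hconst : ∀ v w : EuclideanSpace ℝ (Fin n), diff (fun z => diff (extChartAt (𝓡 n) x₀) z
      (coordField x₀ v z)) y (coordField x₀ w y) = 0 := fun v w => by
    have h : (fun z => diff (extChartAt (𝓡 n) x₀) z (coordField x₀ v z)) =ᶠ[𝓝 y] fun _ => v := by
      filter_upwards [ho.mem_nhds hy] with z hz using mfderiv_extChartAt_coordField hz v
    rw [diff_congr h, diff_const]
  have h := diff_diff_sub_eq_diff_mlieBracket ho hc hy (isSmoothVectorField_coordField x₀ v)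
    (isSmoothVectorField_coordField x₀ w)
  rw [hconst, hconst, sub_zero] at h
  exact (injective_iff_map_eq_zero (mfderiv (𝓡 n) 𝓘(ℝ, EuclideanSpace ℝ (Fin n))
    (extChartAt (𝓡 n) x₀) y)).1 (mfderiv_extChartAt_injective hy) _ h.symm

variable {m : ℕ} {g : M → F} {E : M → Submodule ℝ F} {U : Set M}

/-- A parallel flat normal subbundle has, near every point, an orthonormal frame of parallel
sections; parallel means that the derivatives of the sections in the ambient space are
tangential. -/
theorem IsParallelFlatNormalSubbundle.exists_parallel_frame
    (hg : IsSmoothImmersionOn (n := n) g U)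
    (hE : IsParallelFlatNormalSubbundle (n := n) g U m E) {x₀ : M} (hx₀ : x₀ ∈ U) :
    ∃ (B : Set M) (ξ : Fin m → M → F), IsOpen B ∧ x₀ ∈ B ∧ B ⊆ U ∧
      (∀ i, ContMDiffOn (𝓡 n) 𝓘(ℝ, F) ∞ (ξ i) B) ∧
      (∀ y ∈ B, Orthonormal ℝ fun i => ξ i y) ∧
      (∀ i, ∀ y ∈ B, ∀ X : TangentSpace (𝓡 n) y, inner ℝ (ξ i y) (diff g y X) = 0) ∧
      ∀ i, ∀ y ∈ B, ∀ X : TangentSpace (𝓡 n) y, ∃ Z : TangentSpace (𝓡 n) y,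
        diff (ξ i) y X = diff g y Z := by
  obtain ⟨W, hW, hxW, hWU, s, hs, hspan⟩ := hE.smooth x₀ hx₀
  obtain ⟨r, hr0, hr, hrW⟩ := exists_coordBall_subset (n := n) (hW.mem_nhds hxW)
  have hB := isOpen_coordBall (n := n) x₀ r
  set u₀ := extChartAt (𝓡 n) x₀ x₀ with hu₀
  let S : M → EuclideanSpace ℝ (Fin m) →L[ℝ] F := fun y => ofColumns fun i => s i y
  have hS : ContMDiffOn (𝓡 n) 𝓘(ℝ, EuclideanSpace ℝ (Fin m) →L[ℝ] F) ∞ S W :=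
    contMDiffOn_ofColumns hs
  have hSd : ∀ y ∈ W, MDifferentiableAt (𝓡 n) 𝓘(ℝ, EuclideanSpace ℝ (Fin m) →L[ℝ] F) S y :=
    fun y hy => mdifferentiableAt_of_contMDiffOn hW hS hy
  have hSmem : ∀ y ∈ W, ∀ a, S y a ∈ E y := fun y hy a => by
    rw [← hspan y hy]
    exact (Submodule.mem_span_range_iff_exists_fun ℝ).2 ⟨a, (ofColumns_apply _ a).symm⟩
  have hSex : ∀ y ∈ W, ∀ v ∈ E y, ∃ a, S y a = v := fun y hy v hv => by
    rw [← hspan y hy] at hv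
    obtain ⟨c, hc⟩ := (Submodule.mem_span_range_iff_exists_fun ℝ).1 hv
    exact ⟨WithLp.toLp 2 c, (ofColumns_apply _ _).trans hc⟩
  have hSinj : ∀ y ∈ W, Function.Injective (S y) := fun y hy => by
    have hr : LinearMap.range (S y).toLinearMap = E y :=
      le_antisymm (by rintro _ ⟨a, rfl⟩; exact hSmem y hy a) fun v hv => hSex y hy v hv
    have h1 := (S y).toLinearMap.finrank_range_add_finrank_ker
    rw [hr, hE.rank y (hWU hy), finrank_euclideanSpace_fin] at h1
    exact LinearMap.ker_eq_bot.1 (Submodule.finrank_eq_zero.1 (by omega))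
  have hnorm : ∀ y ∈ W, ∀ a, ∀ X : TangentSpace (𝓡 n) y, inner ℝ (S y a) (diff g y X) = 0 :=
    fun y hy a X => hE.normal y (hWU hy) _ (hSmem y hy a) X
  -- the connection form of the normal connection in the frame `s`, with the opposite sign
  let A : EuclideanSpace ℝ (Fin n) → EuclideanSpace ℝ (Fin n) →L[ℝ]
      EuclideanSpace ℝ (Fin m) →L[ℝ] EuclideanSpace ℝ (Fin m) := fun u =>
    -((ContinuousLinearMap.compL ℝ (EuclideanSpace ℝ (Fin m)) F (EuclideanSpace ℝ (Fin m))
      (leftInv (coordRep x₀ S u))) ∘L fderiv ℝ (coordRep x₀ S) u)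
  have hA : ContDiffOn ℝ ∞ A (ball u₀ r) := by
    intro u hu
    have hm := symm_mem_coordBall hr hu
    have h1 := contDiffAt_coordRep hm.1 (hS.contMDiffAt (hW.mem_nhds (hrW hm)))
    rw [(extChartAt (𝓡 n) x₀).right_inv (hr hu)] at h1
    have h2 : ContDiffAt ℝ ∞ (fun u => leftInv (coordRep x₀ S u)) u :=
      ContDiffAt.comp (g := leftInv) u (contDiffAt_leftInv (hSinj _ (hrW hm))) h1
    have h3 : ContDiffAt ℝ ∞ (fderiv ℝ (coordRep x₀ S)) u := h1.fderiv_right (by simp)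
    exact (((ContinuousLinearMap.contDiff _).contDiffAt.comp u h2).clm_comp h3).neg.contDiffWithinAt
  have hAapp : ∀ y ∈ coordBall (n := n) x₀ r, ∀ v b,
      A (extChartAt (𝓡 n) x₀ y) v b = -leftInv (S y) (diff S y (coordField x₀ v y) b) := by
    intro y hy v b
    rw [diff_coordField hy.1 (hSd y (hrW hy)), ← coordRep_extChartAt hy.1 S]
    rfl
  have hconn : ∀ y ∈ coordBall (n := n) x₀ r, ∀ v b,
      normalPart (n := n) g y (diff S y (coordField x₀ v y) b)
        = -S y (A (extChartAt (𝓡 n) x₀ y) v b) := by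
    intro y hy v b
    have hyW := hrW hy
    have hmem : normalPart (n := n) g y (diff S y (coordField x₀ v y) b) ∈ E y := by
      have h := hE.parallel W hW hWU (fun y => S y b)
        ⟨contMDiffOn_clm_apply hS contMDiffOn_const, fun y hy => hSmem y hy b⟩ y hyW
        (coordField x₀ v y)
      rwa [normalConn_apply, diff_clm_apply (hSd y hyW) mdifferentiableAt_const, diff_const,
        map_zero, add_zero] at h
    obtain ⟨c, hc⟩ := hSex y hyW _ hmem
    rw [← hc, hAapp y hy, map_neg, neg_neg]
    congr 1
    refine hSinj y hyW (sub_eq_zero.1 ?_)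
    rw [← map_sub, ← inner_self_eq_zero (𝕜 := ℝ)]
    nth_rewrite 1 [map_sub]
    rw [inner_sub_left, inner_leftInv (hSinj y hyW), hc, normalPart_apply, inner_sub_left,
      real_inner_comm _ (diff g y _), hnorm y hyW, sub_zero, sub_self]
  -- the normal connection in the frame `s`
  have hnc : ∀ y ∈ coordBall (n := n) x₀ r, ∀ (c : M → EuclideanSpace ℝ (Fin m)),
      MDifferentiableAt (𝓡 n) 𝓘(ℝ, EuclideanSpace ℝ (Fin m)) c y → ∀ v,
      normalConn g (fun y => S y (c y)) y (coordField x₀ v y)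
        = S y (diff c y (coordField x₀ v y) - A (extChartAt (𝓡 n) x₀ y) v (c y)) := by
    intro y hy c hc v
    rw [normalConn_apply, diff_clm_apply (hSd y (hrW hy)) hc, map_add, hconn y hy,
      normalPart_of_normal (hg.injective y (hWU (hrW hy))) (hnorm y (hrW hy) _), map_sub]
    abel
  -- vanishing curvature on coordinate vector fields is flatness of the connection form
  have hflat : ∀ u ∈ ball u₀ r, ∀ v w, fderiv ℝ A u v w + A u w ∘L A u v
      = fderiv ℝ A u w v + A u v ∘L A u w := by
    intro u hu v w
    set y := (extChartAt (𝓡 n) x₀).symm u with hy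
    have hm : y ∈ coordBall (n := n) x₀ r := symm_mem_coordBall hr hu
    have hyu : extChartAt (𝓡 n) x₀ y = u := (extChartAt (𝓡 n) x₀).right_inv (hr hu)
    have hAd : DifferentiableAt ℝ A u :=
      (hA.contDiffAt (isOpen_ball.mem_nhds hu)).differentiableAt (by simp)
    refine ContinuousLinearMap.ext fun b => ?_
    have key : ∀ v w, normalConn g (fun y => normalConn g (fun y => S y b) y (coordField x₀ w y)) y
        (coordField x₀ v y) = S y (-fderiv ℝ A u v w b + A u v (A u w b)) := by
      intro v w
      have h1 : HasFDerivAt (fun u => -A u w b) (-((ContinuousLinearMap.apply ℝ _ b ∘L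
          ContinuousLinearMap.apply ℝ _ w) ∘L fderiv ℝ A u)) u :=
        ((ContinuousLinearMap.apply ℝ _ b ∘L
          ContinuousLinearMap.apply ℝ _ w).hasFDerivAt.comp u hAd.hasFDerivAt).neg
      have h2 : (fun y => normalConn g (fun y => S y b) y (coordField x₀ w y)) =ᶠ[𝓝 y]
          fun y => S y (-A (extChartAt (𝓡 n) x₀ y) w b) := by
        filter_upwards [hB.mem_nhds hm] with z hz
        rw [hnc z hz _ mdifferentiableAt_const, diff_const, zero_sub]
      have h3 := h1.differentiableAt
      rw [← hyu] at h3
      have hyx : MDifferentiableAt (𝓡 n) 𝓘(ℝ, EuclideanSpace ℝ (Fin n))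
          (extChartAt (𝓡 n) x₀) y := by
        have := isManifold_one (n := n) (M := M)
        exact mdifferentiableAt_extChartAt (by simpa using! hm.1)
      rw [normalConn_congr h2, hnc y hm _ (mdifferentiableAt_comp_of_hasFDerivAt
        h3.hasFDerivAt hyx), diff_comp_extChartAt hm.1 h3, hyu, h1.fderiv]
      congr 1
      rw [map_neg, sub_neg_eq_add]
      rfl
    have hcurv := hE.flat (coordBall x₀ r) hB (hrW.trans hWU) (fun y => S y b)
      ⟨(contMDiffOn_clm_apply hS contMDiffOn_const).mono hrW, fun y hy => hSmem y (hrW hy) b⟩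
      (coordField x₀ v) (coordField x₀ w)
      ((isSmoothVectorField_coordField x₀ v).mono fun y hy => hy.1)
      ((isSmoothVectorField_coordField x₀ w).mono fun y hy => hy.1) y hm
    rw [normalCurvature, key, key, mlieBracket_coordField x₀ v w hm.1, map_zero, sub_zero,
      ← map_sub] at hcurv
    have h0 := (injective_iff_map_eq_zero (S y)).1 (hSinj y (hrW hm)) _ hcurv
    change fderiv ℝ A u v w b + A u w (A u v b) = fderiv ℝ A u w v b + A u v (A u w b)
    rw [← sub_eq_zero, ← neg_eq_zero, ← h0]
    abel
  obtain ⟨ρ, hρ, hsol⟩ := exists_flat_section (ball_mem_nhds u₀ hr0)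
    ((hA.contDiffAt (ball_mem_nhds u₀ hr0)).of_le two_le_infty) hflat
  -- the initial values of the parallel sections
  have hfin := hE.rank x₀ hx₀
  have : FiniteDimensional ℝ (E x₀) := by
    rw [← hspan x₀ hxW]
    exact FiniteDimensional.span_of_finite ℝ (finite_range _)
  let o : OrthonormalBasis (Fin m) ℝ (E x₀) :=
    (stdOrthonormalBasis ℝ (E x₀)).reindex (finCongr hfin)
  choose a₀ ha₀ using fun i => hSex x₀ hxW (o i : F) (o i).2
  choose a ha hda using fun i => hsol (a₀ i)
  set r' := min r ρ with hr'
  have hB' := isOpen_coordBall (n := n) x₀ r'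
  have hr'r := coordBall_mono (n := n) x₀ (min_le_left r ρ)
  have hbr : ball u₀ r' ⊆ ball u₀ r := ball_subset_ball (min_le_left r ρ)
  have hbρ : ball u₀ r' ⊆ ball u₀ ρ := ball_subset_ball (min_le_right r ρ)
  have has : ∀ i, ContDiffOn ℝ ∞ (a i) (ball u₀ r') := fun i =>
    contDiffOn_of_hasFDerivAt_flip isOpen_ball (hA.mono hbr) fun u hu => hda i u (hbρ hu)
  have hac : ∀ i, ContMDiffOn (𝓡 n) 𝓘(ℝ, EuclideanSpace ℝ (Fin m)) ∞
      (fun y => a i (extChartAt (𝓡 n) x₀ y)) (coordBall (n := n) x₀ r') := fun i y hy =>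
    (contMDiffAt_comp_extChartAt hy.1
      ((has i).contDiffAt (isOpen_ball.mem_nhds hy.2))).contMDiffWithinAt
  let ξ : Fin m → M → F := fun i y => S y (a i (extChartAt (𝓡 n) x₀ y))
  have hξs : ∀ i, ContMDiffOn (𝓡 n) 𝓘(ℝ, F) ∞ (ξ i) (coordBall (n := n) x₀ r') := fun i =>
    contMDiffOn_clm_apply (hS.mono (hr'r.trans hrW)) (hac i)
  have hξn : ∀ i, ∀ y ∈ coordBall (n := n) x₀ r', ∀ X : TangentSpace (𝓡 n) y,
      inner ℝ (ξ i y) (diff g y X) = 0 := fun i y hy X => hnorm y (hrW (hr'r hy)) _ X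
  have hξt : ∀ i, ∀ y ∈ coordBall (n := n) x₀ r', ∀ X : TangentSpace (𝓡 n) y,
      ∃ Z : TangentSpace (𝓡 n) y, diff (ξ i) y X = diff g y Z := by
    intro i y hy X
    obtain ⟨v, rfl⟩ := exists_coordField_eq hy.1 X
    have h1 := hnc y (hr'r hy) _ (mdifferentiableAt_of_contMDiffOn hB' (hac i) hy) v
    have h2 := hda i _ (hbρ hy.2)
    rw [diff_comp_extChartAt hy.1 h2.differentiableAt, h2.fderiv, ContinuousLinearMap.flip_apply,
      sub_self, map_zero, normalConn_apply, normalPart_apply, sub_eq_zero] at h1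
    exact ⟨_, h1⟩
  refine ⟨_, ξ, hB', mem_coordBall_self x₀ (lt_min hr0 hρ), (hr'r.trans hrW).trans hWU, hξs,
    fun y hy => ?_, hξn, hξt⟩
  -- the inner products of parallel sections are constant
  rw [orthonormal_iff_ite]
  intro i j
  have h1 := eq_of_diff_eq_zero (η := fun y => inner ℝ (ξ i y) (ξ j y)) (hbr.trans hr)
    (contMDiffOn_inner (hξs i) (hξs j)) (fun z hz X => by
      rw [diff_inner (mdifferentiableAt_of_contMDiffOn hB' (hξs i) hz)
        (mdifferentiableAt_of_contMDiffOn hB' (hξs j) hz)]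
      obtain ⟨Z, hZ⟩ := hξt i z hz X
      obtain ⟨Z', hZ'⟩ := hξt j z hz X
      rw [hZ, hZ', hξn i z hz, real_inner_comm, hξn j z hz, add_zero]) hy
  rw [h1]
  have h2 : ∀ i, ξ i x₀ = o i := fun i => by
    rw [← ha₀ i, ← ha i]
  rw [h2, h2, ← orthonormal_iff_ite.1 o.orthonormal i j]
  rfl

end FlatFrame


/-! ### Recovering the data from a submanifold -/

/-- Every square matrix becomes invertible after adding a suitable diagonal matrix of signs. -/
theorem exists_isUnit_add_diagonal {m : ℕ} (A : Matrix (Fin m) (Fin m) ℝ) :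
    ∃ ε : Fin m → ℝ, (∀ i, ε i * ε i = 1) ∧ IsUnit (A + Matrix.diagonal ε) := by
  -- replace the rows of the identity matrix one by one: a determinant is affine in each row
  have key : ∀ s : Finset (Fin m), ∃ ε : Fin m → ℝ, (∀ i, ε i * ε i = 1) ∧
      (Matrix.of fun i => if i ∈ s then A i + Pi.single i (ε i)
        else Pi.single i (1 : ℝ)).det ≠ 0 := by
    intro s
    induction s using Finset.induction_on with
    | empty =>
      refine ⟨fun _ => 1, fun _ => one_mul 1, ?_⟩
      have : (Matrix.of fun i => if i ∈ (∅ : Finset (Fin m)) then A i + Pi.single i (1 : ℝ)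
          else Pi.single i (1 : ℝ)) = 1 := by
        ext i j
        simp [Matrix.one_apply, Pi.single_apply, eq_comm]
      rw [this, Matrix.det_one]
      exact one_ne_zero
    | insert k s hk ih =>
      obtain ⟨ε, hε, hdet⟩ := ih
      set N : Matrix (Fin m) (Fin m) ℝ :=
        Matrix.of fun i => if i ∈ s then A i + Pi.single i (ε i) else Pi.single i (1 : ℝ) with hN
      have hNk : N.updateRow k (Pi.single k 1) = N := by
        have : (Pi.single k 1 : Fin m → ℝ) = N k := (if_neg hk).symm
        rw [this, Matrix.updateRow_eq_self]
      have hrow : ∀ t : ℝ, (Matrix.of fun i => if i ∈ insert k s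
          then A i + Pi.single i (Function.update ε k t i) else Pi.single i (1 : ℝ))
          = N.updateRow k (A k + t • Pi.single k 1) := by
        intro t
        ext i j
        rcases eq_or_ne i k with rfl | hik
        · simp [Pi.single_apply]
        · simp [hN, Finset.mem_insert, hik]
      have hd : ∀ t : ℝ, (N.updateRow k (A k + t • Pi.single k 1)).det
          = (N.updateRow k (A k)).det + t * N.det := fun t => by
        rw [Matrix.det_updateRow_add, Matrix.det_updateRow_smul, hNk]
      have hsign : ∀ t : ℝ, t * t = 1 →
          ∀ i, Function.update ε k t i * Function.update ε k t i = 1 := by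
        intro t ht i
        rcases eq_or_ne i k with rfl | hik
        · simpa using ht
        · simpa [Function.update_of_ne hik] using hε i
      by_cases h1 : (N.updateRow k (A k)).det + 1 * N.det = 0
      · refine ⟨Function.update ε k (-1), hsign _ (by norm_num), ?_⟩
        rw [hrow, hd]
        intro h2
        exact hdet (by linarith)
      · exact ⟨Function.update ε k 1, hsign _ (by norm_num), by rw [hrow, hd]; exact h1⟩
  obtain ⟨ε, hε, hdet⟩ := key Finset.univ
  refine ⟨ε, hε, ?_⟩
  rw [Matrix.isUnit_iff_isUnit_det, isUnit_iff_ne_zero]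
  convert hdet using 2
  ext i j
  simp [Matrix.diagonal_apply, Pi.single_apply, eq_comm]

section Recover

variable {n : ℕ} {M : Type*} [TopologicalSpace M] [ChartedSpace (EuclideanSpace ℝ (Fin n)) M]
  {V : Type*} [NormedAddCommGroup V] [InnerProductSpace ℝ V]
  {W : Type*} [NormedAddCommGroup W] [InnerProductSpace ℝ W] [FiniteDimensional ℝ W]

/-- The projection of the orthogonal sum to the first summand. -/
noncomputable def fstCLM (V W : Type*) [NormedAddCommGroup V] [InnerProductSpace ℝ V]
    [NormedAddCommGroup W] [InnerProductSpace ℝ W] : WithLp 2 (V × W) →L[ℝ] V :=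
  ContinuousLinearMap.fst ℝ V W ∘L (WithLp.prodContinuousLinearEquiv 2 ℝ V W).toContinuousLinearMap

/-- The projection of the orthogonal sum to the second summand. -/
noncomputable def sndCLM (V W : Type*) [NormedAddCommGroup V] [InnerProductSpace ℝ V]
    [NormedAddCommGroup W] [InnerProductSpace ℝ W] : WithLp 2 (V × W) →L[ℝ] W :=
  ContinuousLinearMap.snd ℝ V W ∘L (WithLp.prodContinuousLinearEquiv 2 ℝ V W).toContinuousLinearMap

omit [FiniteDimensional ℝ W] in
theorem inner_eq_fstCLM_add_sndCLM (z z' : WithLp 2 (V × W)) : inner ℝ z z'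
    = inner ℝ (fstCLM V W z) (fstCLM V W z') + inner ℝ (sndCLM V W z) (sndCLM V W z') :=
  WithLp.prod_inner_apply z z'

variable [IsManifold (𝓡 n) ∞ M]

/-- A submanifold `g = (g₁, g₂)` with an orthonormal frame `(𝕌 b, 𝕎 b)` of parallel normal fields
is locally a transform: here `Ω = (𝕎 + 1)⁻¹`, `𝒢 = 𝕌 Ω`, `φ = -Ω (g₂ + c)` and
`f = g₁ - 𝒢 (g₂ + c)`. -/
theorem exists_isTransformData {B : Set M} (hB : IsOpen B) {g : M → WithLp 2 (V × W)}
    (hg : IsSmoothImmersionOn (n := n) g B) {𝕏 : M → W →L[ℝ] WithLp 2 (V × W)}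
    (h𝕏 : ContMDiffOn (𝓡 n) 𝓘(ℝ, W →L[ℝ] WithLp 2 (V × W)) ∞ 𝕏 B)
    (hiso : ∀ y ∈ B, ∀ a b, inner ℝ (𝕏 y a) (𝕏 y b) = inner ℝ a b)
    (hn : ∀ y ∈ B, ∀ b, ∀ X : TangentSpace (𝓡 n) y, inner ℝ (𝕏 y b) (diff g y X) = 0)
    (ht : ∀ y ∈ B, ∀ X : TangentSpace (𝓡 n) y, ∀ b, ∃ Z : TangentSpace (𝓡 n) y,
      diff 𝕏 y X b = diff g y Z) {x₀ : M} (hx₀ : x₀ ∈ B)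
    (hinv₀ : (sndCLM V W ∘L 𝕏 x₀ + ContinuousLinearMap.id ℝ W).IsInvertible) :
    ∃ (U : Set M) (f : M → V) (φ : M → W) (𝔾 : M → W →L[ℝ] V) (Ω : M → W →L[ℝ] W) (c : W),
      x₀ ∈ U ∧ SimplyConnectedSpace U ∧ IsTransformData (n := n) U f φ 𝔾 Ω ∧
      (∀ x ∈ U, Function.Injective (diff (n := n) f x)) ∧
      ∀ y ∈ U, g y + WithLp.toLp 2 (0, c) = transform f φ 𝔾 Ω y := by
  have : CompleteSpace W := FiniteDimensional.complete ℝ W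
  let A : M → W →L[ℝ] W := fun y => sndCLM V W ∘L 𝕏 y + ContinuousLinearMap.id ℝ W
  have hAs : ContMDiffOn (𝓡 n) 𝓘(ℝ, W →L[ℝ] W) ∞ A B :=
    (contMDiffOn_clm_comp (ContinuousLinearMap.compL ℝ W (WithLp 2 (V × W)) W (sndCLM V W)) h𝕏).add
      contMDiffOn_const
  have hnear : {y | (A y).IsInvertible} ∈ 𝓝 x₀ := by
    obtain ⟨e, he⟩ := hinv₀
    have h1 := (hAs.contMDiffAt (hB.mem_nhds hx₀)).continuousAt
    have h2 := e.nhds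
    rw [he] at h2
    exact h1 h2
  obtain ⟨r, hr0, hr, hrB⟩ := exists_coordBall_subset (n := n) (inter_mem (hB.mem_nhds hx₀) hnear)
  set C := coordBall (n := n) x₀ r with hC
  have hCo : IsOpen C := isOpen_coordBall x₀ r
  have hCB : C ⊆ B := fun y hy => (hrB hy).1
  have hinv : ∀ y ∈ C, (A y).IsInvertible := fun y hy => (hrB hy).2
  let g₁ : M → V := fun y => fstCLM V W (g y)
  -- the second component of `g`, translated to vanish at `x₀`
  let h : M → W := fun y => sndCLM V W (g y) - sndCLM V W (g x₀)
  let 𝕌 : M → W →L[ℝ] V := fun y => fstCLM V W ∘L 𝕏 y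
  let Ω : M → W →L[ℝ] W := fun y => (A y).inverse
  let 𝔾 : M → W →L[ℝ] V := fun y => 𝕌 y ∘L Ω y
  let φ : M → W := fun y => -Ω y (h y)
  let f : M → V := fun y => g₁ y - 𝔾 y (h y)
  have hg₁ : ContMDiffOn (𝓡 n) 𝓘(ℝ, V) ∞ g₁ C := contMDiffOn_clm_comp _ (hg.smooth.mono hCB)
  have hh : ContMDiffOn (𝓡 n) 𝓘(ℝ, W) ∞ h C :=
    (contMDiffOn_clm_comp (sndCLM V W) (hg.smooth.mono hCB)).sub contMDiffOn_const
  have h𝕌 : ContMDiffOn (𝓡 n) 𝓘(ℝ, W →L[ℝ] V) ∞ 𝕌 C := contMDiffOn_clm_comp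
    (ContinuousLinearMap.compL ℝ W (WithLp 2 (V × W)) V (fstCLM V W)) (h𝕏.mono hCB)
  have hΩ : ContMDiffOn (𝓡 n) 𝓘(ℝ, W →L[ℝ] W) ∞ Ω C :=
    contMDiffOn_clm_inverse hCo (hAs.mono hCB) hinv
  have h𝔾 : ContMDiffOn (𝓡 n) 𝓘(ℝ, W →L[ℝ] V) ∞ 𝔾 C :=
    contMDiffOn_bilin (ContinuousLinearMap.compL ℝ W W V) h𝕌 hΩ
  have hφ : ContMDiffOn (𝓡 n) 𝓘(ℝ, W) ∞ φ C := (contMDiffOn_clm_apply hΩ hh).neg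
  have hf : ContMDiffOn (𝓡 n) 𝓘(ℝ, V) ∞ f C := hg₁.sub (contMDiffOn_clm_apply h𝔾 hh)
  have hgd := fun y (hy : y ∈ C) => mdifferentiableAt_of_contMDiffOn hB hg.smooth (hCB hy)
  have h𝕏d := fun y (hy : y ∈ C) => mdifferentiableAt_of_contMDiffOn hB h𝕏 (hCB hy)
  have hAd := fun y (hy : y ∈ C) => mdifferentiableAt_of_contMDiffOn hB hAs (hCB hy)
  have h𝕌d := fun y (hy : y ∈ C) => mdifferentiableAt_of_contMDiffOn hCo h𝕌 hy
  have hΩd := fun y (hy : y ∈ C) => mdifferentiableAt_of_contMDiffOn hCo hΩ hy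
  have h𝔾d := fun y (hy : y ∈ C) => mdifferentiableAt_of_contMDiffOn hCo h𝔾 hy
  have hg₁d := fun y (hy : y ∈ C) => mdifferentiableAt_of_contMDiffOn hCo hg₁ hy
  have hhd := fun y (hy : y ∈ C) => mdifferentiableAt_of_contMDiffOn hCo hh hy
  have hAΩ : ∀ y ∈ C, ∀ b, A y (Ω y b) = b := fun y hy b => (hinv y hy).self_apply_inverse b
  have hΩA : ∀ y ∈ C, ∀ b, Ω y (A y b) = b := fun y hy b => (hinv y hy).inverse_apply_self b
  have hAapp : ∀ y b, sndCLM V W (𝕏 y b) = A y b - b := fun y b => (add_sub_cancel_right _ _).symm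
  have dg₁ : ∀ y ∈ C, ∀ X : TangentSpace (𝓡 n) y, diff g₁ y X = fstCLM V W (diff g y X) :=
    fun y hy X => diff_clm_comp _ (hgd y hy) X
  have dh : ∀ y ∈ C, ∀ X : TangentSpace (𝓡 n) y, diff h y X = sndCLM V W (diff g y X) :=
    fun y hy X => by
      have := diff_sub (mdifferentiableAt_comp_of_hasFDerivAt (sndCLM V W).hasFDerivAt (hgd y hy))
        (mdifferentiableAt_const (c := sndCLM V W (g x₀))) X
      rw [diff_const, sub_zero, diff_clm_comp _ (hgd y hy)] at this
      exact this
  -- the algebraic identity for `Ω`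
  have hsymm : ∀ y ∈ C, ∀ a b, inner ℝ a (Ω y b) + inner ℝ (Ω y a) b
      = inner ℝ (𝔾 y a) (𝔾 y b) + inner ℝ a b := by
    intro y hy a b
    have h1 := hiso y (hCB hy) (Ω y a) (Ω y b)
    rw [inner_eq_fstCLM_add_sndCLM, hAapp, hAapp, hAΩ y hy, hAΩ y hy] at h1
    have h2 : inner ℝ (𝔾 y a) (𝔾 y b)
      = inner ℝ (fstCLM V W (𝕏 y (Ω y a))) (fstCLM V W (𝕏 y (Ω y b))) := rfl
    simp only [inner_sub_left, inner_sub_right] at h1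
    linarith
  -- the map `τ = dg₁ - 𝒢 dg₂`
  let τ : ∀ y : M, TangentSpace (𝓡 n) y →ₗ[ℝ] V := fun y =>
    diff g₁ y - (𝔾 y).toLinearMap ∘ₗ diff h y
  have hτ : ∀ y, ∀ X : TangentSpace (𝓡 n) y, τ y X = diff g₁ y X - 𝔾 y (diff h y X) :=
    fun y X => rfl
  have hinner : ∀ y ∈ C, ∀ b, ∀ Z : TangentSpace (𝓡 n) y,
      inner ℝ (𝔾 y b) (τ y Z) = -inner ℝ b (Ω y (diff h y Z)) := by
    intro y hy b Z
    have h1 := hn y (hCB hy) (Ω y b) Z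
    rw [inner_eq_fstCLM_add_sndCLM, hAapp, hAΩ y hy, ← dg₁ y hy, ← dh y hy, inner_sub_left] at h1
    have h2 := hsymm y hy b (diff h y Z)
    have h3 : inner ℝ (fstCLM V W (𝕏 y (Ω y b))) (diff g₁ y Z)
      = inner ℝ (𝔾 y b) (diff g₁ y Z) := rfl
    rw [hτ, inner_sub_right]
    linarith
  have hτinj : ∀ y ∈ C, Function.Injective (τ y) := by
    intro y hy
    rw [injective_iff_map_eq_zero]
    intro X hX
    have h1 : Ω y (diff h y X) = 0 := ext_inner_left ℝ fun b => by
      have := hinner y hy b X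
      rw [hX, inner_zero_right] at this
      rw [inner_zero_right]
      linarith
    have h2 : diff h y X = 0 := by rw [← hAΩ y hy (diff h y X), h1, map_zero]
    have h3 : diff g₁ y X = 0 := by
      have := hτ y X
      rwa [hX, h2, map_zero, sub_zero, eq_comm] at this
    refine (injective_iff_map_eq_zero _).1 (hg.injective y (hCB hy)) X ?_
    rw [← inner_self_eq_zero (𝕜 := ℝ), inner_eq_fstCLM_add_sndCLM, ← dg₁ y hy, ← dh y hy, h2, h3,
      inner_zero_left, inner_zero_left, add_zero]
  -- the differentials of `Ω` and `𝒢`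
  have hder : ∀ y ∈ C, ∀ X : TangentSpace (𝓡 n) y, ∀ b, ∃ Z : TangentSpace (𝓡 n) y,
      diff Ω y X b = -Ω y (diff h y Z) ∧ diff 𝔾 y X b = τ y Z := by
    intro y hy X b
    obtain ⟨Z, hZ⟩ := ht y (hCB hy) X (Ω y b)
    have hdA : diff A y X (Ω y b) = diff h y Z := by
      have e1 := diff_add (mdifferentiableAt_comp_of_hasFDerivAt (ContinuousLinearMap.compL ℝ W
        (WithLp 2 (V × W)) W (sndCLM V W)).hasFDerivAt (h𝕏d y hy))
        (mdifferentiableAt_const (c := ContinuousLinearMap.id ℝ W)) X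
      rw [diff_const, add_zero, diff_clm_comp _ (h𝕏d y hy)] at e1
      rw [dh y hy, ← hZ]
      exact congrArg (fun T : W →L[ℝ] W => T (Ω y b)) e1
    have hdU : diff 𝕌 y X (Ω y b) = diff g₁ y Z := by
      have e1 := diff_clm_comp (ContinuousLinearMap.compL ℝ W (WithLp 2 (V × W)) V (fstCLM V W))
        (h𝕏d y hy) X
      rw [dg₁ y hy, ← hZ]
      exact congrArg (fun T : W →L[ℝ] V => T (Ω y b)) e1
    have hdΩ : diff Ω y X b = -Ω y (diff h y Z) := by
      have e1 : (fun z => A z (Ω z b)) =ᶠ[𝓝 y] fun _ => b := by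
        filter_upwards [hCo.mem_nhds hy] with z hz using hAΩ z hz b
      have e2 := diff_clm_apply (hAd y hy) (mdifferentiableAt_clm_apply (hΩd y hy)
        (mdifferentiableAt_const (c := b))) X
      rw [diff_congr e1, diff_const, hdA, diff_clm_apply (hΩd y hy) mdifferentiableAt_const,
        diff_const, map_zero, add_zero] at e2
      have e3 := congrArg (Ω y) e2
      rw [map_zero, map_add, hΩA y hy] at e3
      exact eq_neg_of_add_eq_zero_right e3.symm
    refine ⟨Z, hdΩ, ?_⟩
    have e1 : diff 𝔾 y X b = diff 𝕌 y X (Ω y b) + 𝕌 y (diff Ω y X b) :=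
      congrArg (fun T : W →L[ℝ] V => T b)
        (diff_bilin (ContinuousLinearMap.compL ℝ W W V) (h𝕌d y hy) (hΩd y hy) X)
    rw [e1, hdU, hdΩ, map_neg, ← sub_eq_add_neg]
    rfl
  have hdf : ∀ y ∈ C, ∀ X : TangentSpace (𝓡 n) y, diff f y X = τ y X - diff 𝔾 y X (h y) := by
    intro y hy X
    have e1 := diff_sub (hg₁d y hy) (mdifferentiableAt_clm_apply (h𝔾d y hy) (hhd y hy)) X
    rw [diff_clm_apply (h𝔾d y hy) (hhd y hy)] at e1
    refine e1.trans ?_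
    rw [hτ]
    abel
  -- the translation makes `h` vanish at `x₀`, so that `f` is an immersion near `x₀`
  have hdf₀ : ∀ X : TangentSpace (𝓡 n) x₀, diff f x₀ X = τ x₀ X := fun X => by
    have : h x₀ = 0 := sub_self _
    rw [hdf x₀ (mem_coordBall_self x₀ hr0), this, map_zero, sub_zero]
  have hx₀R : x₀ ∈ {x ∈ C | Function.Injective (diff (n := n) f x)} :=
    ⟨mem_coordBall_self x₀ hr0, fun X Y hXY => hτinj x₀ (mem_coordBall_self x₀ hr0)
      (by rw [← hdf₀, ← hdf₀, hXY])⟩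
  obtain ⟨r', hr'0, hr', hr'R⟩ :=
    exists_coordBall_subset (n := n) ((isOpen_regular hCo hf).mem_nhds hx₀R)
  have hUC : coordBall (n := n) x₀ r' ⊆ C := fun y hy => (hr'R hy).1
  refine ⟨coordBall (n := n) x₀ r', f, φ, 𝔾, Ω, -sndCLM V W (g x₀), mem_coordBall_self x₀ hr'0,
    simplyConnectedSpace_coordBall hr'0 hr', ⟨isOpen_coordBall x₀ r', hf.mono hUC, hφ.mono hUC,
      h𝔾.mono hUC, hΩ.mono hUC, fun y hy => ?_, fun y hy => hsymm y (hUC hy),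
      fun y hy X a b => ?_, fun y hy X a => ?_, fun y hy X a => ?_⟩,
    fun y hy => (hr'R hy).2, fun y hy => ?_⟩
  · obtain ⟨e, he⟩ := hinv y (hUC hy)
    exact ⟨e.symm, by simp only [Ω, ← he, ContinuousLinearMap.inverse_equiv]⟩
  · obtain ⟨Z, hZ, hZ'⟩ := hder y (hUC hy) X b
    rw [hZ, hZ', hinner y (hUC hy), inner_neg_right]
  · have e1 := diff_neg (mdifferentiableAt_clm_apply (hΩd y (hUC hy)) (hhd y (hUC hy))) X
    rw [diff_clm_apply (hΩd y (hUC hy)) (hhd y (hUC hy))] at e1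
    obtain ⟨Z, hZ, hZ'⟩ := hder y (hUC hy) X (h y)
    have e2 : diff φ y X = -(diff Ω y X (h y) + Ω y (diff h y X)) := e1
    rw [e2, hdf y (hUC hy), hZ', inner_sub_right, hinner y (hUC hy), hinner y (hUC hy), hZ,
      inner_neg_right, inner_add_right, inner_neg_right]
    ring
  · -- `df` and `τ` have the same image
    have : FiniteDimensional ℝ (TangentSpace (𝓡 n) y) :=
      inferInstanceAs (FiniteDimensional ℝ (EuclideanSpace ℝ (Fin n)))
    have hle : LinearMap.range (diff (n := n) f y) ≤ LinearMap.range (τ y) := by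
      rintro _ ⟨X, rfl⟩
      obtain ⟨Z, -, hZ⟩ := hder y (hUC hy) X (h y)
      exact ⟨X - Z, by rw [map_sub, hdf y (hUC hy), hZ]⟩
    have heq := Submodule.eq_of_le_of_finrank_le hle
      ((LinearMap.finrank_range_le _).trans (LinearMap.finrank_range_of_inj (hr'R hy).2).ge)
    obtain ⟨Z, -, hZ⟩ := hder y (hUC hy) X a
    obtain ⟨Z', hZ'⟩ := (heq.ge ⟨Z, rfl⟩ : τ y Z ∈ LinearMap.range (diff (n := n) f y))
    exact ⟨Z', by rw [hZ, hZ']⟩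
  · have e1 : (Ω y).inverse (φ y) = -h y := by
      obtain ⟨e, he⟩ := hinv y (hUC hy)
      have e2 : Ω y = (e.symm : W →L[ℝ] W) := by
        simp only [Ω, ← he, ContinuousLinearMap.inverse_equiv]
      have e3 : φ y = Ω y (-h y) := (map_neg (Ω y) (h y)).symm
      rw [e3, e2, ContinuousLinearMap.inverse_equiv]
      exact e.apply_symm_apply _
    rw [transform, e1, map_neg, neg_neg]
    have e4 : f y - -𝔾 y (h y) = g₁ y := by simp only [f]; abel
    rw [e4]
    refine congrArg (WithLp.toLp 2) (Prod.ext (add_zero _) ?_)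
    exact (sub_eq_add_neg _ _).symm

end Recover


section Converse

variable {n m : ℕ} {M : Type*} [TopologicalSpace M] [ChartedSpace (EuclideanSpace ℝ (Fin n)) M]
  {V : Type*} [NormedAddCommGroup V] [InnerProductSpace ℝ V]

theorem inner_ofColumns {v : Fin m → V} (hv : Orthonormal ℝ v) (a b : EuclideanSpace ℝ (Fin m)) :
    inner ℝ (ofColumns v a) (ofColumns v b) = inner ℝ a b := by
  rw [ofColumns_apply, ofColumns_apply, hv.inner_sum, PiLp.inner_apply]
  exact Finset.sum_congr rfl fun i _ => mul_comm _ _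

theorem orthonormal_smul_sign {v : Fin m → V} (hv : Orthonormal ℝ v) {ε : Fin m → ℝ}
    (hε : ∀ i, ε i * ε i = 1) : Orthonormal ℝ fun i => ε i • v i := by
  rw [orthonormal_iff_ite] at hv ⊢
  intro i j
  rw [inner_smul_left, inner_smul_right, hv]
  split_ifs with h
  · rw [← h, mul_one]
    exact hε i
  · simp

/-- The signs of the frame can be chosen such that `𝕎 + 1` is invertible at a given point. -/
theorem exists_isInvertible_sndCLM_add_id
    (v : Fin m → WithLp 2 (V × EuclideanSpace ℝ (Fin m))) :
    ∃ ε : Fin m → ℝ, (∀ i, ε i * ε i = 1) ∧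
      (sndCLM V (EuclideanSpace ℝ (Fin m)) ∘L ofColumns (fun i => ε i • v i)
        + ContinuousLinearMap.id ℝ (EuclideanSpace ℝ (Fin m))).IsInvertible := by
  let A : Matrix (Fin m) (Fin m) ℝ := Matrix.of fun i j =>
    sndCLM V (EuclideanSpace ℝ (Fin m)) (v j) i
  obtain ⟨ε, hε, hA⟩ := exists_isUnit_add_diagonal A
  refine ⟨ε, hε, ?_⟩
  -- with `D` the diagonal matrix of the signs, `𝕎 + 1 = A D + 1 = (A + D) D`
  have hD : Matrix.diagonal ε * Matrix.diagonal ε = 1 := by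
    rw [Matrix.diagonal_mul_diagonal]
    simp_rw [hε]
    exact Matrix.diagonal_one
  have hU := hA.mul (IsUnit.of_mul_eq_one _ hD)
  have heq : sndCLM V (EuclideanSpace ℝ (Fin m)) ∘L ofColumns (fun i => ε i • v i)
      + ContinuousLinearMap.id ℝ (EuclideanSpace ℝ (Fin m))
      = Matrix.toEuclideanCLM (𝕜 := ℝ) ((A + Matrix.diagonal ε) * Matrix.diagonal ε) := by
    rw [toEuclideanCLM_eq_ofColumns, add_mul, hD]
    refine (ofColumns_apply_single _).symm.trans (congrArg ofColumns (funext fun j => ?_))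
    rw [add_apply, ContinuousLinearMap.comp_apply, ofColumns_single, map_smul]
    ext i
    simp [A, Matrix.one_apply, mul_comm]
  rw [heq]
  exact isInvertible_toEuclideanCLM hU

variable [IsManifold (𝓡 n) ∞ M]

/-- A submanifold with a parallel flat normal subbundle is locally a transform. -/
theorem IsParallelFlatNormalSubbundle.exists_isTransformData
    {g : M → WithLp 2 (V × EuclideanSpace ℝ (Fin m))}
    {E : M → Submodule ℝ (WithLp 2 (V × EuclideanSpace ℝ (Fin m)))} {S : Set M}
    (hg : IsSmoothImmersionOn (n := n) g S)
    (hE : IsParallelFlatNormalSubbundle (n := n) g S m E) {x : M} (hx : x ∈ S) :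
    ∃ (U : Set M) (f : M → V) (φ : M → EuclideanSpace ℝ (Fin m))
      (𝔾 : M → EuclideanSpace ℝ (Fin m) →L[ℝ] V)
      (Ω : M → EuclideanSpace ℝ (Fin m) →L[ℝ] EuclideanSpace ℝ (Fin m))
      (c : EuclideanSpace ℝ (Fin m)),
      x ∈ U ∧ SimplyConnectedSpace U ∧ IsTransformData (n := n) U f φ 𝔾 Ω ∧
      (∀ x ∈ U, Function.Injective (diff (n := n) f x)) ∧
      ∀ y ∈ U, g y + WithLp.toLp 2 (0, c) = transform f φ 𝔾 Ω y := by
  obtain ⟨B, ξ, hB, hxB, hBS, hξs, hξo, hξn, hξt⟩ := hE.exists_parallel_frame hg hx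
  obtain ⟨ε, hε, hinv⟩ := exists_isInvertible_sndCLM_add_id fun i => ξ i x
  have hs : ∀ i, ContMDiffOn (𝓡 n) 𝓘(ℝ, WithLp 2 (V × EuclideanSpace ℝ (Fin m))) ∞
      (fun y => ε i • ξ i y) B := fun i => contMDiffOn_smul' contMDiffOn_const (hξs i)
  refine EuclSubmfd.exists_isTransformData hB
    ⟨hg.smooth.mono hBS, fun y hy => hg.injective y (hBS hy)⟩
    (𝕏 := fun y => ofColumns fun i => ε i • ξ i y) (contMDiffOn_ofColumns hs)
    (fun y hy => inner_ofColumns (orthonormal_smul_sign (hξo y hy) hε)) (fun y hy b X => ?_)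
    (fun y hy X b => ?_) hxB hinv
  · rw [ofColumns_apply, sum_inner]
    exact Finset.sum_eq_zero fun i _ => by simp [inner_smul_left, hξn i y hy X]
  · choose Z hZ using fun i => hξt i y hy X
    refine ⟨∑ i, b i • ε i • Z i, ?_⟩
    rw [diff_ofColumns (fun i => mdifferentiableAt_of_contMDiffOn hB (hs i) hy), ofColumns_apply,
      map_sum]
    refine Finset.sum_congr rfl fun i _ => ?_
    rw [diff_smul mdifferentiableAt_const (mdifferentiableAt_of_contMDiffOn hB (hξs i) hy),
      diff_const, zero_smul, zero_add, hZ, map_smul, map_smul]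

end Converse

end EuclSubmfd

end Auxiliary

theorem theorem18 (n p m : ℕ) (M : Type*) [TopologicalSpace M] [T2Space M]
    [SecondCountableTopology M] [ChartedSpace (EuclideanSpace ℝ (Fin n)) M]
    [IsManifold (𝓡 n) ∞ M] :
    -- direct part
    (∀ (S : Set M) (f : M → EuclideanSpace ℝ (Fin (n + p))) (φ : Fin m → M → ℝ)
        (β : Fin m → M → EuclideanSpace ℝ (Fin (n + p))), IsData (n := n) S f φ β →
      -- existence of `Ω` near every point
      (∀ x ∈ S, ∃ U : Set M, IsOpen U ∧ x ∈ U ∧ U ⊆ S ∧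
        ∃ Ω : M → Matrix (Fin m) (Fin m) ℝ, IsSolution (n := n) U f φ β Ω) ∧
      -- every solution `Ω` gives, at the regular points, an immersion as claimed
      (∀ (U : Set M) (Ω : M → Matrix (Fin m) (Fin m) ℝ), IsOpen U → U ⊆ S →
        IsSolution (n := n) U f φ β Ω →
        ∀ R : Set M,
          R = {x ∈ U | Function.Injective (diff (n := n) (ribaucourMap (n := n) f φ β Ω) x)} →
          IsOpen R ∧ IsSmoothImmersionOn (n := n) (ribaucourMap (n := n) f φ β Ω) R ∧
          ∃ E : M → Submodule ℝ (WithLp 2 (EuclideanSpace ℝ (Fin (n + p)) ×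
              EuclideanSpace ℝ (Fin m))),
            IsParallelFlatNormalSubbundle (n := n) (ribaucourMap (n := n) f φ β Ω) R m E)) ∧
    -- converse
    (∀ (g : M → WithLp 2 (EuclideanSpace ℝ (Fin (n + p)) × EuclideanSpace ℝ (Fin m)))
        (E : M → Submodule ℝ (WithLp 2 (EuclideanSpace ℝ (Fin (n + p)) ×
          EuclideanSpace ℝ (Fin m)))),
      IsSmoothImmersionOn (n := n) g Set.univ →
      IsParallelFlatNormalSubbundle (n := n) g Set.univ m E →
      ∀ x : M, ∃ (U : Set M) (f : M → EuclideanSpace ℝ (Fin (n + p))) (φ : Fin m → M → ℝ)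
        (β : Fin m → M → EuclideanSpace ℝ (Fin (n + p))) (Ω : M → Matrix (Fin m) (Fin m) ℝ)
        (c : EuclideanSpace ℝ (Fin m)),
        x ∈ U ∧ IsData (n := n) U f φ β ∧ IsSolution (n := n) U f φ β Ω ∧
        ∀ y ∈ U, g y + WithLp.toLp 2 (0, c) = ribaucourMap (n := n) f φ β Ω y) := by
  refine ⟨fun S f φ β hD => ⟨fun x hx => hD.exists_isSolution hx, ?_⟩, ?_⟩
  · rintro U Ω hU hUS hΩ R rfl
    have hT := hD.isTransformData hU hUS hΩ
    rw [ribaucourMap_eq_transform]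
    have hR := isOpen_regular hU hT.contMDiffOn_transform
    exact ⟨hR, ⟨hT.contMDiffOn_transform.mono fun x hx => hx.1, fun x hx => hx.2⟩,
      hT.exists_isParallelFlatNormalSubbundle (EuclideanSpace.basisFun (Fin m) ℝ) hR
        (fun x hx => hx.1) fun x hx => hx.2⟩
  · intro g E hg hE x
    obtain ⟨U, f, φ, 𝔾, Ω, c, hxU, hUsc, hT, hf, heq⟩ :=
      hE.exists_isTransformData hg (Set.mem_univ x)
    obtain ⟨φ', β, Ω', hD, hΩ, hmap⟩ := hT.exists_isData hUsc hf
    exact ⟨U, f, φ', β, Ω', c, hxU, hD, hΩ, fun y hy => by rw [hmap, heq y hy]⟩
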